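/- Elliptic and div-curl estimates for $\tilde r$ and $\tilde u$. Setting. Let $\gamma>1$, $T>0$, and use Cartesian coordinates $(t,x)$ on $\mathbb R^{1+3}$ with the Minkowski metric $g=\mathrm{diag}(-1,1,1,1)$; Greek indices run over $0,\dots,3$, Latin ones over $1,2,3$, repeated indices are summed, and indices are lowered with $g$. For each $t\in[0,T]$ let $\Omega_t\subset\mathbb R^3$ be open, and let $\mathscr D=\bigcup_{0\le t\le T}\{t\}\times\Omega_t$. Let $(s,r,u)$ be functions on $\mathscr D$ ($s,r$ real-valued, $u=(u^0,\dots,u^3)$) that are smooth up to the boundary with bounded derivatives of all orders, i.e. restrictions to $\mathscr D$ of smooth functions on $\mathbb R^{1+3}$ all of whose derivatives (including order $0$) are bounded (for bounded $\mathscr D$ this just means $C^\infty(\overline{\mathscr D})$). Assume that $g_{\alpha\beta}u^\alpha u^\beta=-1$, $u^0>0$ and $r>0$ on $\mathscr D$, and that the physical vacuum boundary condition holds: there are $c_1,c_2>0$ with $c_1\,\mathrm{dist}(x,\partial\Omega_t)\le r(t,x)\le c_2\,\mathrm{dist}(x,\partial\Omega_t)$ for all $t\in[0,T]$, $x\in\Omega_t$.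 (In particular, $(s,r,u)$ may be such a smooth background solution of the relativistic Euler equations of an ideal gas with physical vacuum boundary.) Put $\Gamma(s)=\dfrac{(\gamma-1)^{(\gamma-1)/\gamma}}{\gamma\,e^{(\gamma-1)s/\gamma}}$, $\;H^{ij}=\delta^{ij}-\dfrac{u^iu^j}{(u^0)^2}$, $\;B^{\alpha i}=g^{\alpha i}-g^{\alpha 0}\dfrac{u^i}{u^0}$, and $$\tilde L_1\tilde r=\frac{\gamma-1}{\Gamma+r}H^{ij}\Big(r\,\partial_i\partial_j\tilde r+\frac1{\gamma-1}\partial_i r\,\partial_j\tilde r\Big),$$ $$(\tilde L_2\tilde u)^\alpha=\frac{\gamma-1}{\Gamma+r}B^{\alpha i}H^{jk}\Big(\partial_i(r\,\partial_j\tilde u_k)+\frac1{\gamma-1}\partial_j r\,\partial_i\tilde u_k\Big),$$ $$(\tilde L_3\tilde u)^\alpha=\frac{\gamma-1}{\Gamma+r}B^{\alpha i}\,r^{-\frac1{\gamma-1}}H^{ml}\,\partial_l\Big(r^{1+\frac1{\gamma-1}}(\partial_m\tilde u_i-\partial_i\tilde u_m)\Big).$$ At fixed $t$ let $\|f\|_{L^2(h)}^2=\int_{\Omega_t}h|f|^2\,dx$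 and let $H^{j,\sigma}$ be the space of distributions on $\Omega_t$ with finite norm $\|f\|_{H^{j,\sigma}}^2=\sum_{|\alpha|\le j}\|r^\sigma\partial^\alpha f\|_{L^2(\Omega_t)}^2$ (weak derivatives in $x$); for spacetime vector fields the squared norms of the four Cartesian components are added. Then there is a constant $C$, depending only on $\gamma$, $T$ and the background $(\Omega_t)_{t\in[0,T]},s,r,u$, such that for every $t\in[0,T]$ the following hold. (i) For every $\tilde r\in H^{2,\frac1{2(\gamma-1)}+\frac12}$, $$\|\tilde r\|_{H^{2,\frac1{2(\gamma-1)}+\frac12}}\le C\Big(\|\tilde L_1\tilde r\|_{H^{0,\frac1{2(\gamma-1)}-\frac12}}+\|\tilde r\|_{L^2(r^{\frac{2-\gamma}{\gamma-1}})}\Big).$$ (ii) For every vector field $\tilde u=(\tilde u^0,\dots,\tilde u^3)$ with components in $H^{2,\frac1{2(\gamma-1)}+1}$ and $u_\alpha\tilde u^\alpha=0$ a.e. on $\Omega_t$, $$\|\tilde u\|_{H^{2,\frac1{2(\gamma-1)}+1}}\le C\Big(\|(\tilde L_2+\tilde L_3)\tilde u\|_{H^{0,\frac1{2(\gamma-1)}}}+\|\tilde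 u\|_{L^2(r^{\frac1{\gamma-1}})}\Big).$$ -/

import Mathlib

open MeasureTheory Set
open scoped ENNReal NNReal ContDiff

noncomputable section

namespace VacuumEuler

/-- The spatial slice `ℝ³`, with Cartesian coordinates `x 0, x 1, x 2`. -/
abbrev Space := EuclideanSpace ℝ (Fin 3)

/-! ### Weak derivatives and weighted Sobolev norms -/

/-- The classical partial derivative `∂_i φ`. -/
def pd (i : Fin 3) (φ : Space → ℝ) : Space → ℝ :=
  fun x => fderiv ℝ φ x (EuclideanSpace.single i 1)

/-- The classical partial derivative `∂^α φ` of a multi-index `α`. -/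
def multiPd (α : Fin 3 → ℕ) (φ : Space → ℝ) : Space → ℝ :=
  (pd 0)^[α 0] ((pd 1)^[α 1] ((pd 2)^[α 2] φ))

/-- Test functions on the open set `Ω`: elements of `C_c^∞(Ω)`. -/
def IsTestFunction (Ω : Set Space) (φ : Space → ℝ) : Prop :=
  ContDiff ℝ ∞ φ ∧ HasCompactSupport φ ∧ tsupport φ ⊆ Ω

/-- `g` is the distributional derivative `∂^α f` on the open set `Ω`. -/
def IsWeakDeriv (Ω : Set Space) (α : Fin 3 → ℕ) (f g : Space → ℝ) : Prop :=
  LocallyIntegrableOn f Ω volume ∧ LocallyIntegrableOn g Ω volume ∧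
    ∀ φ : Space → ℝ, IsTestFunction Ω φ →
      ∫ x in Ω, f x * multiPd α φ x = (-1) ^ (∑ i, α i) * ∫ x in Ω, g x * φ x

open Classical in
/-- The weak derivative `∂^α f` on `Ω` (unique up to a null set when it exists). -/
def weakDeriv (Ω : Set Space) (α : Fin 3 → ℕ) (f : Space → ℝ) : Space → ℝ :=
  if h : ∃ g, IsWeakDeriv Ω α f g then h.choose else 0

/-- The multi-index of the first-order derivative `∂_i`. -/
def e (i : Fin 3) : Fin 3 → ℕ := Pi.single i 1

/-- The multi-indices `α` with `|α| ≤ j`. -/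
def multiIndices (j : ℕ) : Finset (Fin 3 → ℕ) :=
  (Fintype.piFinset fun _ => Finset.range (j + 1)).filter fun α => ∑ i, α i ≤ j

open Classical in
/-- The weighted Sobolev norm
`‖f‖_{H^{j,σ}} = (∑_{|α| ≤ j} ‖r^σ ∂^α f‖²_{L²(Ω)})^{1/2}`, with value `∞` when some derivative
is not a locally integrable function. -/
def hNorm (Ω : Set Space) (r : Space → ℝ) (j : ℕ) (σ : ℝ) (f : Space → ℝ) : ℝ≥0∞ :=
  if ∀ α ∈ multiIndices j, ∃ g, IsWeakDeriv Ω α f g then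
    (∑ α ∈ multiIndices j,
      eLpNorm (fun x => r x ^ σ * weakDeriv Ω α f x) 2 (volume.restrict Ω) ^ 2) ^ (1 / 2 : ℝ)
  else ⊤

/-- Membership in the weighted Sobolev space `H^{j,σ}`. -/
def MemH (Ω : Set Space) (r : Space → ℝ) (j : ℕ) (σ : ℝ) (f : Space → ℝ) : Prop :=
  hNorm Ω r j σ f < ⊤

/-- The norm `‖f‖_{L²(h)} = (∫_Ω h |f|² dx)^{1/2}` with weight `h`. -/
def weightedL2Norm (Ω : Set Space) (h f : Space → ℝ) : ℝ≥0∞ :=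
  (∫⁻ x in Ω, ENNReal.ofReal (h x * |f x| ^ 2)) ^ (1 / 2 : ℝ)

/-- The `H^{j,σ}` norm of a spacetime vector field, through its Cartesian components. -/
def vecHNorm (Ω : Set Space) (r : Space → ℝ) (j : ℕ) (σ : ℝ) (X : Space → Fin 4 → ℝ) : ℝ≥0∞ :=
  (∑ μ, hNorm Ω r j σ (fun x => X x μ) ^ 2) ^ (1 / 2 : ℝ)

/-- The `L²(h)` norm of a spacetime vector field, through its Cartesian components. -/
def vecWeightedL2Norm (Ω : Set Space) (h : Space → ℝ) (X : Space → Fin 4 → ℝ) : ℝ≥0∞ :=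
  (∑ μ, weightedL2Norm Ω h (fun x => X x μ) ^ 2) ^ (1 / 2 : ℝ)

/-! ### The Minkowski metric and the coefficients

Spacetime indices run over `Fin 4`, with `0` the time index; the spatial index `i : Fin 3` is the
spacetime index `i.succ`. -/

/-- The Minkowski metric `g = diag(-1, 1, 1, 1)`; it is also its own inverse. -/
def mink (μ ν : Fin 4) : ℝ := if μ = ν then (if μ = 0 then -1 else 1) else 0

/-- The Minkowski product `g_{μν} X^μ Y^ν`. -/
def minkProd (X Y : Fin 4 → ℝ) : ℝ := ∑ μ, ∑ ν, mink μ ν * X μ * Y ν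

/-- The lowered component `X_μ = g_{μν} X^ν`. -/
def lower (X : Fin 4 → ℝ) (μ : Fin 4) : ℝ := ∑ ν, mink μ ν * X ν

/-- `Γ(s) = (γ-1)^{(γ-1)/γ} / (γ e^{(γ-1)s/γ})`. -/
def Gam (γ s : ℝ) : ℝ := (γ - 1) ^ ((γ - 1) / γ) / (γ * Real.exp ((γ - 1) / γ * s))

/-- `H^{ij} = δ^{ij} - u^i u^j / (u^0)²`. -/
def Hmat (u : Fin 4 → ℝ) (i j : Fin 3) : ℝ :=
  (if i = j then 1 else 0) - u i.succ * u j.succ / (u 0) ^ 2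

/-- `B^{μi} = g^{μi} - g^{μ0} u^i / u^0`. -/
def Bmat (u : Fin 4 → ℝ) (μ : Fin 4) (i : Fin 3) : ℝ :=
  mink μ i.succ - mink μ 0 * (u i.succ / u 0)

/-! ### The spatial operators on a fixed time slice -/

/-- `L̃₁ f = (γ-1)/(Γ+r) H^{ij} (r ∂_i ∂_j f + 1/(γ-1) ∂_i r ∂_j f)`. -/
def L1 (γ : ℝ) (Ω : Set Space) (s r : Space → ℝ) (u : Space → Fin 4 → ℝ) (f : Space → ℝ) :
    Space → ℝ := fun x =>
  (γ - 1) / (Gam γ (s x) + r x) * ∑ i, ∑ j, Hmat (u x) i j *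
    (r x * weakDeriv Ω (e i + e j) f x + 1 / (γ - 1) * pd i r x * weakDeriv Ω (e j) f x)

/-- `(L̃₂ v)^μ = (γ-1)/(Γ+r) B^{μi} H^{jk} (∂_i (r ∂_j v_k) + 1/(γ-1) ∂_j r ∂_i v_k)`. -/
def L2 (γ : ℝ) (Ω : Set Space) (s r : Space → ℝ) (u v : Space → Fin 4 → ℝ) :
    Space → Fin 4 → ℝ := fun x μ =>
  (γ - 1) / (Gam γ (s x) + r x) * ∑ i, ∑ j, ∑ k, Bmat (u x) μ i * Hmat (u x) j k *
    (weakDeriv Ω (e i)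
        (fun y => r y * weakDeriv Ω (e j) (fun z => lower (v z) k.succ) y) x
      + 1 / (γ - 1) * pd j r x * weakDeriv Ω (e i) (fun z => lower (v z) k.succ) x)

/-- `(L̃₃ v)^μ = (γ-1)/(Γ+r) B^{μi} r^{-1/(γ-1)} H^{ml} ∂_l (r^{1+1/(γ-1)} (∂_m v_i - ∂_i v_m))`. -/
def L3 (γ : ℝ) (Ω : Set Space) (s r : Space → ℝ) (u v : Space → Fin 4 → ℝ) :
    Space → Fin 4 → ℝ := fun x μ =>
  (γ - 1) / (Gam γ (s x) + r x) * ∑ i, ∑ m, ∑ l,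
    Bmat (u x) μ i * r x ^ (-(1 / (γ - 1))) * Hmat (u x) m l *
      weakDeriv Ω (e l) (fun y => r y ^ (1 + 1 / (γ - 1)) *
        (weakDeriv Ω (e m) (fun z => lower (v z) i.succ) y
          - weakDeriv Ω (e i) (fun z => lower (v z) m.succ) y)) x

/-! ### The background -/

/-- The moving domain `⋃_{0 ≤ t ≤ T} {t} × Ω_t`. -/
def movingDomain (T : ℝ) (Ω : ℝ → Set Space) : Set (ℝ × Space) :=
  {p | p.1 ∈ Icc 0 T ∧ p.2 ∈ Ω p.1}

/-- `f` is smooth on `D` up to the boundary, with bounded derivatives of every order: it is the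
restriction to `D` of a smooth function on spacetime all of whose derivatives are bounded.
(For bounded `D` the boundedness is automatic, by a cut-off.) -/
def SmoothUpToBoundary (D : Set (ℝ × Space)) (f : ℝ → Space → ℝ) : Prop :=
  ∃ F : ℝ × Space → ℝ, ContDiff ℝ ∞ F ∧
    (∀ n : ℕ, ∃ M : ℝ, ∀ p, ‖iteratedFDeriv ℝ n F p‖ ≤ M) ∧ ∀ p ∈ D, f p.1 p.2 = F p

/-- A smooth background `(s, r, u)` on the moving domain satisfying the physical vacuum boundary
condition: `u` is a future-directed unit timelike vector field and `r` is positive and comparable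
to the distance to the free boundary. -/
structure VacuumBackground (T : ℝ) (Ω : ℝ → Set Space) (s r : ℝ → Space → ℝ)
    (u : ℝ → Space → Fin 4 → ℝ) : Prop where
  isOpen : ∀ t ∈ Icc 0 T, IsOpen (Ω t)
  smooth_s : SmoothUpToBoundary (movingDomain T Ω) s
  smooth_r : SmoothUpToBoundary (movingDomain T Ω) r
  smooth_u : ∀ μ, SmoothUpToBoundary (movingDomain T Ω) (fun t x => u t x μ)
  unit_u : ∀ t ∈ Icc 0 T, ∀ x ∈ Ω t, minkProd (u t x) (u t x) = -1
  future_u : ∀ t ∈ Icc 0 T, ∀ x ∈ Ω t, 0 < u t x 0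
  pos_r : ∀ t ∈ Icc 0 T, ∀ x ∈ Ω t, 0 < r t x
  vacuum : ∃ c₁ c₂ : ℝ, 0 < c₁ ∧ 0 < c₂ ∧ ∀ t ∈ Icc 0 T, ∀ x ∈ Ω t,
    c₁ * Metric.infDist x (frontier (Ω t)) ≤ r t x ∧
      r t x ≤ c₂ * Metric.infDist x (frontier (Ω t))

end VacuumEuler

end

open VacuumEuler

/-!
# Weighted elliptic and div-curl estimates for the linearised Euler flow with vacuum boundary

Fix a time slice `Ω`. The function `r` vanishes to first order on `∂Ω`, so the operators are
degenerate: their principal part is `r H^{jk} ∂_j ∂_k`, and the first order terms carry the factor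
`∂r`. Both estimates are instances of one a priori bound, `frame_estimate`, for the system
`L_i = H^{jk} (r ∂_j ∂_k v_i + λ ∂_k r ∂_j v_i + θ (∂_i r ∂_j v_k - ∂_j r ∂_i v_k))`,
with `λ = 1/(γ-1)`, `θ = 0` for `L̃₁` and `λ = 1 + 1/(γ-1)`, `θ = 1` for `L̃₂ + L̃₃`. In the second
case the spatial components of `ũ` satisfy the system exactly (`divCurl_eq`), because the second
order parts of div and curl add up to `H^{jk} ∂_j ∂_k` (`divCurl_algebra`); the time component is a
combination of the spatial ones by `u_α ũ^α = 0`, with smooth bounded coefficients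
(`combination_jet_le`).

The metric `H` has the explicit smooth square root `S^{ij} = δ^{ij} - u^i u^j / (u⁰ (1 + u⁰))`.
The global frame `X_a = ∑_i S_{ai} ∂_i` turns `H^{jk} ∂_j ∂_k` into `∑_a X_a X_a` up to lower order
terms, so that no localisation or flattening of the boundary is needed. With `w_c = ∑_k S_{ck} v_k`,
`p_{ac} = X_a w_c`, `q_{abc} = X_a p_{bc}` and the conormal `n_a = X_a r`, three integrated
identities carry the proof:

* The multiplier `r^{λ-1} w_c` bounds `∫ r^λ |p|²` (`energy_bound`). The `θ`-term has the structure
  of a null form: integrating `λ r^{λ-1} (n_c p_{aa} - n_a p_{ca}) w_c` by parts, with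
  `λ r^{λ-1} n_a = X_a (r^λ)`, produces no second derivatives except commutators. The resulting
  quadratic form `|p|² + (θ/λ) ((∑_a p_{aa})² - ∑_{a,c} p_{ac} p_{ca})` is at least `(1 - θ/λ) |p|²`,
  and `θ < λ` in both cases.
* The multiplier `r^{λ-1} (∑_a n_a p_{ac} + β (n_c ∑_a p_{aa} + ∑_a n_a p_{ca}))`, with a suitable
  constant `β`, produces a quadratic form in `p` which is positive definite where `n ≠ 0`
  (`gradForm_lower`); as `|∇r|` is bounded below near `∂Ω`, and the first step covers the region
  away from `∂Ω`, this bounds `∫ r^{λ-1} |p|²` (`gradient_bound`).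
* Squaring the principal part and exchanging derivatives through the null form
  `X_a g X_b h - X_b g X_a h` bounds `∫ r^{λ+1} |q|²` (`hessian_bound`).

For functions with only `∫ r^{λ+1} (|v|² + |∂v|² + |∂²v|²) < ∞` these integrations by parts have no
boundary terms: a cut-off `χ_n` with `|∇χ_n| = O(1/r)` reduces the matter to the integrability of
the flux divided by `r` (`VacuumFrame.integral_eq_zero`), and that follows from the Hardy inequality
`VacuumFrame.hardy`, which gives `∫ r^{λ-1} |∂v|² < ∞`. All constants depend only on bounds for the
background up to second order and on its nondegeneracy, which are uniform in time
(`VacuumBackground.exists_vacuumFrame`).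
-/

noncomputable section

namespace VacuumEuler

open Filter Topology Convolution

/-! ### Mollification in `L²` -/

/-- Jensen's inequality for averages with respect to a bump function. -/
theorem enorm_sq_convolution_le (φ : ContDiffBump (0 : Space)) {g : Space → ℝ}
    (hg : StronglyMeasurable g) (x : Space) :
    ‖(φ.normed volume ⋆[ContinuousLinearMap.lsmul ℝ ℝ, volume] g) x‖ₑ ^ 2
      ≤ ∫⁻ t, ENNReal.ofReal (φ.normed volume t) * ‖g (x - t)‖ₑ ^ 2 := by
  have hρm : Measurable (fun t => ENNReal.ofReal (φ.normed volume t)) :=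
    (φ.continuous_normed.measurable).ennreal_ofReal
  have hone : ∫⁻ t, ENNReal.ofReal (φ.normed volume t) = 1 := by
    rw [← ofReal_integral_eq_lintegral_ofReal φ.integrable_normed
      (Eventually.of_forall fun t => φ.nonneg_normed t), φ.integral_normed]
    simp
  have hgm : Measurable (fun t => ‖g (x - t)‖ₑ) :=
    (hg.measurable.comp (measurable_const.sub measurable_id)).enorm
  have h1 : ‖(φ.normed volume ⋆[ContinuousLinearMap.lsmul ℝ ℝ, volume] g) x‖ₑ
      ≤ ∫⁻ t, ENNReal.ofReal (φ.normed volume t) * ‖g (x - t)‖ₑ := by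
    rw [convolution_def]
    refine (enorm_integral_le_lintegral_enorm _).trans (le_of_eq ?_)
    refine lintegral_congr fun t => ?_
    simp only [ContinuousLinearMap.lsmul_apply, smul_eq_mul, enorm_mul]
    rw [Real.enorm_of_nonneg (φ.nonneg_normed t)]
  have h2 := ENNReal.lintegral_mul_le_Lp_mul_Lq volume Real.HolderConjugate.two_two
    (f := fun t => ENNReal.ofReal (φ.normed volume t) ^ (1 / 2 : ℝ))
    (g := fun t => ENNReal.ofReal (φ.normed volume t) ^ (1 / 2 : ℝ) * ‖g (x - t)‖ₑ)
    (hρm.pow_const _).aemeasurable ((hρm.pow_const _).mul hgm).aemeasurable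
  have hhalf : ∀ a : ℝ≥0∞, (a ^ (1 / 2 : ℝ)) ^ (2 : ℝ) = a := fun a => by
    rw [← ENNReal.rpow_mul]; norm_num
  have hhalf' : ∀ a : ℝ≥0∞, a ^ (1 / 2 : ℝ) * a ^ (1 / 2 : ℝ) = a := fun a => by
    rw [← ENNReal.rpow_add_of_nonneg _ _ (by norm_num) (by norm_num)]; norm_num
  simp only [Pi.mul_apply, ← mul_assoc, hhalf', ENNReal.mul_rpow_of_nonneg _ _ zero_le_two, hhalf,
    hone, ENNReal.one_rpow, one_mul] at h2
  calc _ ≤ ((∫⁻ t, ENNReal.ofReal (φ.normed volume t) * ‖g (x - t)‖ₑ ^ (2 : ℝ)) ^ (1 / 2 : ℝ)) ^ 2 :=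
        pow_le_pow_left₀ (zero_le) (h1.trans h2) 2
    _ = _ := by
        rw [← ENNReal.rpow_natCast, Nat.cast_ofNat, hhalf]
        simp only [ENNReal.rpow_two]

/-- Averaging against a normalised bump function is a contraction of `L²`. -/
theorem eLpNorm_convolution_le (φ : ContDiffBump (0 : Space)) {g : Space → ℝ}
    (hg : AEStronglyMeasurable g volume) :
    eLpNorm (φ.normed volume ⋆[ContinuousLinearMap.lsmul ℝ ℝ, volume] g) 2 volume
      ≤ eLpNorm g 2 volume := by
  wlog h : StronglyMeasurable g generalizing g
  · have := this hg.stronglyMeasurable_mk.aestronglyMeasurable hg.stronglyMeasurable_mk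
    rw [← eLpNorm_congr_ae hg.ae_eq_mk] at this
    rwa [convolution_congr _ (EventuallyEq.refl _ _) hg.ae_eq_mk]
  have hρm : Measurable (fun t => ENNReal.ofReal (φ.normed volume t)) :=
    (φ.continuous_normed.measurable).ennreal_ofReal
  have hone : ∫⁻ t, ENNReal.ofReal (φ.normed volume t) = 1 := by
    rw [← ofReal_integral_eq_lintegral_ofReal φ.integrable_normed
      (Eventually.of_forall fun t => φ.nonneg_normed t), φ.integral_normed]
    simp
  rw [eLpNorm_eq_lintegral_rpow_enorm_toReal (by norm_num) (by norm_num),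
    eLpNorm_eq_lintegral_rpow_enorm_toReal (by norm_num) (by norm_num)]
  simp only [ENNReal.toReal_ofNat, ENNReal.rpow_two]
  refine ENNReal.rpow_le_rpow ?_ (by norm_num)
  calc _ ≤ ∫⁻ x, ∫⁻ t, ENNReal.ofReal (φ.normed volume t) * ‖g (x - t)‖ₑ ^ 2 :=
        lintegral_mono fun x => enorm_sq_convolution_le φ h x
    _ = ∫⁻ t, ∫⁻ x, ENNReal.ofReal (φ.normed volume t) * ‖g (x - t)‖ₑ ^ 2 := by
        refine lintegral_lintegral_swap (Measurable.aemeasurable ?_)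
        exact (hρm.comp measurable_snd).mul
          ((h.measurable.comp (measurable_fst.sub measurable_snd)).enorm.pow_const 2)
    _ = ∫⁻ t, ENNReal.ofReal (φ.normed volume t) * ∫⁻ x, ‖g x‖ₑ ^ 2 := by
        refine lintegral_congr fun t => ?_
        have hm : Measurable fun x => ‖g (x - t)‖ₑ ^ 2 :=
          ((h.measurable.comp (measurable_id.sub measurable_const)).enorm.pow_const 2)
        rw [lintegral_const_mul _ hm, lintegral_sub_right_eq_self (fun x => ‖g x‖ₑ ^ 2) t]
    _ = _ := by rw [lintegral_mul_const _ hρm, hone, one_mul]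

/-- Mollifications converge in `L²`: clear for continuous functions of compact support, which are
dense, and mollification is a contraction. -/
theorem tendsto_eLpNorm_convolution_sub {φ : ℕ → ContDiffBump (0 : Space)}
    (hφ : Tendsto (fun n => (φ n).rOut) atTop (𝓝 0)) {g : Space → ℝ} (hg : MemLp g 2 volume) :
    Tendsto (fun n => eLpNorm
      (((φ n).normed volume ⋆[ContinuousLinearMap.lsmul ℝ ℝ, volume] g) - g) 2 volume)
      atTop (𝓝 0) := by
  rw [ENNReal.tendsto_nhds_zero]
  intro ε hε
  obtain ⟨δ, hδ, hδε⟩ : ∃ δ : ℝ≥0∞, 0 < δ ∧ δ + δ + δ ≤ ε := by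
    refine ⟨ε / 3, ENNReal.div_pos hε.ne' (by norm_num), le_of_eq ?_⟩
    exact ENNReal.add_thirds ε
  obtain ⟨k, hkc, hgk, hkcont, hkL⟩ :=
    hg.exists_hasCompactSupport_eLpNorm_sub_le (by norm_num) hδ.ne'
  -- the compact set which carries `k` and its mollifications of radius at most one
  set K := Metric.cthickening 1 (tsupport k) with hK
  have hKc : IsCompact K := hkc.isCompact.cthickening
  obtain ⟨η, hη, hηδ⟩ : ∃ η : ℝ, 0 < η ∧ volume K ^ (1 / 2 : ℝ) * ENNReal.ofReal η ≤ δ := by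
    have hfin : volume K ^ (1 / 2 : ℝ) ≠ ⊤ :=
      ENNReal.rpow_ne_top_of_nonneg (by norm_num) hKc.measure_lt_top.ne
    have : Tendsto (fun η : ℝ => volume K ^ (1 / 2 : ℝ) * ENNReal.ofReal η) (𝓝[>] 0) (𝓝 0) := by
      have h0 : Tendsto (fun η : ℝ => volume K ^ (1 / 2 : ℝ) * ENNReal.ofReal η) (𝓝 0)
          (𝓝 (volume K ^ (1 / 2 : ℝ) * ENNReal.ofReal 0)) :=
        ENNReal.Tendsto.const_mul (ENNReal.continuous_ofReal.tendsto 0) (Or.inr hfin)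
      simpa using h0.mono_left nhdsWithin_le_nhds
    obtain ⟨η, h1, h2⟩ :=
      ((ENNReal.tendsto_nhds_zero.1 this δ hδ).and self_mem_nhdsWithin).exists
    exact ⟨η, h2, h1⟩
  obtain ⟨d, hd, hdk⟩ := Metric.uniformContinuous_iff.1
    (hkc.uniformContinuous_of_continuous hkcont) η hη
  have hsmall : ∀ᶠ n in atTop, (φ n).rOut < min d 1 :=
    hφ.eventually_lt_const (by positivity)
  filter_upwards [hsmall] with n hn
  have hlg : ∀ {f : Space → ℝ}, MemLp f 2 volume →
      ConvolutionExists ((φ n).normed volume) f (ContinuousLinearMap.lsmul ℝ ℝ) volume :=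
    fun hf => (φ n).hasCompactSupport_normed.convolutionExists_left _ (φ n).continuous_normed
      (hf.locallyIntegrable (by norm_num))
  have hmeas : ∀ {f : Space → ℝ}, MemLp f 2 volume →
      AEStronglyMeasurable ((φ n).normed volume ⋆[ContinuousLinearMap.lsmul ℝ ℝ, volume] f) volume :=
    fun hf => ((φ n).hasCompactSupport_normed.continuous_convolution_left _
      (φ n).continuous_normed (hf.locallyIntegrable (by norm_num))).aestronglyMeasurable
  have hdecomp : ((φ n).normed volume ⋆[ContinuousLinearMap.lsmul ℝ ℝ, volume] g) - g
      = ((φ n).normed volume ⋆[ContinuousLinearMap.lsmul ℝ ℝ, volume] (g - k))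
        + (((φ n).normed volume ⋆[ContinuousLinearMap.lsmul ℝ ℝ, volume] k) - k) + (k - g) := by
    have : (φ n).normed volume ⋆[ContinuousLinearMap.lsmul ℝ ℝ, volume] g
      = ((φ n).normed volume ⋆[ContinuousLinearMap.lsmul ℝ ℝ, volume] (g - k))
        + ((φ n).normed volume ⋆[ContinuousLinearMap.lsmul ℝ ℝ, volume] k) := by
      rw [← ConvolutionExists.distrib_add (hlg (hg.sub hkL)) (hlg hkL), sub_add_cancel]
    rw [this]; abel
  have hmid : eLpNorm (((φ n).normed volume ⋆[ContinuousLinearMap.lsmul ℝ ℝ, volume] k) - k)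
      2 volume ≤ δ := by
    have hpt : ∀ x, ‖(((φ n).normed volume ⋆[ContinuousLinearMap.lsmul ℝ ℝ, volume] k) - k) x‖
        ≤ η := fun x => by
      rw [Pi.sub_apply, ← dist_eq_norm]
      refine ContDiffBump.dist_normed_convolution_le hkcont.aestronglyMeasurable fun y hy => ?_
      exact (hdk ((Metric.mem_ball.1 hy).trans (hn.trans_le (min_le_left _ _)))).le
    have hsupp : ∀ x, x ∉ K →
        (((φ n).normed volume ⋆[ContinuousLinearMap.lsmul ℝ ℝ, volume] k) - k) x = 0 := by
      intro x hx
      have hfar : ∀ y, dist y x < 1 → k y = 0 := fun y hy => by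
        by_contra hne
        refine hx (Metric.mem_cthickening_of_dist_le x y 1 _ (subset_tsupport k hne) ?_)
        rw [dist_comm]; exact hy.le
      have hx0 : k x = 0 := hfar x (by simp)
      have := (φ n).normed_convolution_eq_right (μ := volume) (g := k) (x₀ := x) fun y hy => by
        rw [hx0, hfar y ((Metric.mem_ball.1 hy).trans (hn.trans_le (min_le_right _ _)))]
      simp [this]
    rw [← eLpNorm_restrict_eq_of_support_subset (s := K)
      (fun x hx => by_contra fun h => hx (hsupp x h))]
    refine (eLpNorm_le_of_ae_bound (C := η) (Eventually.of_forall hpt)).trans ?_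
    simpa using hηδ
  rw [hdecomp]
  refine (eLpNorm_add_le ((hmeas (hg.sub hkL)).add ((hmeas hkL).sub hkL.1)) (hkL.sub hg).1
    (by norm_num)).trans ?_
  refine (add_le_add ((eLpNorm_add_le (hmeas (hg.sub hkL)) ((hmeas hkL).sub hkL.1)
    (by norm_num)).trans (add_le_add ((eLpNorm_convolution_le _ (hg.sub hkL).1).trans hgk) hmid))
    ?_).trans hδε
  rw [eLpNorm_sub_comm]; exact hgk

end VacuumEuler

namespace VacuumEuler

open Filter Topology Convolution

/-! ### Classical partial derivatives and test functions -/

section Classical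

variable {Ω K : Set Space} {f g φ : Space → ℝ} {x : Space}

theorem pd_add (i : Fin 3) (hf : DifferentiableAt ℝ f x) (hg : DifferentiableAt ℝ g x) :
    pd i (fun y => f y + g y) x = pd i f x + pd i g x := by
  simp [pd, fderiv_fun_add hf hg]

theorem pd_mul (i : Fin 3) (hf : DifferentiableAt ℝ f x) (hg : DifferentiableAt ℝ g x) :
    pd i (fun y => f y * g y) x = pd i f x * g x + f x * pd i g x := by
  simp [pd, fderiv_fun_mul hf hg]; ring

theorem pd_congr (i : Fin 3) (h : f =ᶠ[𝓝 x] g) : pd i f x = pd i g x := by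
  simp [pd, h.fderiv_eq]

theorem contDiff_pd (i : Fin 3) (hf : ContDiff ℝ ∞ f) : ContDiff ℝ ∞ (pd i f) :=
  (hf.fderiv_right (m := ∞) le_rfl).clm_apply contDiff_const

theorem contDiffOn_pd (hΩ : IsOpen Ω) (i : Fin 3) (hf : ContDiffOn ℝ ∞ f Ω) :
    ContDiffOn ℝ ∞ (pd i f) Ω :=
  (hf.fderiv_of_isOpen hΩ (m := ∞) le_rfl).clm_apply contDiffOn_const

theorem diffAt_of_contDiffOn (hΩ : IsOpen Ω) (hf : ContDiffOn ℝ ∞ f Ω) (hx : x ∈ Ω) :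
    DifferentiableAt ℝ f x :=
  (hf.contDiffAt (hΩ.mem_nhds hx)).differentiableAt (by simp)

theorem pd_comm (i j : Fin 3) (hf : ContDiff ℝ ∞ f) : pd i (pd j f) = pd j (pd i f) := by
  have hd : Differentiable ℝ (fderiv ℝ f) :=
    (hf.fderiv_right (m := ∞) le_rfl).differentiable (by simp)
  have key : ∀ (a b : Fin 3) (x : Space), pd a (pd b f) x
      = fderiv ℝ (fderiv ℝ f) x (EuclideanSpace.single a 1) (EuclideanSpace.single b 1) := by
    intro a b x
    have := fderiv_clm_apply (hd x) (differentiableAt_const (EuclideanSpace.single b (1 : ℝ)))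
    change fderiv ℝ (fun y => fderiv ℝ f y (EuclideanSpace.single b 1)) x _ = _
    rw [this]; simp
  funext x
  rw [key, key]
  exact (hf.contDiffAt.isSymmSndFDerivAt (by simpa using (WithTop.coe_le_coe.2 le_top : ((2 : ℕ∞) : ℕ∞ω) ≤ ((⊤ : ℕ∞) : ℕ∞ω)))).eq _ _

theorem IsTestFunction.pd (hφ : IsTestFunction Ω φ) (i : Fin 3) : IsTestFunction Ω (pd i φ) := by
  have hs : tsupport (VacuumEuler.pd i φ) ⊆ tsupport φ := by
    refine closure_minimal (fun x hx => ?_) (isClosed_tsupport φ)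
    refine support_fderiv_subset ℝ (f := φ) fun h0 => hx ?_
    simp [VacuumEuler.pd, h0]
  exact ⟨contDiff_pd i hφ.1, hφ.2.1.of_isClosed_subset (isClosed_tsupport _) hs, hs.trans hφ.2.2⟩

/-- A smooth function on `Ω` times a test function is a test function. -/
theorem IsTestFunction.smul (hΩ : IsOpen Ω) (hφ : IsTestFunction Ω φ) (hf : ContDiffOn ℝ ∞ f Ω) :
    IsTestFunction Ω (fun x => f x * φ x) := by
  have hs : tsupport (fun x => f x * φ x) ⊆ tsupport φ := tsupport_mul_subset_right
  refine ⟨contDiff_iff_contDiffAt.2 fun x => ?_,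
    hφ.2.1.of_isClosed_subset (isClosed_tsupport _) hs, hs.trans hφ.2.2⟩
  by_cases hx : x ∈ tsupport φ
  · exact (hf.contDiffAt (hΩ.mem_nhds (hφ.2.2 hx))).mul hφ.1.contDiffAt
  · have : (fun x => f x * φ x) =ᶠ[𝓝 x] fun _ => 0 := by
      filter_upwards [(isClosed_tsupport φ).isOpen_compl.mem_nhds hx] with y hy
      simp [image_eq_zero_of_notMem_tsupport hy]
    exact contDiffAt_const.congr_of_eventuallyEq this

end Classical

/-! ### Weak gradients of locally square integrable functions -/

/-- `g` is locally square integrable on `Ω`. -/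
def L2loc (Ω : Set Space) (g : Space → ℝ) : Prop :=
  ∀ K ⊆ Ω, IsCompact K → MemLp g 2 (volume.restrict K)

/-- `g ∈ W^{1,2}_loc(Ω)` with weak gradient `(g' 0, g' 1, g' 2)`. -/
structure HasWD (Ω : Set Space) (g : Space → ℝ) (g' : Fin 3 → Space → ℝ) : Prop where
  l2 : L2loc Ω g
  l2' : ∀ j, L2loc Ω (g' j)
  ibp : ∀ j φ, IsTestFunction Ω φ → ∫ x in Ω, g x * pd j φ x = -∫ x in Ω, g' j x * φ x

section Weak

variable {Ω K : Set Space} {f g h c : Space → ℝ} {g' h' : Fin 3 → Space → ℝ}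

theorem L2loc.add (hf : L2loc Ω f) (hg : L2loc Ω g) : L2loc Ω (fun x => f x + g x) :=
  fun K hK hc => (hf K hK hc).add (hg K hK hc)

theorem L2loc.mul_continuousOn (hc : ContinuousOn c Ω) (hg : L2loc Ω g) :
    L2loc Ω (fun x => c x * g x) := fun K hK hKc => by
  obtain ⟨M, hM⟩ := hKc.exists_bound_of_continuousOn (hc.mono hK)
  refine MemLp.of_le_mul (c := M) (hg K hK hKc) ?_ ?_
  · exact ((hc.mono hK).aestronglyMeasurable hKc.measurableSet).mul (hg K hK hKc).1
  · filter_upwards [ae_restrict_mem hKc.measurableSet] with x hx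
    rw [norm_mul]
    exact mul_le_mul_of_nonneg_right (hM x hx) (norm_nonneg _)

/-- The integral over `Ω` of a function which vanishes off a subset `K`. -/
theorem setIntegral_eq_of_support (hKΩ : K ⊆ Ω)
    (h0 : ∀ x, x ∉ K → f x = 0) : ∫ x in Ω, f x = ∫ x in K, f x := by
  rw [setIntegral_eq_integral_of_forall_compl_eq_zero (fun x hx => h0 x fun h => hx (hKΩ h)),
    setIntegral_eq_integral_of_forall_compl_eq_zero h0]

theorem L2loc.integrableOn_mul (hK : K ⊆ Ω) (hKc : IsCompact K) (hf : L2loc Ω f)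
    (hg : L2loc Ω g) : IntegrableOn (fun x => f x * g x) K :=
  (hf K hK hKc).integrable_mul (hg K hK hKc)

/-- Products of locally square integrable functions are integrable against functions with compact
support in `Ω`. -/
theorem L2loc.integrableOn_mul_mul (hΩ : IsOpen Ω) (hc : Continuous c) (hcc : HasCompactSupport c)
    (hcs : tsupport c ⊆ Ω) (hf : L2loc Ω f) (hg : L2loc Ω g) :
    IntegrableOn (fun x => c x * f x * g x) Ω := by
  have h1 : IntegrableOn (fun x => c x * f x * g x) (tsupport c) :=
    L2loc.integrableOn_mul hcs hcc (L2loc.mul_continuousOn hc.continuousOn hf) hg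
  exact h1.of_forall_sdiff_eq_zero hΩ.measurableSet
    fun x hx => by simp [image_eq_zero_of_notMem_tsupport hx.2]

/-- Weak `L²`-convergence on `K` from strong convergence. -/
theorem tendsto_setIntegral_mul {ψ : Space → ℝ} {G : ℕ → Space → ℝ}
    (hψ : MemLp ψ 2 (volume.restrict K)) (hG : ∀ n, MemLp (G n) 2 (volume.restrict K))
    (hg : MemLp g 2 (volume.restrict K))
    (hl : Tendsto (fun n => eLpNorm (G n - g) 2 (volume.restrict K)) atTop (𝓝 0)) :
    Tendsto (fun n => ∫ x in K, ψ x * G n x) atTop (𝓝 (∫ x in K, ψ x * g x)) := by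
  refine tendsto_integral_of_L1' _ (hψ.integrable_mul hg).1
    (Eventually.of_forall fun n => hψ.integrable_mul (hG n)) ?_
  have hb : ∀ n, eLpNorm ((fun x => ψ x * G n x) - fun x => ψ x * g x) 1 (volume.restrict K)
      ≤ eLpNorm ψ 2 (volume.restrict K) * eLpNorm (G n - g) 2 (volume.restrict K) := fun n => by
    have := eLpNorm_smul_le_mul_eLpNorm (p := 2) (q := 2) (r := 1) ((hG n).sub hg).1 hψ.1
    refine le_trans (le_of_eq ?_) this
    congr 1
    funext x
    simp [mul_sub]
  refine tendsto_of_tendsto_of_tendsto_of_le_of_le tendsto_const_nhds ?_ (fun n => zero_le) hb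
  simpa using ENNReal.Tendsto.const_mul hl (Or.inr hψ.2.ne)

theorem pd_convolution_eq_integral (φ : ContDiffBump (0 : Space)) {f : Space → ℝ}
    (hf : LocallyIntegrable f volume) (x : Space) (j : Fin 3) :
    pd j (φ.normed volume ⋆[ContinuousLinearMap.lsmul ℝ ℝ, volume] f) x
      = ∫ y, pd j (φ.normed volume) (x - y) * f y := by
  have hsm : ContDiff ℝ ∞ (φ.normed volume) := φ.contDiff_normed
  have hcs : HasCompactSupport (φ.normed volume) := φ.hasCompactSupport_normed
  have hd := hcs.hasFDerivAt_convolution_left (ContinuousLinearMap.lsmul ℝ ℝ) (hsm.of_le (by simp))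
    hf x
  have hex := ((hcs.fderiv ℝ).convolutionExists_left (ContinuousLinearMap.precompL Space
    (ContinuousLinearMap.lsmul ℝ ℝ)) (hsm.continuous_fderiv (by simp)) hf x).integrable_swap
  rw [pd, hd.fderiv, convolution_eq_swap, ContinuousLinearMap.integral_apply hex]
  rfl

/-- Mollification commutes with weak derivatives away from the boundary of `Ω`. -/
theorem HasWD.pd_convolution (h : HasWD Ω g g') {x : Space} {K' : Set Space}
    (hK' : IsCompact K') (hK'Ω : K' ⊆ Ω) (φ : ContDiffBump (0 : Space))
    (hx : Metric.closedBall x φ.rOut ⊆ K') (j : Fin 3) :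
    pd j (φ.normed volume ⋆[ContinuousLinearMap.lsmul ℝ ℝ, volume] K'.indicator g) x
      = (φ.normed volume ⋆[ContinuousLinearMap.lsmul ℝ ℝ, volume] K'.indicator (g' j)) x := by
  have hli : LocallyIntegrable (K'.indicator g) volume :=
    ((memLp_indicator_iff_restrict hK'.measurableSet).2 (h.l2 K' hK'Ω hK')).locallyIntegrable
      (by norm_num)
  have hsm : ContDiff ℝ ∞ (φ.normed volume) := φ.contDiff_normed
  -- the reflected and translated kernel
  set ψ : Space → ℝ := fun y => φ.normed volume (x - y) with hψ
  have hψs : tsupport ψ ⊆ Metric.closedBall x φ.rOut := by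
    refine closure_minimal (fun y hy => ?_) Metric.isClosed_closedBall
    have : x - y ∈ Function.support (φ.normed volume) := hy
    rw [φ.support_normed_eq] at this
    simpa [dist_eq_norm, norm_sub_rev] using (Metric.ball_subset_closedBall this)
  have hψt : IsTestFunction Ω ψ :=
    ⟨hsm.comp (contDiff_const.sub contDiff_id),
      (isCompact_closedBall x φ.rOut).of_isClosed_subset (isClosed_tsupport _) hψs,
      (hψs.trans hx).trans hK'Ω⟩
  have hψd : ∀ y, pd j (φ.normed volume) (x - y) = -pd j ψ y := by
    intro y
    have h1 : HasFDerivAt ψ ((fderiv ℝ (φ.normed volume) (x - y)).comp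
        (-ContinuousLinearMap.id ℝ Space)) y := by
      refine HasFDerivAt.comp y (g := φ.normed volume)
        ((hsm.differentiable (by simp)) (x - y)).hasFDerivAt ?_
      simpa using (hasFDerivAt_id y).const_sub x
    simp [pd, h1.fderiv]
  have hψ0 : ∀ y, y ∉ K' → ψ y = 0 := fun y hy =>
    image_eq_zero_of_notMem_tsupport fun h0 => hy (hx (hψs h0))
  have hψ1 : ∀ y, y ∉ K' → pd j ψ y = 0 := fun y hy => by
    have h0 : fderiv ℝ ψ y = 0 := by_contra fun h1 =>
      hy (hx (hψs (support_fderiv_subset ℝ (f := ψ) h1)))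
    simp [pd, h0]
  have e1 : ∀ y, pd j (φ.normed volume) (x - y) * K'.indicator g y = -(g y * pd j ψ y) := by
    intro y
    by_cases hy : y ∈ K'
    · rw [indicator_of_mem hy, hψd]; ring
    · simp [indicator_of_notMem hy, hψ1 y hy]
  have e2 : ∀ y, φ.normed volume (x - y) * K'.indicator (g' j) y = g' j y * ψ y := by
    intro y
    by_cases hy : y ∈ K'
    · rw [indicator_of_mem hy, mul_comm]
    · simp [indicator_of_notMem hy, hψ0 y hy]
  rw [pd_convolution_eq_integral φ hli, convolution_eq_swap]
  simp only [ContinuousLinearMap.lsmul_apply, smul_eq_mul, e1, e2]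
  have := h.ibp j ψ hψt
  rw [setIntegral_eq_integral_of_forall_compl_eq_zero
      (fun y hy => by rw [hψ1 y fun h0 => hy (hK'Ω h0), mul_zero]),
    setIntegral_eq_integral_of_forall_compl_eq_zero
      (fun y hy => by rw [hψ0 y fun h0 => hy (hK'Ω h0), mul_zero])] at this
  rw [integral_neg, this, neg_neg]

/-- On a compact subset of `Ω`, a function with weak gradient is the `L²` limit, together with its
gradient, of smooth functions. This transfers the product rules to weak derivatives. -/
theorem HasWD.exists_smooth_approx (hΩ : IsOpen Ω) (h : HasWD Ω g g') (hK : IsCompact K)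
    (hKΩ : K ⊆ Ω) : ∃ G : ℕ → Space → ℝ, (∀ n, ContDiff ℝ ∞ (G n)) ∧
      Tendsto (fun n => eLpNorm (G n - g) 2 (volume.restrict K)) atTop (𝓝 0) ∧
      ∀ j, Tendsto (fun n => eLpNorm (pd j (G n) - g' j) 2 (volume.restrict K)) atTop (𝓝 0) := by
  obtain ⟨δ, hδ, hδΩ⟩ := hK.exists_cthickening_subset_open hΩ hKΩ
  set K' := Metric.cthickening δ K with hK'
  have hK'c : IsCompact K' := hK.cthickening
  have hKK' : K ⊆ K' := Metric.self_subset_cthickening K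
  have hind : ∀ {f : Space → ℝ}, L2loc Ω f → MemLp (K'.indicator f) 2 volume := fun hf =>
    (memLp_indicator_iff_restrict hK'c.measurableSet).2 (hf K' hδΩ hK'c)
  let φ : ℕ → ContDiffBump (0 : Space) := fun n =>
    ⟨δ / (n + 2), δ / (n + 1), by positivity, by
      apply div_lt_div_of_pos_left hδ (by positivity); linarith⟩
  have hφ : Tendsto (fun n => (φ n).rOut) atTop (𝓝 0) :=
    tendsto_const_nhds.div_atTop (tendsto_atTop_add_const_right _ _ tendsto_natCast_atTop_atTop)
  have hle : ∀ n, (φ n).rOut ≤ δ := fun n => div_le_self hδ.le (by simp)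
  have hrestr : ∀ {f : Space → ℝ}, L2loc Ω f → Tendsto (fun n => eLpNorm
      ((((φ n).normed volume ⋆[ContinuousLinearMap.lsmul ℝ ℝ, volume] K'.indicator f)) - f) 2
      (volume.restrict K)) atTop (𝓝 0) := fun {f} hf => by
    refine tendsto_of_tendsto_of_tendsto_of_le_of_le tendsto_const_nhds
      (tendsto_eLpNorm_convolution_sub hφ (hind hf)) (fun n => zero_le) fun n => ?_
    refine le_trans (le_of_eq ?_) (eLpNorm_mono_measure _ (Measure.restrict_le_self (s := K)))
    refine eLpNorm_congr_ae ?_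
    filter_upwards [ae_restrict_mem hK.measurableSet] with x hx
    simp [indicator_of_mem (hKK' hx)]
  refine ⟨fun n => (φ n).normed volume ⋆[ContinuousLinearMap.lsmul ℝ ℝ, volume] K'.indicator g,
    fun n => ?_, hrestr h.l2, fun j => ?_⟩
  · exact (φ n).hasCompactSupport_normed.contDiff_convolution_left (n := ⊤) _ (φ n).contDiff_normed
      ((hind h.l2).locallyIntegrable (by norm_num))
  · refine (hrestr (h.l2' j)).congr fun n => eLpNorm_congr_ae ?_
    filter_upwards [ae_restrict_mem hK.measurableSet] with x hx
    rw [Pi.sub_apply, Pi.sub_apply, h.pd_convolution hK'c hδΩ (φ n) ?_ j]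
    exact (Metric.closedBall_subset_closedBall (hle n)).trans
      (Metric.closedBall_subset_cthickening hx δ)

theorem _root_.ContDiff.l2loc (hf : ContDiff ℝ ∞ f) : L2loc Ω f := fun K _ hKc => by
  obtain ⟨M, hM⟩ := hKc.exists_bound_of_continuousOn hf.continuous.continuousOn
  have : IsFiniteMeasure (volume.restrict K) := ⟨by simpa using hKc.measure_lt_top⟩
  refine MemLp.of_bound hf.continuous.aestronglyMeasurable M ?_
  filter_upwards [ae_restrict_mem hKc.measurableSet] with x hx using hM x hx

/-- Integration by parts for the product of two functions of class `W^{1,2}_loc`, against a test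
function. -/
theorem HasWD.integral_mul (hΩ : IsOpen Ω) (hg : HasWD Ω g g') (hh : HasWD Ω h h')
    (hc : IsTestFunction Ω c) (j : Fin 3) :
    ∫ x in Ω, (c x * g' j x * h x + c x * g x * h' j x + pd j c x * g x * h x) = 0 := by
  have hcj := hc.pd j
  have hKΩ := hc.2.2
  have hKc : IsCompact (tsupport c) := hc.2.1
  obtain ⟨G, hGs, hG, hG'⟩ := hg.exists_smooth_approx hΩ hKc hKΩ
  have hpd0 : ∀ x, x ∉ tsupport c → pd j c x = 0 := fun x hx => by
    have := support_fderiv_subset ℝ (f := c)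
    have h0 : fderiv ℝ c x = 0 := by_contra fun h1 => hx (this h1)
    simp [pd, h0]
  have I1 : ∀ {p q : Space → ℝ}, L2loc Ω p → L2loc Ω q →
      Integrable (fun x => c x * p x * q x) (volume.restrict Ω) := fun hp hq =>
    L2loc.integrableOn_mul_mul hΩ hc.1.continuous hc.2.1 hc.2.2 hp hq
  have I2 : ∀ {p q : Space → ℝ}, L2loc Ω p → L2loc Ω q →
      Integrable (fun x => pd j c x * p x * q x) (volume.restrict Ω) := fun hp hq =>
    L2loc.integrableOn_mul_mul hΩ hcj.1.continuous hcj.2.1 hcj.2.2 hp hq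
  have T1 : ∀ {p : Space → ℝ} {P : ℕ → Space → ℝ}, (∀ n, ContDiff ℝ ∞ (P n)) → L2loc Ω p →
      Tendsto (fun n => eLpNorm (P n - p) 2 (volume.restrict (tsupport c))) atTop (𝓝 0) →
      ∀ {a q : Space → ℝ}, ContDiff ℝ ∞ a → (∀ x, x ∉ tsupport c → a x = 0) → L2loc Ω q →
      Tendsto (fun n => ∫ x in Ω, a x * P n x * q x) atTop (𝓝 (∫ x in Ω, a x * p x * q x)) := by
    intro p P hP hp hl a q ha ha0 hq
    have := tendsto_setIntegral_mul
      ((L2loc.mul_continuousOn ha.continuous.continuousOn hq) _ hKΩ hKc)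
      (fun n => (hP n).l2loc (Ω := Ω) _ hKΩ hKc) (hp _ hKΩ hKc) hl
    rw [setIntegral_eq_of_support hKΩ (fun x hx => by simp [ha0 x hx])]
    refine (this.congr fun n => ?_).trans (le_of_eq ?_)
    · rw [setIntegral_eq_of_support hKΩ (fun x hx => by simp [ha0 x hx])]
      exact integral_congr_ae (Eventually.of_forall fun x => by ring)
    · congr 1
      exact integral_congr_ae (Eventually.of_forall fun x => by ring)
  have L1 := T1 (fun n => contDiff_pd j (hGs n)) (hg.l2' j) (hG' j) hc.1
    (fun x hx => image_eq_zero_of_notMem_tsupport hx) hh.l2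
  have L2 := T1 hGs hg.l2 hG hc.1 (fun x hx => image_eq_zero_of_notMem_tsupport hx) (hh.l2' j)
  have L3 := T1 hGs hg.l2 hG hcj.1 hpd0 hh.l2
  have hzero : ∀ n, (∫ x in Ω, c x * pd j (G n) x * h x) + (∫ x in Ω, c x * G n x * h' j x)
      + (∫ x in Ω, pd j c x * G n x * h x) = 0 := by
    intro n
    have ht : IsTestFunction Ω (fun x => G n x * c x) := hc.smul hΩ (hGs n).contDiffOn
    have := hh.ibp j _ ht
    have e1 : (fun x => h x * pd j (fun x => G n x * c x) x)
        = fun x => c x * pd j (G n) x * h x + pd j c x * G n x * h x := by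
      funext x
      rw [pd_mul j ((hGs n).differentiable (by simp) x) (hc.1.differentiable (by simp) x)]
      ring
    have e2 : (fun x => h' j x * (G n x * c x)) = fun x => c x * G n x * h' j x := by
      funext x; ring
    rw [e1, e2, integral_add (I1 (contDiff_pd j (hGs n)).l2loc hh.l2)
      (I2 (hGs n).l2loc hh.l2)] at this
    linarith
  have := tendsto_nhds_unique ((L1.add L2).add L3)
    (tendsto_const_nhds.congr fun n => (hzero n).symm)
  have A := (I1 (hg.l2' j) hh.l2).fun_add (I1 hg.l2 (hh.l2' j))
  rw [integral_add A (I2 hg.l2 hh.l2), integral_add (I1 (hg.l2' j) hh.l2) (I1 hg.l2 (hh.l2' j))]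
  exact this

/-- Integration by parts for the null form `∂_i g ∂_j h - ∂_j g ∂_i h`, which needs no second
derivatives. -/
theorem HasWD.integral_null_form (hΩ : IsOpen Ω) (hg : HasWD Ω g g') (hh : HasWD Ω h h')
    (hc : IsTestFunction Ω c) (i j : Fin 3) :
    ∫ x in Ω, (c x * g' i x * h' j x - c x * g' j x * h' i x
      + pd i c x * g x * h' j x - pd j c x * g x * h' i x) = 0 := by
  have hKΩ := hc.2.2
  have hKc : IsCompact (tsupport c) := hc.2.1
  obtain ⟨G, hGs, hG, hG'⟩ := hh.exists_smooth_approx hΩ hKc hKΩ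
  have hpd0 : ∀ k x, x ∉ tsupport c → pd k c x = 0 := fun k x hx => by
    have := support_fderiv_subset ℝ (f := c)
    have h0 : fderiv ℝ c x = 0 := by_contra fun h1 => hx (this h1)
    simp [pd, h0]
  have I : ∀ {a p q : Space → ℝ}, IsTestFunction Ω a → L2loc Ω p → L2loc Ω q →
      Integrable (fun x => a x * p x * q x) (volume.restrict Ω) := fun ha hp hq =>
    L2loc.integrableOn_mul_mul hΩ ha.1.continuous ha.2.1 ha.2.2 hp hq
  have T : ∀ (k : Fin 3) {a q : Space → ℝ}, ContDiff ℝ ∞ a → (∀ x, x ∉ tsupport c → a x = 0) →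
      L2loc Ω q → Tendsto (fun n => ∫ x in Ω, a x * q x * pd k (G n) x) atTop
        (𝓝 (∫ x in Ω, a x * q x * h' k x)) := by
    intro k a q ha ha0 hq
    have := tendsto_setIntegral_mul
      ((L2loc.mul_continuousOn ha.continuous.continuousOn hq) _ hKΩ hKc)
      (fun n => (contDiff_pd k (hGs n)).l2loc (Ω := Ω) _ hKΩ hKc) (hh.l2' k _ hKΩ hKc) (hG' k)
    rw [setIntegral_eq_of_support hKΩ (fun x hx => by simp [ha0 x hx])]
    refine this.congr fun n => ?_
    rw [setIntegral_eq_of_support hKΩ (fun x hx => by simp [ha0 x hx])]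
  have hc0 : ∀ x, x ∉ tsupport c → c x = 0 := fun x hx => image_eq_zero_of_notMem_tsupport hx
  have L1 := T j hc.1 hc0 (hg.l2' i)
  have L2 := T i hc.1 hc0 (hg.l2' j)
  have L3 := T j (hc.pd i).1 (hpd0 i) hg.l2
  have L4 := T i (hc.pd j).1 (hpd0 j) hg.l2
  have hzero : ∀ n, (∫ x in Ω, c x * g' i x * pd j (G n) x)
      - (∫ x in Ω, c x * g' j x * pd i (G n) x)
      + (∫ x in Ω, pd i c x * g x * pd j (G n) x)
      - (∫ x in Ω, pd j c x * g x * pd i (G n) x) = 0 := by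
    intro n
    have key : ∀ a b : Fin 3, (∫ x in Ω, c x * g' a x * pd b (G n) x)
        + (∫ x in Ω, pd a c x * g x * pd b (G n) x)
        = - ∫ x in Ω, c x * g x * pd a (pd b (G n)) x := by
      intro a b
      have hGb := contDiff_pd b (hGs n)
      have := hg.ibp a _ (hc.smul hΩ hGb.contDiffOn)
      have e1 : (fun x => g x * pd a (fun x => pd b (G n) x * c x) x)
          = fun x => c x * g x * pd a (pd b (G n)) x + pd a c x * g x * pd b (G n) x := by
        funext x
        rw [pd_mul a (hGb.differentiable (by simp) x) (hc.1.differentiable (by simp) x)]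
        ring
      have e2 : (fun x => g' a x * (pd b (G n) x * c x)) = fun x => c x * g' a x * pd b (G n) x := by
        funext x; ring
      rw [e1, e2, integral_add (I hc hg.l2 (contDiff_pd a hGb).l2loc)
        (I (hc.pd a) hg.l2 hGb.l2loc)] at this
      linarith
    have h1 := key i j
    have h2 := key j i
    rw [pd_comm i j (hGs n)] at h1
    linarith
  have := tendsto_nhds_unique (((L1.sub L2).add L3).sub L4)
    (tendsto_const_nhds.congr fun n => (hzero n).symm)
  have A : Integrable (fun x => c x * g' i x * h' j x - c x * g' j x * h' i x)
    (volume.restrict Ω) := (I hc (hg.l2' i) (hh.l2' j)).sub (I hc (hg.l2' j) (hh.l2' i))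
  have B := A.fun_add (I (hc.pd i) hg.l2 (hh.l2' j))
  rw [integral_sub B (I (hc.pd j) hg.l2 (hh.l2' i)),
    integral_add A (I (hc.pd i) hg.l2 (hh.l2' j)),
    integral_sub (I hc (hg.l2' i) (hh.l2' j)) (I hc (hg.l2' j) (hh.l2' i))]
  exact this

end Weak

end VacuumEuler

namespace VacuumEuler

open Filter Topology

/-! ### The geometric setting: a defining function and a frame -/

/-- An open set `Ω` with a nondegenerate defining function `r` (positive in `Ω`, vanishing on the
boundary) and a frame of vector fields `X_a = ∑_i S_{ai} ∂_i`, all of them smooth in `Ω` with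
bounds controlled by the single constant `M`. -/
structure VacuumFrame (M : ℝ) (Ω : Set Space) (r : Space → ℝ) (S : Fin 3 → Fin 3 → Space → ℝ) :
    Prop where
  one_le : 1 ≤ M
  isOpen : IsOpen Ω
  smooth_r : ContDiffOn ℝ ∞ r Ω
  smooth_S : ∀ a i, ContDiffOn ℝ ∞ (S a i) Ω
  pos : ∀ x ∈ Ω, 0 < r x
  r_le : ∀ x ∈ Ω, r x ≤ M
  pd_r_le : ∀ x ∈ Ω, ∀ i, |pd i r x| ≤ M
  pd_pd_r_le : ∀ x ∈ Ω, ∀ i j, |pd i (pd j r) x| ≤ M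
  S_le : ∀ x ∈ Ω, ∀ a i, |S a i x| ≤ M
  pd_S_le : ∀ x ∈ Ω, ∀ j a i, |pd j (S a i) x| ≤ M
  /-- The frame is uniformly nondegenerate. -/
  coercive : ∀ x ∈ Ω, ∀ (ξ : Fin 3 → ℝ) (j : Fin 3), |ξ j| ≤ M * ∑ a, |∑ k, S a k x * ξ k|
  /-- The gradient of `r` does not vanish where `r` is small. -/
  nondegenerate : ∀ x ∈ Ω, 1 ≤ M * (∑ a, (∑ j, S a j x * pd j r x) ^ 2 + r x)
  /-- `r` vanishes at the boundary of `Ω`. -/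
  isClosed_superlevel : ∀ δ > 0, IsClosed {x | x ∈ Ω ∧ δ ≤ r x}

/-- `X_a g` for a function with gradient `g'`. -/
def frameD (S : Fin 3 → Fin 3 → Space → ℝ) (a : Fin 3) (g' : Fin 3 → Space → ℝ) : Space → ℝ :=
  fun x => ∑ j, S a j x * g' j x

/-- The components `n_a = X_a r` of the conormal. -/
def conormal (S : Fin 3 → Fin 3 → Space → ℝ) (r : Space → ℝ) (a : Fin 3) : Space → ℝ :=
  frameD S a fun j => pd j r

/-- `g ∈ W^{1,2}_loc(Ω)` with frame derivatives `X_a g = gX a`. -/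
def HasXD (Ω : Set Space) (S : Fin 3 → Fin 3 → Space → ℝ) (g : Space → ℝ)
    (gX : Fin 3 → Space → ℝ) : Prop :=
  ∃ g', HasWD Ω g g' ∧ ∀ a, ∀ x ∈ Ω, gX a x = frameD S a g' x

theorem exists_deriv_smoothTransition_bound :
    ∃ C : ℝ, ∀ t, |deriv Real.smoothTransition t| ≤ C := by
  have hc : Continuous (deriv Real.smoothTransition) :=
    (Real.smoothTransition.contDiff (n := 1)).continuous_deriv le_rfl
  obtain ⟨C, hC⟩ := (isCompact_Icc (a := (0 : ℝ)) (b := 1)).exists_bound_of_continuousOn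
    hc.continuousOn
  refine ⟨max C 0, fun t => ?_⟩
  by_cases ht : t ∈ Icc (0 : ℝ) 1
  · exact (hC t ht).trans (le_max_left _ _)
  · have : deriv Real.smoothTransition t = 0 := by
      rw [mem_Icc, not_and_or, not_le, not_le] at ht
      rcases ht with ht | ht
      · have : Real.smoothTransition =ᶠ[𝓝 t] fun _ => 0 := by
          filter_upwards [Iio_mem_nhds ht] with y hy
          exact Real.smoothTransition.zero_of_nonpos (le_of_lt hy)
        rw [this.deriv_eq, deriv_const]
      · have : Real.smoothTransition =ᶠ[𝓝 t] fun _ => 1 := by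
          filter_upwards [Ioi_mem_nhds ht] with y hy
          exact Real.smoothTransition.one_of_one_le (le_of_lt hy)
        rw [this.deriv_eq, deriv_const]
    rw [this, abs_zero]; exact le_max_right _ _

theorem deriv_smoothTransition_of_one_lt {t : ℝ} (ht : 1 < t) :
    deriv Real.smoothTransition t = 0 := by
  have : Real.smoothTransition =ᶠ[𝓝 t] fun _ => 1 := by
    filter_upwards [Ioi_mem_nhds ht] with y hy
    exact Real.smoothTransition.one_of_one_le (le_of_lt hy)
  rw [this.deriv_eq, deriv_const]

theorem pd_comp {f : Space → ℝ} {ψ : ℝ → ℝ} {x : Space} (i : Fin 3)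
    (hψ : DifferentiableAt ℝ ψ (f x)) (hf : DifferentiableAt ℝ f x) :
    pd i (fun y => ψ (f y)) x = deriv ψ (f x) * pd i f x := by
  have := hψ.hasDerivAt.comp_hasFDerivAt x hf.hasFDerivAt
  simp only [pd]
  rw [show (fun y => ψ (f y)) = ψ ∘ f from rfl, this.fderiv]
  simp

theorem pd_inv_one_add_norm_sq (i : Fin 3) (x : Space) :
    pd i (fun y : Space => (1 + ‖y‖ ^ 2)⁻¹) x = -(2 * x i) / (1 + ‖x‖ ^ 2) ^ 2 := by
  have h1 : HasFDerivAt (fun y : Space => 1 + ‖y‖ ^ 2) (2 • (innerSL ℝ x)) x := by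
    simpa using (hasStrictFDerivAt_norm_sq x).hasFDerivAt.const_add 1
  have hne : (1 + ‖x‖ ^ 2) ≠ 0 := by positivity
  have h2 := (hasDerivAt_inv hne).comp_hasFDerivAt x h1
  simp only [pd]
  rw [show (fun y : Space => (1 + ‖y‖ ^ 2)⁻¹) = (fun y => y⁻¹) ∘ fun y : Space => 1 + ‖y‖ ^ 2
    from rfl, h2.fderiv]
  simp [EuclideanSpace.inner_single_right]
  ring

section Setting

variable {M : ℝ} {Ω : Set Space} {r : Space → ℝ} {S : Fin 3 → Fin 3 → Space → ℝ}

/-- Cut-off functions exhausting `Ω` whose gradients are `O(1/r)`. -/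
theorem VacuumFrame.exists_cutoff (F : VacuumFrame M Ω r S) :
    ∃ (χ : ℕ → Space → ℝ) (C : ℝ), (∀ n, IsTestFunction Ω (χ n)) ∧ (∀ n x, |χ n x| ≤ 1) ∧
      (∀ n, ∀ x ∈ Ω, ∀ j, |r x * pd j (χ n) x| ≤ C) ∧
      ∀ x ∈ Ω, ∀ᶠ n in atTop, χ n x = 1 ∧ ∀ j, pd j (χ n) x = 0 := by
  classical
  obtain ⟨C, hC⟩ := exists_deriv_smoothTransition_bound
  have hC0 : 0 ≤ C := (abs_nonneg _).trans (hC 0)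
  set ψ := Real.smoothTransition
  have hψs : ContDiff ℝ ∞ ψ := Real.smoothTransition.contDiff
  -- the factor `(1 + ‖x‖ ^ 2)⁻¹` makes the supports compact when `Ω` is unbounded
  let ρ : Space → ℝ := fun x => r x * (1 + ‖x‖ ^ 2)⁻¹
  have hw : ∀ x : Space, 0 < 1 + ‖x‖ ^ 2 := fun x => by positivity
  have hwi : ContDiff ℝ ∞ fun x : Space => (1 + ‖x‖ ^ 2)⁻¹ :=
    (contDiff_const.add (contDiff_norm_sq ℝ)).inv fun x => (hw x).ne'
  have hρs : ContDiffOn ℝ ∞ ρ Ω := F.smooth_r.mul hwi.contDiffOn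
  have hρ0 : ∀ x ∈ Ω, 0 < ρ x := fun x hx => mul_pos (F.pos x hx) (inv_pos.2 (hw x))
  let χ : ℕ → Space → ℝ := fun n => Ω.indicator fun x => ψ (n * ρ x - 1)
  let K : ℕ → Set Space := fun n =>
    {x | x ∈ Ω ∧ 1 / (n : ℝ) ≤ r x} ∩ Metric.closedBall 0 (n * M)
  have hK : ∀ n : ℕ, 0 < n → IsCompact (K n) := fun n hn =>
    (isCompact_closedBall _ _).inter_left (F.isClosed_superlevel _ (by positivity))
  have hχK : ∀ n : ℕ, 0 < n → ∀ x, x ∉ K n → χ n x = 0 := by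
    intro n hn x hx
    by_cases hxΩ : x ∈ Ω
    · simp only [χ, indicator_of_mem hxΩ]
      refine Real.smoothTransition.zero_of_nonpos ?_
      by_contra hlt
      push Not at hlt
      have hn' : (0 : ℝ) < n := by exact_mod_cast hn
      have h1 : 1 + ‖x‖ ^ 2 < n * r x := by
        have : 1 < n * r x / (1 + ‖x‖ ^ 2) := by
          simp only [ρ] at hlt
          rw [div_eq_mul_inv]; linarith
        rwa [lt_div_iff₀ (hw x), one_mul] at this
      refine hx ⟨⟨hxΩ, ?_⟩, ?_⟩
      · rw [div_le_iff₀ hn']; nlinarith [sq_nonneg ‖x‖]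
      · rw [mem_closedBall_zero_iff]
        have := mul_le_mul_of_nonneg_left (F.r_le x hxΩ) hn'.le
        nlinarith [sq_nonneg (‖x‖ - 1), norm_nonneg x]
    · simp [χ, indicator_of_notMem hxΩ]
  have hχev : ∀ n, ∀ x ∈ Ω, χ n =ᶠ[𝓝 x] fun y => ψ (n * ρ y - 1) := fun n x hx => by
    filter_upwards [F.isOpen.mem_nhds hx] with y hy
    simp [χ, indicator_of_mem hy]
  have hts : ∀ n, 0 < n → tsupport (χ n) ⊆ K n := fun n hn =>
    closure_minimal (fun x hx => by_contra fun h => hx (hχK n hn x h)) (hK n hn).isClosed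
  have hzero : χ 0 = fun _ => 0 := by
    funext x
    by_cases hxΩ : x ∈ Ω
    · simp only [χ, indicator_of_mem hxΩ]
      exact Real.smoothTransition.zero_of_nonpos (by simp)
    · simp [χ, indicator_of_notMem hxΩ]
  have hpd : ∀ n, ∀ x ∈ Ω, ∀ j, pd j (χ n) x = deriv ψ (n * ρ x - 1) * (n * pd j ρ x) := by
    intro n x hx j
    have hd := diffAt_of_contDiffOn F.isOpen hρs hx
    rw [pd_congr j (hχev n x hx), pd_comp (f := fun y => n * ρ y - 1) j
      (hψs.differentiable (by simp) _) ((hd.const_mul _).sub_const _)]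
    congr 1
    simp only [pd]
    rw [fderiv_sub_const, fderiv_const_mul hd]
    simp
  refine ⟨χ, C * (2 * (2 * M)), fun n => ?_, fun n x => ?_, fun n x hx j => ?_, fun x hx => ?_⟩
  · rcases Nat.eq_zero_or_pos n with rfl | hn
    · rw [hzero]
      exact ⟨contDiff_const, HasCompactSupport.zero, by simp⟩
    · refine ⟨contDiff_iff_contDiffAt.2 fun x => ?_,
        (hK n hn).of_isClosed_subset (isClosed_tsupport _) (hts n hn),
        (hts n hn).trans fun x hx => hx.1.1⟩
      by_cases hx : x ∈ Ω
      · refine ContDiffAt.congr_of_eventuallyEq ?_ (hχev n x hx)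
        exact hψs.contDiffAt.comp x
          ((contDiffAt_const.mul (hρs.contDiffAt (F.isOpen.mem_nhds hx))).sub contDiffAt_const)
      · have : χ n =ᶠ[𝓝 x] fun _ => 0 := by
          filter_upwards [(hK n hn).isClosed.isOpen_compl.mem_nhds fun h => hx h.1.1] with y hy
          exact hχK n hn y hy
        exact contDiffAt_const.congr_of_eventuallyEq this
  · by_cases hxΩ : x ∈ Ω
    · simp only [χ, indicator_of_mem hxΩ]
      rw [abs_of_nonneg (Real.smoothTransition.nonneg _)]
      exact Real.smoothTransition.le_one _
    · simp [χ, indicator_of_notMem hxΩ]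
  · have hM : 0 ≤ M := zero_le_one.trans F.one_le
    rw [hpd n x hx]
    by_cases hbig : 1 < n * ρ x - 1
    · rw [deriv_smoothTransition_of_one_lt hbig]
      simp only [zero_mul, mul_zero, abs_zero]
      positivity
    · have hd := diffAt_of_contDiffOn F.isOpen F.smooth_r hx
      have hρd : pd j ρ x = (1 + ‖x‖ ^ 2)⁻¹ *
          (pd j r x - r x * (2 * x j / (1 + ‖x‖ ^ 2))) := by
        simp only [ρ]
        rw [pd_mul j hd (hwi.differentiable (by simp) x), pd_inv_one_add_norm_sq]
        have := (hw x).ne'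
        field_simp
        ring
      have e : r x * (deriv ψ (n * ρ x - 1) * (n * pd j ρ x))
          = deriv ψ (n * ρ x - 1) * ((n * ρ x) *
            (pd j r x - r x * (2 * x j / (1 + ‖x‖ ^ 2)))) := by
        rw [hρd]; simp only [ρ]; ring
      have hxj : |2 * x j / (1 + ‖x‖ ^ 2)| ≤ 1 := by
        have h1 : |x j| ≤ ‖x‖ := by simpa using PiLp.norm_apply_le x j
        rw [abs_div, abs_of_pos (hw x), div_le_one (hw x), abs_mul, abs_two]
        nlinarith [sq_nonneg (‖x‖ - 1)]
      have hb : |pd j r x - r x * (2 * x j / (1 + ‖x‖ ^ 2))| ≤ 2 * M := by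
        refine (abs_sub _ _).trans ?_
        rw [abs_mul, abs_of_pos (F.pos x hx)]
        have := mul_le_mul (F.r_le x hx) hxj (abs_nonneg _) hM
        linarith [F.pd_r_le x hx j]
      have hnρ : |n * ρ x| ≤ 2 := by
        rw [abs_of_nonneg (mul_nonneg (Nat.cast_nonneg _) (hρ0 x hx).le)]; linarith
      rw [e, abs_mul, abs_mul]
      exact mul_le_mul (hC _) (mul_le_mul hnρ hb (abs_nonneg _) zero_le_two) (by positivity) hC0
  · have : ∀ᶠ n : ℕ in atTop, 2 / ρ x < n := tendsto_natCast_atTop_atTop.eventually_gt_atTop _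
    filter_upwards [this] with n hn
    rw [div_lt_iff₀ (hρ0 x hx)] at hn
    have hbig : 1 < n * ρ x - 1 := by linarith
    refine ⟨?_, fun j => ?_⟩
    · simp only [χ, indicator_of_mem hx]
      exact Real.smoothTransition.one_of_one_le hbig.le
    · rw [hpd n x hx, deriv_smoothTransition_of_one_lt hbig, zero_mul]

end Setting

end VacuumEuler

namespace VacuumEuler

open Filter Topology

/-! ### Weighted `L²` classes -/

/-- `∫_Ω r^μ f² < ∞`. -/
def WL (Ω : Set Space) (r : Space → ℝ) (μ : ℝ) (f : Space → ℝ) : Prop :=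
  AEStronglyMeasurable f (volume.restrict Ω) ∧ IntegrableOn (fun x => r x ^ μ * f x ^ 2) Ω

section Setting

variable {M B μ ν σ : ℝ} {Ω : Set Space} {r : Space → ℝ} {S : Fin 3 → Fin 3 → Space → ℝ}
  {f g h c φ : Space → ℝ} {g' h' gX hX : Fin 3 → Space → ℝ}

theorem VacuumFrame.M_nonneg (F : VacuumFrame M Ω r S) : 0 ≤ M := zero_le_one.trans F.one_le

theorem VacuumFrame.contDiffOn_rpow (F : VacuumFrame M Ω r S) (μ : ℝ) :
    ContDiffOn ℝ ∞ (fun x => r x ^ μ) Ω :=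
  F.smooth_r.rpow_const_of_ne fun x hx => (F.pos x hx).ne'

theorem VacuumFrame.pd_rpow (F : VacuumFrame M Ω r S) (μ : ℝ) {x : Space} (hx : x ∈ Ω)
    (j : Fin 3) : pd j (fun y => r y ^ μ) x = μ * r x ^ (μ - 1) * pd j r x := by
  have h0 := (F.pos x hx).ne'
  rw [pd_comp (ψ := fun t => t ^ μ) j (Real.differentiableAt_rpow_const_of_ne μ h0)
    (diffAt_of_contDiffOn F.isOpen F.smooth_r hx), Real.deriv_rpow_const]

theorem VacuumFrame.aesm (F : VacuumFrame M Ω r S) (hc : ContinuousOn c Ω) :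
    AEStronglyMeasurable c (volume.restrict Ω) :=
  hc.aestronglyMeasurable F.isOpen.measurableSet

theorem VacuumFrame.rpow_succ (F : VacuumFrame M Ω r S) (μ : ℝ) {x : Space} (hx : x ∈ Ω) :
    r x ^ μ = r x ^ (μ - 1) * r x := by
  rw [← Real.rpow_add_one (F.pos x hx).ne', sub_add_cancel]

/-- A pointwise form of Young's inequality with split weights. -/
theorem rpow_mul_abs_mul_le {t a b : ℝ} (ht : 0 < t) (h : μ + ν = 2 * σ) :
    t ^ σ * (|a| * |b|) ≤ (t ^ μ * a ^ 2 + t ^ ν * b ^ 2) / 2 := by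
  have e1 : t ^ μ = (t ^ (μ / 2)) ^ 2 := by
    rw [← Real.rpow_natCast, ← Real.rpow_mul ht.le]; norm_num
  have e2 : t ^ ν = (t ^ (ν / 2)) ^ 2 := by
    rw [← Real.rpow_natCast, ← Real.rpow_mul ht.le]; norm_num
  have e3 : t ^ σ = t ^ (μ / 2) * t ^ (ν / 2) := by
    rw [← Real.rpow_add ht]; congr 1; linarith
  rw [e1, e2, e3, ← sq_abs a, ← sq_abs b]
  nlinarith [sq_nonneg (t ^ (μ / 2) * |a| - t ^ (ν / 2) * |b|)]

theorem WL.integrable_mul (F : VacuumFrame M Ω r S) (hf : WL Ω r μ f) (hg : WL Ω r ν g)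
    (hc : AEStronglyMeasurable c (volume.restrict Ω)) (hb : ∀ x ∈ Ω, |c x| ≤ B * r x ^ σ)
    (hσ : μ + ν = 2 * σ) : IntegrableOn (fun x => c x * f x * g x) Ω := by
  refine Integrable.mono' ((hf.2.add hg.2).const_mul (|B| / 2)) ((hc.mul hf.1).mul hg.1) ?_
  filter_upwards [ae_restrict_mem F.isOpen.measurableSet] with x hx
  have hr := F.pos x hx
  have h1 := rpow_mul_abs_mul_le (a := f x) (b := g x) hr hσ
  have h2 : |c x| ≤ |B| * r x ^ σ := (hb x hx).trans
    (mul_le_mul_of_nonneg_right (le_abs_self B) (Real.rpow_nonneg hr.le _))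
  rw [Real.norm_eq_abs, abs_mul, abs_mul, mul_assoc]
  calc |c x| * (|f x| * |g x|) ≤ |B| * r x ^ σ * (|f x| * |g x|) :=
        mul_le_mul_of_nonneg_right h2 (by positivity)
    _ = |B| * (r x ^ σ * (|f x| * |g x|)) := by ring
    _ ≤ |B| * ((r x ^ μ * f x ^ 2 + r x ^ ν * g x ^ 2) / 2) :=
        mul_le_mul_of_nonneg_left h1 (abs_nonneg _)
    _ = _ := by simp only [Pi.add_apply]; ring

theorem WL.mono (F : VacuumFrame M Ω r S) (hf : WL Ω r μ f) (h : μ ≤ ν) : WL Ω r ν f := by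
  refine ⟨hf.1, Integrable.mono' (hf.2.const_mul (M ^ (ν - μ)))
    ((F.aesm (F.contDiffOn_rpow ν).continuousOn).mul (hf.1.pow 2)) ?_⟩
  filter_upwards [ae_restrict_mem F.isOpen.measurableSet] with x hx
  have hr := F.pos x hx
  have e : r x ^ ν = r x ^ (ν - μ) * r x ^ μ := by rw [← Real.rpow_add hr]; ring_nf
  rw [Real.norm_of_nonneg (mul_nonneg (Real.rpow_nonneg hr.le _) (sq_nonneg _)), e, mul_assoc]
  exact mul_le_mul_of_nonneg_right (Real.rpow_le_rpow hr.le (F.r_le x hx) (by linarith))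
    (mul_nonneg (Real.rpow_nonneg hr.le _) (sq_nonneg _))

theorem WL.of_le (F : VacuumFrame M Ω r S) (hf : WL Ω r μ f)
    (hg : AEStronglyMeasurable g (volume.restrict Ω)) (hb : ∀ x ∈ Ω, |g x| ≤ B * |f x|) :
    WL Ω r μ g := by
  refine ⟨hg, Integrable.mono' (hf.2.const_mul (B ^ 2))
    ((F.aesm (F.contDiffOn_rpow μ).continuousOn).mul (hg.pow 2)) ?_⟩
  filter_upwards [ae_restrict_mem F.isOpen.measurableSet] with x hx
  have hr := F.pos x hx
  rw [Real.norm_of_nonneg (mul_nonneg (Real.rpow_nonneg hr.le _) (sq_nonneg _))]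
  have : g x ^ 2 ≤ B ^ 2 * f x ^ 2 := by
    rw [← sq_abs (g x), ← sq_abs (f x), ← mul_pow]
    exact pow_le_pow_left₀ (abs_nonneg _) (hb x hx) 2
  calc r x ^ μ * g x ^ 2 ≤ r x ^ μ * (B ^ 2 * f x ^ 2) :=
        mul_le_mul_of_nonneg_left this (Real.rpow_nonneg hr.le _)
    _ = _ := by ring

theorem WL.add (F : VacuumFrame M Ω r S) (hf : WL Ω r μ f) (hg : WL Ω r μ g) :
    WL Ω r μ (fun x => f x + g x) := by
  refine ⟨hf.1.add hg.1, Integrable.mono' ((hf.2.add hg.2).const_mul 2)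
    ((F.aesm (F.contDiffOn_rpow μ).continuousOn).mul ((hf.1.add hg.1).pow 2)) ?_⟩
  filter_upwards [ae_restrict_mem F.isOpen.measurableSet] with x hx
  have hr := Real.rpow_nonneg (F.pos x hx).le μ
  rw [Real.norm_of_nonneg (mul_nonneg hr (sq_nonneg _))]
  simp only [Pi.add_apply]
  nlinarith [mul_nonneg hr (sq_nonneg (f x - g x))]

theorem WL.bdd_mul (F : VacuumFrame M Ω r S) (hf : WL Ω r μ f) (hc : ContinuousOn c Ω)
    (hb : ∀ x ∈ Ω, |c x| ≤ B) : WL Ω r μ (fun x => c x * f x) :=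
  hf.of_le F ((F.aesm hc).mul hf.1) fun x hx => by
    rw [abs_mul]; exact mul_le_mul_of_nonneg_right (hb x hx) (abs_nonneg _)

theorem WL.zero : WL Ω r μ (fun _ => 0) :=
  ⟨aestronglyMeasurable_const, by simp⟩

theorem WL.sum (F : VacuumFrame M Ω r S) {ι : Type*} (s : Finset ι) {f : ι → Space → ℝ}
    (hf : ∀ i ∈ s, WL Ω r μ (f i)) : WL Ω r μ (fun x => ∑ i ∈ s, f i x) := by
  classical
  induction s using Finset.induction_on with
  | empty => simpa using WL.zero
  | insert i s hi ih =>
    simp only [Finset.sum_insert hi]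
    exact (hf i (Finset.mem_insert_self i s)).add F
      (ih fun j hj => hf j (Finset.mem_insert_of_mem hj))

theorem WL.abs (hf : WL Ω r μ f) : WL Ω r μ (fun x => |f x|) :=
  ⟨by simpa [Real.norm_eq_abs] using hf.1.norm, by simpa [WL, sq_abs] using hf.2⟩

theorem WL.congr (hf : WL Ω r μ f) (h : g =ᵐ[volume.restrict Ω] f) : WL Ω r μ g :=
  ⟨hf.1.congr h.symm, hf.2.congr (by filter_upwards [h] with x hx; rw [hx])⟩

/-! ### Integration by parts up to the boundary -/

/-- If `W` is the distributional divergence of `V` and `V / r` is integrable, then there is no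
boundary contribution and `∫_Ω W = 0`. -/
theorem VacuumFrame.integral_eq_zero (F : VacuumFrame M Ω r S) {W : Space → ℝ}
    {V : Fin 3 → Space → ℝ} (hW : IntegrableOn W Ω)
    (hV : ∀ j, IntegrableOn (fun x => (r x)⁻¹ * V j x) Ω)
    (hdiv : ∀ φ, IsTestFunction Ω φ → ∫ x in Ω, (φ x * W x + ∑ j, pd j φ x * V j x) = 0) :
    ∫ x in Ω, W x = 0 := by
  obtain ⟨χ, C, hχ, hχ1, hχC, hχl⟩ := F.exists_cutoff
  have hlim : Tendsto (fun n => ∫ x in Ω, (χ n x * W x + ∑ j, pd j (χ n) x * V j x)) atTop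
      (𝓝 (∫ x in Ω, W x)) := by
    refine tendsto_integral_of_dominated_convergence
      (fun x => |W x| + ∑ j, C * |(r x)⁻¹ * V j x|) (fun n => ?_) ?_ (fun n => ?_) ?_
    · refine ((hχ n).1.continuous.aestronglyMeasurable.mul hW.1).add
        (Finset.univ.aestronglyMeasurable_fun_sum fun j _ => ?_)
      have h1 : AEStronglyMeasurable (fun x => (pd j (χ n) x * r x) * ((r x)⁻¹ * V j x))
          (volume.restrict Ω) :=
        (((hχ n).pd j).1.continuous.aestronglyMeasurable.mul
          (F.aesm F.smooth_r.continuousOn)).mul (hV j).1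
      refine h1.congr ?_
      filter_upwards [ae_restrict_mem F.isOpen.measurableSet] with x hx
      have := (F.pos x hx).ne'
      field_simp
    · exact hW.abs.add (integrable_finsetSum _ fun j _ => (hV j).abs.const_mul C)
    · filter_upwards [ae_restrict_mem F.isOpen.measurableSet] with x hx
      refine (norm_add_le _ _).trans (add_le_add ?_ ((norm_sum_le _ _).trans
        (Finset.sum_le_sum fun j _ => ?_)))
      · rw [norm_mul, Real.norm_eq_abs, Real.norm_eq_abs]
        exact mul_le_of_le_one_left (abs_nonneg _) (hχ1 n x)
      · have e : pd j (χ n) x * V j x = (r x * pd j (χ n) x) * ((r x)⁻¹ * V j x) := by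
          have := (F.pos x hx).ne'
          field_simp
        rw [e, Real.norm_eq_abs, abs_mul]
        exact mul_le_mul_of_nonneg_right (hχC n x hx j) (abs_nonneg _)
    · filter_upwards [ae_restrict_mem F.isOpen.measurableSet] with x hx
      refine tendsto_const_nhds.congr' ?_
      filter_upwards [hχl x hx] with n hn
      simp [hn.1, hn.2]
  refine tendsto_nhds_unique hlim (tendsto_const_nhds.congr fun n => ?_)
  exact (hdiv _ (hχ n)).symm

theorem HasWD.global_integral_mul (F : VacuumFrame M Ω r S) (hg : HasWD Ω g g')
    (hh : HasWD Ω h h') (hc : ContDiffOn ℝ ∞ c Ω) (j : Fin 3)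
    (i1 : IntegrableOn (fun x => c x * g' j x * h x) Ω)
    (i2 : IntegrableOn (fun x => c x * g x * h' j x) Ω)
    (i3 : IntegrableOn (fun x => pd j c x * g x * h x) Ω)
    (i4 : IntegrableOn (fun x => (r x)⁻¹ * (c x * g x * h x)) Ω) :
    ∫ x in Ω, (c x * g' j x * h x + c x * g x * h' j x + pd j c x * g x * h x) = 0 := by
  refine F.integral_eq_zero (V := fun k x => if k = j then c x * g x * h x else 0)
    ((i1.add i2).add i3) (fun k => ?_) fun φ hφ => ?_
  · by_cases hk : k = j
    · simpa [hk] using i4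
    · simp [hk]
  · refine Eq.trans ?_ (HasWD.integral_mul F.isOpen hg hh (hφ.smul F.isOpen hc) j)
    refine setIntegral_congr_fun F.isOpen.measurableSet fun x hx => ?_
    simp only [mul_ite, mul_zero, Finset.sum_ite_eq', Finset.mem_univ, if_true]
    rw [pd_mul j (diffAt_of_contDiffOn F.isOpen hc hx) (hφ.1.differentiable (by simp) x)]
    ring

theorem HasWD.global_integral_null_form (F : VacuumFrame M Ω r S) (hg : HasWD Ω g g')
    (hh : HasWD Ω h h') (hc : ContDiffOn ℝ ∞ c Ω) (i j : Fin 3)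
    (i1 : ∀ i j, IntegrableOn (fun x => c x * g' i x * h' j x) Ω)
    (i2 : ∀ i j, IntegrableOn (fun x => pd i c x * g x * h' j x) Ω)
    (i3 : ∀ j, IntegrableOn (fun x => (r x)⁻¹ * (c x * g x * h' j x)) Ω) :
    ∫ x in Ω, (c x * g' i x * h' j x - c x * g' j x * h' i x
      + pd i c x * g x * h' j x - pd j c x * g x * h' i x) = 0 := by
  refine F.integral_eq_zero (V := fun k x => (if k = i then c x * g x * h' j x else 0)
      - (if k = j then c x * g x * h' i x else 0))
    ((((i1 i j).sub (i1 j i)).add (i2 i j)).sub (i2 j i)) (fun k => ?_) fun φ hφ => ?_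
  · have e : ∀ a b, IntegrableOn (fun x => (r x)⁻¹ * (if k = a then c x * g x * h' b x else 0)) Ω :=
      fun a b => by
        by_cases hk : k = a
        · simpa [hk] using i3 b
        · simp [hk]
    simp only [mul_sub]
    exact (e i j).sub (e j i)
  · refine Eq.trans ?_ (HasWD.integral_null_form F.isOpen hg hh (hφ.smul F.isOpen hc) i j)
    refine setIntegral_congr_fun F.isOpen.measurableSet fun x hx => ?_
    simp only [mul_sub, mul_ite, mul_zero, Finset.sum_ite_eq', Finset.mem_univ, if_true,
      Finset.sum_sub_distrib]
    have hd := diffAt_of_contDiffOn F.isOpen hc hx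
    have hφd := hφ.1.differentiable (by simp) x
    rw [pd_mul i hd hφd, pd_mul j hd hφd]
    ring

/-- The weak gradient is controlled by the frame derivatives. -/
theorem VacuumFrame.wl_of_frameD (F : VacuumFrame M Ω r S) (hg : HasWD Ω g g')
    (hgX : ∀ a, ∀ x ∈ Ω, gX a x = frameD S a g' x) (hX : ∀ a, WL Ω r μ (gX a)) (j : Fin 3) :
    WL Ω r μ (g' j) := by
  refine (WL.sum F Finset.univ fun a _ => (hX a).abs).of_le (B := M) F ?_ fun x hx => ?_
  · have hl : LocallyIntegrableOn (g' j) Ω := by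
      refine (locallyIntegrableOn_iff F.isOpen.isLocallyClosed).2 fun K hK hKc => ?_
      have : IsFiniteMeasure (volume.restrict K) := ⟨by simpa using hKc.measure_lt_top⟩
      exact (hg.l2' j K hK hKc).integrable (by norm_num)
    exact hl.aestronglyMeasurable
  · refine (F.coercive x hx (fun k => g' k x) j).trans (le_of_eq ?_)
    rw [abs_of_nonneg (Finset.sum_nonneg fun a _ => abs_nonneg _)]
    congr 1
    exact Finset.sum_congr rfl fun a _ => by rw [hgX a x hx]; rfl

theorem VacuumFrame.contDiffOn_rpow_mul (F : VacuumFrame M Ω r S) (μ : ℝ)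
    (hφ : ContDiffOn ℝ ∞ φ Ω) : ContDiffOn ℝ ∞ (fun x => r x ^ μ * φ x) Ω :=
  (F.contDiffOn_rpow μ).mul hφ

theorem VacuumFrame.pd_rpow_mul (F : VacuumFrame M Ω r S) (μ : ℝ) (hφ : ContDiffOn ℝ ∞ φ Ω)
    {x : Space} (hx : x ∈ Ω) (j : Fin 3) : pd j (fun y => r y ^ μ * φ y) x
      = μ * r x ^ (μ - 1) * pd j r x * φ x + r x ^ μ * pd j φ x := by
  rw [pd_mul j (diffAt_of_contDiffOn F.isOpen (F.contDiffOn_rpow μ) hx)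
    (diffAt_of_contDiffOn F.isOpen hφ hx), F.pd_rpow μ hx]

theorem VacuumFrame.abs_rpow_mul_le (F : VacuumFrame M Ω r S) (μ : ℝ) {x : Space} (hx : x ∈ Ω)
    (hφB : |φ x| ≤ B) : |r x ^ μ * φ x| ≤ (B * M * (|μ| + 1)) * r x ^ μ := by
  have hr := Real.rpow_nonneg (F.pos x hx).le μ
  have hB : 0 ≤ B := (abs_nonneg _).trans hφB
  rw [abs_mul, abs_of_nonneg hr, mul_comm]
  refine mul_le_mul_of_nonneg_right (hφB.trans ?_) hr
  have h1 : 1 ≤ M * (|μ| + 1) := by nlinarith [F.one_le, abs_nonneg μ]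
  nlinarith

theorem VacuumFrame.abs_pd_rpow_mul_le (F : VacuumFrame M Ω r S) (μ : ℝ)
    (hφ : ContDiffOn ℝ ∞ φ Ω) {x : Space} (hx : x ∈ Ω) (hφB : |φ x| ≤ B) {j : Fin 3}
    (hφ'B : |pd j φ x| ≤ B) :
    |pd j (fun y => r y ^ μ * φ y) x| ≤ (B * M * (|μ| + 1)) * r x ^ (μ - 1) := by
  have hr := Real.rpow_nonneg (F.pos x hx).le (μ - 1)
  have hB : 0 ≤ B := (abs_nonneg _).trans hφB
  have hM := F.M_nonneg
  rw [F.pd_rpow_mul μ hφ hx, F.rpow_succ μ hx]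
  refine (abs_add_le _ _).trans ?_
  rw [abs_mul, abs_mul, abs_mul, abs_mul, abs_mul, abs_of_nonneg hr, abs_of_pos (F.pos x hx)]
  have h1 : |μ| * r x ^ (μ - 1) * |pd j r x| * |φ x| ≤ |μ| * r x ^ (μ - 1) * M * B :=
    mul_le_mul (mul_le_mul_of_nonneg_left (F.pd_r_le x hx j) (mul_nonneg (abs_nonneg _) hr))
      hφB (abs_nonneg _) (mul_nonneg (mul_nonneg (abs_nonneg _) hr) hM)
  have h2 : r x ^ (μ - 1) * r x * |pd j φ x| ≤ r x ^ (μ - 1) * M * B :=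
    mul_le_mul (mul_le_mul_of_nonneg_left (F.r_le x hx) hr) hφ'B (abs_nonneg _)
      (mul_nonneg hr hM)
  linarith

/-- The divergence `∑_j ∂_j S_{aj}` of the vector field `X_a`. -/
def frameDiv (S : Fin 3 → Fin 3 → Space → ℝ) (a : Fin 3) : Space → ℝ :=
  fun x => ∑ j, pd j (S a j) x

theorem VacuumFrame.abs_frameDiv_le (F : VacuumFrame M Ω r S) {x : Space} (hx : x ∈ Ω)
    (a : Fin 3) : |frameDiv S a x| ≤ 3 * M := by
  refine (Finset.abs_sum_le_sum_abs _ _).trans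
    ((Finset.sum_le_sum fun j _ => F.pd_S_le x hx j a j).trans (le_of_eq ?_))
  simp

/-- `|X_a c|` is controlled by the coordinate derivatives. -/
theorem VacuumFrame.abs_frameD_le (F : VacuumFrame M Ω r S) {x : Space} (hx : x ∈ Ω)
    (hb : ∀ j, |g' j x| ≤ B) (a : Fin 3) : |frameD S a g' x| ≤ 3 * (M * B) := by
  refine (Finset.abs_sum_le_sum_abs _ _).trans ((Finset.sum_le_sum (g := fun _ => M * B)
    fun j _ => ?_).trans (le_of_eq ?_))
  · rw [abs_mul]
    exact mul_le_mul (F.S_le x hx a j) (hb j) (abs_nonneg _) F.M_nonneg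
  · simp

/-- Integration by parts of the frame derivative `X_a` with a coefficient `c = O(r^μ)`. -/
theorem HasXD.ibp (F : VacuumFrame M Ω r S) (hg : HasXD Ω S g gX) (hh : HasXD Ω S h hX)
    (hgL : WL Ω r (μ - 1) g) (hhL : WL Ω r (μ - 1) h) (hgXL : ∀ a, WL Ω r (μ + 1) (gX a))
    (hhXL : ∀ a, WL Ω r (μ + 1) (hX a)) (hc : ContDiffOn ℝ ∞ c Ω)
    (hcB : ∀ x ∈ Ω, |c x| ≤ B * r x ^ μ) (hc'B : ∀ x ∈ Ω, ∀ j, |pd j c x| ≤ B * r x ^ (μ - 1))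
    (a : Fin 3) :
    ∃ D : Space → ℝ, IntegrableOn D Ω ∧ ∫ x in Ω, D x = 0 ∧ ∀ x ∈ Ω,
      D x = c x * (gX a x * h x + g x * hX a x)
        + (frameD S a (fun j => pd j c) x + c x * frameDiv S a x) * g x * h x := by
  obtain ⟨g', hgW, hgE⟩ := hg
  obtain ⟨h', hhW, hhE⟩ := hh
  have hM := F.M_nonneg
  have hg'L := F.wl_of_frameD hgW hgE hgXL
  have hh'L := F.wl_of_frameD hhW hhE hhXL
  let k : Fin 3 → Space → ℝ := fun j x => c x * S a j x
  have hks : ∀ j, ContDiffOn ℝ ∞ (k j) Ω := fun j => hc.mul (F.smooth_S a j)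
  have hkm : ∀ j, AEStronglyMeasurable (k j) (volume.restrict Ω) := fun j =>
    F.aesm (hks j).continuousOn
  have hkb : ∀ j, ∀ x ∈ Ω, |k j x| ≤ (B * M) * r x ^ μ := fun j x hx => by
    simp only [k]
    rw [abs_mul]
    refine (mul_le_mul (hcB x hx) (F.S_le x hx a j) (abs_nonneg _)
      ((abs_nonneg _).trans (hcB x hx))).trans (le_of_eq (by ring))
  have hpd : ∀ j, ∀ x ∈ Ω, pd j (k j) x = pd j c x * S a j x + c x * pd j (S a j) x :=
    fun j x hx => pd_mul j (diffAt_of_contDiffOn F.isOpen hc hx)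
      (diffAt_of_contDiffOn F.isOpen (F.smooth_S a j) hx)
  have hpdb : ∀ j, ∀ x ∈ Ω, |pd j (k j) x| ≤ (B * M + B * M * M) * r x ^ (μ - 1) :=
    fun j x hx => by
    have h0 := (abs_nonneg _).trans (hc'B x hx j)
    rw [hpd j x hx]
    refine (abs_add_le _ _).trans ?_
    rw [abs_mul, abs_mul]
    have h1 := mul_le_mul (hc'B x hx j) (F.S_le x hx a j) (abs_nonneg _) h0
    have h2 : |c x| ≤ B * r x ^ (μ - 1) * M := by
      refine (hcB x hx).trans ?_
      rw [F.rpow_succ μ hx, ← mul_assoc]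
      exact mul_le_mul_of_nonneg_left (F.r_le x hx) h0
    have h3 := mul_le_mul h2 (F.pd_S_le x hx j a j) (abs_nonneg _) (mul_nonneg h0 hM)
    linarith
  have i1 : ∀ j, IntegrableOn (fun x => k j x * g' j x * h x) Ω := fun j =>
    WL.integrable_mul F (hg'L j) hhL (hkm j) (hkb j) (by ring)
  have i2 : ∀ j, IntegrableOn (fun x => k j x * g x * h' j x) Ω := fun j =>
    WL.integrable_mul F hgL (hh'L j) (hkm j) (hkb j) (by ring)
  have i3 : ∀ j, IntegrableOn (fun x => pd j (k j) x * g x * h x) Ω := fun j =>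
    WL.integrable_mul F hgL hhL (F.aesm (contDiffOn_pd F.isOpen j (hks j)).continuousOn)
      (hpdb j) (by ring)
  have i4 : ∀ j, IntegrableOn (fun x => (r x)⁻¹ * (k j x * g x * h x)) Ω := fun j => by
    have hm : AEStronglyMeasurable (fun x => (r x)⁻¹ * k j x) (volume.restrict Ω) :=
      F.aesm ((F.smooth_r.continuousOn.inv₀ fun x hx => (F.pos x hx).ne').mul (hks j).continuousOn)
    have := WL.integrable_mul (σ := μ - 1) (B := B * M) F hgL hhL hm (fun x hx => ?_) (by ring)
    · refine this.congr (Eventually.of_forall fun x => ?_)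
      simp only []; ring
    · have hr := F.pos x hx
      rw [abs_mul, abs_of_pos (inv_pos.2 hr), inv_mul_le_iff₀ hr]
      refine (hkb j x hx).trans (le_of_eq ?_)
      rw [F.rpow_succ μ hx]; ring
  refine ⟨fun x => ∑ j, (k j x * g' j x * h x + k j x * g x * h' j x + pd j (k j) x * g x * h x),
    integrable_finsetSum _ fun j _ => ((i1 j).add (i2 j)).add (i3 j), ?_, fun x hx => ?_⟩
  · rw [integral_finsetSum _ fun j _ => ((i1 j).fun_add (i2 j)).fun_add (i3 j)]
    exact Finset.sum_eq_zero fun j _ =>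
      HasWD.global_integral_mul F hgW hhW (hks j) j (i1 j) (i2 j) (i3 j) (i4 j)
  · rw [hgE a x hx, hhE a x hx]
    simp only [frameD, frameDiv, Fin.sum_univ_three, hpd _ x hx, k]
    ring

/-- Integration by parts of the frame derivative `X_a` with the weight `r^μ φ`: up to an integrable
function `D` of integral zero, `r^μ φ X_a (g h) + μ r^{μ-1} (X_a r) φ g h` is `O(r^μ |g h|)`. -/
theorem HasXD.weighted_ibp (F : VacuumFrame M Ω r S) (hg : HasXD Ω S g gX) (hh : HasXD Ω S h hX)
    (hgL : WL Ω r (μ - 1) g) (hhL : WL Ω r (μ - 1) h) (hgXL : ∀ a, WL Ω r (μ + 1) (gX a))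
    (hhXL : ∀ a, WL Ω r (μ + 1) (hX a)) (hφ : ContDiffOn ℝ ∞ φ Ω) (hφB : ∀ x ∈ Ω, |φ x| ≤ B)
    (hφ'B : ∀ x ∈ Ω, ∀ j, |pd j φ x| ≤ B) (a : Fin 3) :
    ∃ D : Space → ℝ, IntegrableOn D Ω ∧ ∫ x in Ω, D x = 0 ∧ ∀ x ∈ Ω,
      |D x - (r x ^ μ * φ x * (gX a x * h x + g x * hX a x)
        + μ * r x ^ (μ - 1) * conormal S r a x * φ x * g x * h x)|
      ≤ 6 * B * M * (r x ^ μ * (|g x| * |h x|)) := by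
  obtain ⟨D, hD, hD0, hDe⟩ := HasXD.ibp F hg hh hgL hhL hgXL hhXL (F.contDiffOn_rpow_mul μ hφ)
    (fun x hx => F.abs_rpow_mul_le μ hx (hφB x hx))
    (fun x hx j => F.abs_pd_rpow_mul_le μ hφ hx (hφB x hx) (hφ'B x hx j)) a
  refine ⟨D, hD, hD0, fun x hx => ?_⟩
  have hr := Real.rpow_nonneg (F.pos x hx).le μ
  have hB : 0 ≤ B := (abs_nonneg _).trans (hφB x hx)
  have e : D x - (r x ^ μ * φ x * (gX a x * h x + g x * hX a x)
        + μ * r x ^ (μ - 1) * conormal S r a x * φ x * g x * h x)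
      = r x ^ μ * (g x * h x) * (frameD S a (fun j => pd j φ) x + φ x * frameDiv S a x) := by
    rw [hDe x hx]
    simp only [frameD, conormal, Fin.sum_univ_three, F.pd_rpow_mul μ hφ hx]
    ring
  have h1 := F.abs_frameD_le hx (g' := fun j => pd j φ) (hφ'B x hx) a
  have h2 := mul_le_mul (hφB x hx) (F.abs_frameDiv_le hx a) (abs_nonneg _) hB
  rw [← abs_mul] at h2
  rw [e, abs_mul, abs_mul, abs_mul, abs_of_nonneg hr]
  have := mul_le_mul_of_nonneg_left ((abs_add_le _ _).trans (add_le_add h1 h2))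
    (show 0 ≤ r x ^ μ * (|g x| * |h x|) by positivity)
  linarith

/-- Integration by parts for the null form `X_a g X_b h - X_b g X_a h` with the weight `r^μ`. -/
theorem HasXD.weighted_null_form (F : VacuumFrame M Ω r S) (hg : HasXD Ω S g gX)
    (hh : HasXD Ω S h hX) (hgL : WL Ω r (μ - 2) g) (hgXL : ∀ a, WL Ω r μ (gX a))
    (hhXL : ∀ a, WL Ω r μ (hX a)) (a b : Fin 3) :
    ∃ D : Space → ℝ, IntegrableOn D Ω ∧ ∫ x in Ω, D x = 0 ∧ ∀ x ∈ Ω,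
      |D x - r x ^ μ * (gX a x * hX b x - gX b x * hX a x)|
      ≤ 18 * (|μ| + 2) * M ^ 4 * (r x ^ (μ - 1) * (|g x| * ∑ k, |hX k x|)) := by
  obtain ⟨g', hgW, hgE⟩ := hg
  obtain ⟨h', hhW, hhE⟩ := hh
  have hM := F.M_nonneg
  have hg'L := F.wl_of_frameD hgW hgE hgXL
  have hh'L := F.wl_of_frameD hhW hhE hhXL
  let c : Fin 3 → Fin 3 → Space → ℝ := fun i j x => r x ^ μ * (S a i x * S b j x)
  have hcs : ∀ i j, ContDiffOn ℝ ∞ (c i j) Ω := fun i j =>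
    (F.contDiffOn_rpow μ).mul ((F.smooth_S a i).mul (F.smooth_S b j))
  have hcm : ∀ i j, AEStronglyMeasurable (c i j) (volume.restrict Ω) := fun i j =>
    F.aesm (hcs i j).continuousOn
  have hSS : ∀ i j, ∀ x ∈ Ω, |S a i x * S b j x| ≤ M * M := fun i j x hx => by
    rw [abs_mul]; exact mul_le_mul (F.S_le x hx a i) (F.S_le x hx b j) (abs_nonneg _) hM
  have hcb : ∀ i j, ∀ x ∈ Ω, |c i j x| ≤ (M * M) * r x ^ μ := fun i j x hx => by
    have hr := Real.rpow_nonneg (F.pos x hx).le μ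
    simp only [c]
    rw [abs_mul, abs_of_nonneg hr, mul_comm]
    exact mul_le_mul_of_nonneg_right (hSS i j x hx) hr
  have hpd : ∀ k i j, ∀ x ∈ Ω, pd k (c i j) x = μ * r x ^ (μ - 1) * pd k r x * (S a i x * S b j x)
      + r x ^ (μ - 1) * r x * (pd k (S a i) x * S b j x + S a i x * pd k (S b j) x) :=
    fun k i j x hx => by
    have d1 := diffAt_of_contDiffOn F.isOpen (F.contDiffOn_rpow μ) hx
    have d2 := diffAt_of_contDiffOn F.isOpen (F.smooth_S a i) hx
    have d3 := diffAt_of_contDiffOn F.isOpen (F.smooth_S b j) hx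
    simp only [c]
    rw [pd_mul k d1 (d2.fun_mul d3), pd_mul k d2 d3, F.pd_rpow μ hx, F.rpow_succ μ hx]
  have hpdb : ∀ k i j, ∀ x ∈ Ω, |pd k (c i j) x| ≤ ((|μ| + 2) * M ^ 3) * r x ^ (μ - 1) :=
    fun k i j x hx => by
    have hr := Real.rpow_nonneg (F.pos x hx).le (μ - 1)
    rw [hpd k i j x hx]
    refine (abs_add_le _ _).trans ?_
    have h1 : |μ * r x ^ (μ - 1) * pd k r x * (S a i x * S b j x)|
        ≤ |μ| * r x ^ (μ - 1) * M * (M * M) := by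
      rw [abs_mul, abs_mul, abs_mul, abs_of_nonneg hr]
      exact mul_le_mul (mul_le_mul_of_nonneg_left (F.pd_r_le x hx k)
        (mul_nonneg (abs_nonneg _) hr)) (hSS i j x hx) (abs_nonneg _)
        (mul_nonneg (mul_nonneg (abs_nonneg _) hr) hM)
    have h2 : |pd k (S a i) x * S b j x + S a i x * pd k (S b j) x| ≤ M * M + M * M := by
      refine (abs_add_le _ _).trans ?_
      rw [abs_mul, abs_mul]
      exact add_le_add (mul_le_mul (F.pd_S_le x hx k a i) (F.S_le x hx b j) (abs_nonneg _) hM)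
        (mul_le_mul (F.S_le x hx a i) (F.pd_S_le x hx k b j) (abs_nonneg _) hM)
    have h3 : |r x ^ (μ - 1) * r x * (pd k (S a i) x * S b j x + S a i x * pd k (S b j) x)|
        ≤ r x ^ (μ - 1) * M * (M * M + M * M) := by
      rw [abs_mul, abs_mul, abs_of_nonneg hr, abs_of_pos (F.pos x hx)]
      exact mul_le_mul (mul_le_mul_of_nonneg_left (F.r_le x hx) hr) h2 (abs_nonneg _)
        (mul_nonneg hr hM)
    linarith
  have i1 : ∀ i j k l, IntegrableOn (fun x => c i j x * g' k x * h' l x) Ω := fun i j k l =>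
    WL.integrable_mul F (hg'L k) (hh'L l) (hcm i j) (hcb i j) (by ring)
  have i2 : ∀ i j k l, IntegrableOn (fun x => pd k (c i j) x * g x * h' l x) Ω := fun i j k l =>
    WL.integrable_mul F hgL (hh'L l) (F.aesm (contDiffOn_pd F.isOpen k (hcs i j)).continuousOn)
      (hpdb k i j) (by ring)
  have i3 : ∀ i j l, IntegrableOn (fun x => (r x)⁻¹ * (c i j x * g x * h' l x)) Ω :=
    fun i j l => by
    have hm : AEStronglyMeasurable (fun x => (r x)⁻¹ * c i j x) (volume.restrict Ω) :=
      F.aesm ((F.smooth_r.continuousOn.inv₀ fun x hx => (F.pos x hx).ne').mul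
        (hcs i j).continuousOn)
    have := WL.integrable_mul (σ := μ - 1) (B := M * M) F hgL (hh'L l) hm (fun x hx => ?_)
      (by ring)
    · refine this.congr (Eventually.of_forall fun x => ?_)
      simp only []; ring
    · have hr := F.pos x hx
      rw [abs_mul, abs_of_pos (inv_pos.2 hr), inv_mul_le_iff₀ hr]
      refine (hcb i j x hx).trans (le_of_eq ?_)
      rw [F.rpow_succ μ hx]; ring
  have iD : ∀ i j, IntegrableOn (fun x => c i j x * g' i x * h' j x - c i j x * g' j x * h' i x
      + pd i (c i j) x * g x * h' j x - pd j (c i j) x * g x * h' i x) Ω := fun i j =>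
    (((i1 i j i j).sub (i1 i j j i)).add (i2 i j i j)).sub (i2 i j j i)
  refine ⟨fun x => ∑ i, ∑ j, (c i j x * g' i x * h' j x - c i j x * g' j x * h' i x
      + pd i (c i j) x * g x * h' j x - pd j (c i j) x * g x * h' i x),
    integrable_finsetSum _ fun i _ => integrable_finsetSum _ fun j _ => iD i j, ?_,
    fun x hx => ?_⟩
  · rw [integral_finsetSum _ fun i _ => integrable_finsetSum _ fun j _ => iD i j]
    refine Finset.sum_eq_zero fun i _ => ?_
    rw [integral_finsetSum _ fun j _ => iD i j]
    exact Finset.sum_eq_zero fun j _ => HasWD.global_integral_null_form F hgW hhW (hcs i j) i j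
      (i1 i j) (i2 i j) (i3 i j)
  · have hr := Real.rpow_nonneg (F.pos x hx).le (μ - 1)
    have hh'b : ∀ l, |h' l x| ≤ M * ∑ k, |hX k x| := fun l => by
      refine (F.coercive x hx (fun k => h' k x) l).trans (le_of_eq ?_)
      congr 1
      exact Finset.sum_congr rfl fun k _ => by rw [hhE k x hx]; rfl
    have e : (∑ i, ∑ j, (c i j x * g' i x * h' j x - c i j x * g' j x * h' i x
          + pd i (c i j) x * g x * h' j x - pd j (c i j) x * g x * h' i x))
        - r x ^ μ * (gX a x * hX b x - gX b x * hX a x)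
        = ∑ i, ∑ j, (pd i (c i j) x * g x * h' j x - pd j (c i j) x * g x * h' i x) := by
      rw [hgE a x hx, hhE a x hx, hgE b x hx, hhE b x hx]
      simp only [frameD, Fin.sum_univ_three, c]
      ring
    have hterm : ∀ k i j l, |pd k (c i j) x * g x * h' l x|
        ≤ (|μ| + 2) * M ^ 4 * (r x ^ (μ - 1) * (|g x| * ∑ k, |hX k x|)) := fun k i j l => by
      rw [abs_mul, abs_mul]
      calc |pd k (c i j) x| * |g x| * |h' l x|
          ≤ ((|μ| + 2) * M ^ 3) * r x ^ (μ - 1) * |g x| * (M * ∑ k, |hX k x|) :=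
            mul_le_mul (mul_le_mul_of_nonneg_right (hpdb k i j x hx) (abs_nonneg _)) (hh'b l)
              (abs_nonneg _) (by positivity)
        _ = _ := by ring
    rw [e]
    refine (Finset.abs_sum_le_sum_abs _ _).trans ((Finset.sum_le_sum fun i _ =>
      (Finset.abs_sum_le_sum_abs _ _).trans (Finset.sum_le_sum fun j _ =>
        (abs_sub _ _).trans (add_le_add (hterm i i j j) (hterm j i j i)))).trans (le_of_eq ?_))
    simp only [Finset.sum_const, Finset.card_univ, Fintype.card_fin]
    ring

end Setting

end VacuumEuler

namespace VacuumEuler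

open Filter Topology

section Setting

variable {M B μ ν σ : ℝ} {Ω : Set Space} {r : Space → ℝ} {S : Fin 3 → Fin 3 → Space → ℝ}
  {f g h c φ : Space → ℝ} {g' h' gX hX : Fin 3 → Space → ℝ}

/-! ### The conormal -/

theorem VacuumFrame.contDiffOn_conormal (F : VacuumFrame M Ω r S) (a : Fin 3) :
    ContDiffOn ℝ ∞ (conormal S r a) Ω :=
  ContDiffOn.sum (s := Finset.univ) (f := fun j x => S a j x * pd j r x) fun j _ =>
    (F.smooth_S a j).mul (contDiffOn_pd F.isOpen j F.smooth_r)

theorem VacuumFrame.abs_conormal_le (F : VacuumFrame M Ω r S) {x : Space} (hx : x ∈ Ω)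
    (a : Fin 3) : |conormal S r a x| ≤ 3 * (M * M) :=
  F.abs_frameD_le hx (F.pd_r_le x hx) a

theorem VacuumFrame.abs_pd_conormal_le (F : VacuumFrame M Ω r S) {x : Space} (hx : x ∈ Ω)
    (a j : Fin 3) : |pd j (conormal S r a) x| ≤ 6 * (M * M) := by
  have hM := F.M_nonneg
  have e : pd j (conormal S r a) x
      = ∑ k, (pd j (S a k) x * pd k r x + S a k x * pd j (pd k r) x) := by
    have hd : ∀ k, DifferentiableAt ℝ (S a k) x := fun k =>
      diffAt_of_contDiffOn F.isOpen (F.smooth_S a k) hx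
    have hd' : ∀ k, DifferentiableAt ℝ (pd k r) x := fun k =>
      diffAt_of_contDiffOn F.isOpen (contDiffOn_pd F.isOpen k F.smooth_r) hx
    have : conormal S r a = fun y => S a 0 y * pd 0 r y + S a 1 y * pd 1 r y
        + S a 2 y * pd 2 r y := by
      funext y; simp [conormal, frameD, Fin.sum_univ_three]
    rw [this, pd_add j (((hd 0).fun_mul (hd' 0)).fun_add ((hd 1).fun_mul (hd' 1)))
      ((hd 2).fun_mul (hd' 2)), pd_add j ((hd 0).fun_mul (hd' 0)) ((hd 1).fun_mul (hd' 1)),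
      pd_mul j (hd 0) (hd' 0), pd_mul j (hd 1) (hd' 1), pd_mul j (hd 2) (hd' 2),
      Fin.sum_univ_three]
  rw [e]
  refine (Finset.abs_sum_le_sum_abs _ _).trans ((Finset.sum_le_sum
    (g := fun _ => M * M + M * M) fun k _ => ?_).trans (le_of_eq ?_))
  · refine (abs_add_le _ _).trans ?_
    rw [abs_mul, abs_mul]
    exact add_le_add (mul_le_mul (F.pd_S_le x hx j a k) (F.pd_r_le x hx k) (abs_nonneg _) hM)
      (mul_le_mul (F.S_le x hx a k) (F.pd_pd_r_le x hx j k) (abs_nonneg _) hM)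
  · simp; ring

theorem VacuumFrame.one_le_conormal (F : VacuumFrame M Ω r S) {x : Space} (hx : x ∈ Ω) :
    1 ≤ M * (∑ a, conormal S r a x ^ 2 + r x) :=
  F.nondegenerate x hx

/-! ### Hardy's inequality -/

/-- The pointwise inequality behind Hardy's inequality, with `a` the regularised weight,
`n = ∇r`, `y = ∇g` and `T` the integrand of an integration by parts. -/
theorem hardy_pointwise {lam r a g w k K L : ℝ} {n y : Fin 3 → ℝ} (hlam : 0 < lam) (hr : 0 < r)
    (ha : 0 ≤ a) (hM : 0 ≤ M) (hn : 1 ≤ M * (∑ i, n i ^ 2 + r)) (hw : w ≤ 2)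
    (hK : ∀ i, |n i| ≤ K) (hk : |k| ≤ L) :
    a * g ^ 2 / 2 ≤ M / lam * (2 * (r * a) * g * ∑ i, n i * y i
        + a * (∑ i, n i ^ 2) * (lam + 2 - w) * g ^ 2 + r * a * k * g ^ 2)
      + ((M * (1 + L / lam)) ^ 2 + 3 * (2 * K * M / lam) ^ 2) *
        (r ^ 2 * a * (g ^ 2 + ∑ i, y i ^ 2)) := by
  set N := ∑ i, n i ^ 2
  have hN : 0 ≤ N := Finset.sum_nonneg fun i _ => sq_nonneg _
  have hK0 : 0 ≤ K := (abs_nonneg _).trans (hK 0)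
  have hL0 : 0 ≤ L := (abs_nonneg _).trans hk
  set P := M * (1 + L / lam)
  set Q := 2 * K * M / lam
  have hQ0 : 0 ≤ Q := by positivity
  have h1 : P * r * g ^ 2 ≤ g ^ 2 / 4 + P ^ 2 * r ^ 2 * g ^ 2 := by
    nlinarith [mul_nonneg (sq_nonneg g) (sq_nonneg (P * r - 1 / 2))]
  have h2 : ∀ i, -(Q * r * (|g| * |y i|)) ≥ -(g ^ 2 / 12 + 3 * Q ^ 2 * (r ^ 2 * y i ^ 2)) := by
    intro i
    rw [← sq_abs g, ← sq_abs (y i)]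
    nlinarith [sq_nonneg (|g| - 6 * (Q * r * |y i|))]
  have h3 : ∀ i, 2 * M / lam * (r * g * (n i * y i)) ≥ -(Q * r * (|g| * |y i|)) := by
    intro i
    have : |2 * M / lam * (r * g * (n i * y i))| ≤ Q * r * (|g| * |y i|) := by
      rw [abs_mul, abs_mul, abs_mul, abs_mul, abs_of_pos hr,
        abs_of_nonneg (show 0 ≤ 2 * M / lam by positivity)]
      have := mul_le_mul_of_nonneg_left (hK i)
        (show 0 ≤ 2 * M / lam * (r * (|g| * |y i|)) by positivity)
      refine le_trans (le_of_eq ?_) (this.trans (le_of_eq ?_))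
      · ring
      · simp only [Q]; ring
    exact (abs_le.1 this).1
  have h4 : M / lam * (N * (lam + 2 - w) * g ^ 2) ≥ M * N * g ^ 2 := by
    have : M / lam * (N * (lam + 2 - w) * g ^ 2) - M * N * g ^ 2
        = M / lam * (N * (2 - w) * g ^ 2) := by field_simp; ring
    have h5 : 0 ≤ M / lam * (N * (2 - w) * g ^ 2) := by
      have : 0 ≤ 2 - w := by linarith
      positivity
    linarith
  have h5 : M / lam * (r * k * g ^ 2) ≥ -(M * (L / lam) * r * g ^ 2) := by
    have := mul_le_mul_of_nonneg_left (neg_le_of_abs_le hk)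
      (show 0 ≤ M / lam * (r * g ^ 2) by positivity)
    refine le_trans (le_of_eq ?_) (this.trans (le_of_eq ?_)) <;> ring
  have h6 : g ^ 2 ≤ M * N * g ^ 2 + M * r * g ^ 2 := by nlinarith [sq_nonneg g]
  have key : g ^ 2 / 2 ≤ M / lam * (2 * r * g * ∑ i, n i * y i + N * (lam + 2 - w) * g ^ 2
      + r * k * g ^ 2) + (P ^ 2 + 3 * Q ^ 2) * (r ^ 2 * (g ^ 2 + ∑ i, y i ^ 2)) := by
    have e : M / lam * (2 * r * g * ∑ i, n i * y i) = 2 * M / lam * (r * g * (n 0 * y 0))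
        + 2 * M / lam * (r * g * (n 1 * y 1)) + 2 * M / lam * (r * g * (n 2 * y 2)) := by
      rw [Fin.sum_univ_three]; ring
    have hP : P * r * g ^ 2 = M * r * g ^ 2 + M * (L / lam) * r * g ^ 2 := by
      simp only [P]; ring
    have hy : 0 ≤ P ^ 2 * (r ^ 2 * (y 0 ^ 2 + y 1 ^ 2 + y 2 ^ 2)) := by positivity
    have hg : 0 ≤ 3 * Q ^ 2 * (r ^ 2 * g ^ 2) := by positivity
    rw [mul_add, mul_add, e, Fin.sum_univ_three]
    linarith [h2 0, h2 1, h2 2, h3 0, h3 1, h3 2]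
  have := mul_le_mul_of_nonneg_left key ha
  refine le_trans (le_of_eq ?_) (this.trans (le_of_eq ?_)) <;> ring

/-- Hardy's inequality with the weight `r^{λ+1} / (r + ε)²` in place of `r^{λ-1}`. The left-hand
side is then finite, so that it can be absorbed; the bound does not depend on `ε`. -/
theorem VacuumFrame.hardy_regularized (F : VacuumFrame M Ω r S) {lam : ℝ} (hlam : 0 < lam)
    (hg : HasXD Ω S g gX) (hgL : WL Ω r (lam + 1) g) (hgXL : ∀ a, WL Ω r (lam + 1) (gX a)) :
    ∃ C : ℝ, ∀ ε > 0, IntegrableOn (fun x => r x ^ (lam + 1) * ((r x + ε) ^ 2)⁻¹ * g x ^ 2) Ω ∧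
      ∫ x in Ω, r x ^ (lam + 1) * ((r x + ε) ^ 2)⁻¹ * g x ^ 2 ≤ C := by
  have hM := F.M_nonneg
  set K := 3 * (M * M)
  set L := 3 * (3 * (M * (6 * (M * M))) + K * (3 * M))
  set C₀ := (M * (1 + L / lam)) ^ 2 + 3 * (2 * K * M / lam) ^ 2
  have hC₀ : 0 ≤ C₀ := by positivity
  let Φ : Space → ℝ := fun x => r x ^ (lam + 1) * g x ^ 2 + ∑ a, r x ^ (lam + 1) * gX a x ^ 2
  have hΦ : IntegrableOn Φ Ω := hgL.2.add (integrable_finsetSum _ fun a _ => (hgXL a).2)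
  refine ⟨2 * (C₀ * ∫ x in Ω, Φ x), fun ε hε => ?_⟩
  have hrε : ∀ x ∈ Ω, 0 < r x + ε := fun x hx => add_pos (F.pos x hx) hε
  let ψ : Space → ℝ := fun x => ((r x + ε) ^ 2)⁻¹
  have hψs : ContDiffOn ℝ ∞ ψ Ω := ((F.smooth_r.add contDiffOn_const).pow 2).inv
    fun x hx => (pow_pos (hrε x hx) 2).ne'
  have hψd : ∀ x ∈ Ω, ∀ j, pd j ψ x = -2 * ((r x + ε) ^ 3)⁻¹ * pd j r x := fun x hx j => by
    have hd := diffAt_of_contDiffOn F.isOpen F.smooth_r hx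
    have h0 := (hrε x hx).ne'
    have h1 : HasDerivAt (fun t : ℝ => ((t + ε) ^ 2)⁻¹) (-2 * ((r x + ε) ^ 3)⁻¹) (r x) := by
      have := (((hasDerivAt_id (r x)).add_const ε).pow 2).inv (pow_ne_zero 2 h0)
      refine this.congr_deriv ?_
      simp only [id]
      field_simp
      simp only [Nat.cast_ofNat, Nat.add_one_sub_one, pow_one, Pi.pow_apply]
      ring
    rw [pd_comp (ψ := fun t : ℝ => ((t + ε) ^ 2)⁻¹) j h1.differentiableAt hd, h1.deriv]
  have hψ0 : ∀ x ∈ Ω, 0 ≤ ψ x := fun x hx => inv_nonneg.2 (sq_nonneg _)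
  have hψb : ∀ x ∈ Ω, ψ x ≤ (ε ^ 2)⁻¹ := fun x hx => by
    have := F.pos x hx
    exact inv_anti₀ (by positivity) (pow_le_pow_left₀ hε.le (by linarith) 2)
  have hψ'b : ∀ x ∈ Ω, ∀ j, |pd j ψ x| ≤ 2 * (ε ^ 3)⁻¹ * M := fun x hx j => by
    have := F.pos x hx
    have h3 := hrε x hx
    rw [hψd x hx, abs_mul, abs_mul, abs_of_pos (inv_pos.2 (pow_pos h3 3))]
    have : ((r x + ε) ^ 3)⁻¹ ≤ (ε ^ 3)⁻¹ :=
      inv_anti₀ (by positivity) (pow_le_pow_left₀ hε.le (by linarith) 3)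
    have h2 : |(-2 : ℝ)| = 2 := by norm_num
    rw [h2]
    exact mul_le_mul (mul_le_mul_of_nonneg_left this zero_le_two) (F.pd_r_le x hx j)
      (abs_nonneg _) (by positivity)
  -- integrate by parts the vector field `r ^ (lam + 2) * ψ * g ^ 2 * n`
  let φ : Fin 3 → Space → ℝ := fun a x => ψ x * conormal S r a x
  have hφs : ∀ a, ContDiffOn ℝ ∞ (φ a) Ω := fun a => hψs.mul (F.contDiffOn_conormal a)
  have hφd : ∀ a, ∀ x ∈ Ω, ∀ j, pd j (φ a) x
      = pd j ψ x * conormal S r a x + ψ x * pd j (conormal S r a) x := fun a x hx j =>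
    pd_mul j (diffAt_of_contDiffOn F.isOpen hψs hx)
      (diffAt_of_contDiffOn F.isOpen (F.contDiffOn_conormal a) hx)
  set B := (ε ^ 2)⁻¹ * K + 2 * (ε ^ 3)⁻¹ * M * K + (ε ^ 2)⁻¹ * (6 * (M * M))
  have hφB : ∀ a, ∀ x ∈ Ω, |φ a x| ≤ B := fun a x hx => by
    have h1 : |φ a x| ≤ (ε ^ 2)⁻¹ * K := by
      simp only [φ]
      rw [abs_mul, abs_of_nonneg (hψ0 x hx)]
      exact mul_le_mul (hψb x hx) (F.abs_conormal_le hx a) (abs_nonneg _) (by positivity)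
    have h2 : 0 ≤ 2 * (ε ^ 3)⁻¹ * M * K + (ε ^ 2)⁻¹ * (6 * (M * M)) := by positivity
    linarith
  have hφ'B : ∀ a, ∀ x ∈ Ω, ∀ j, |pd j (φ a) x| ≤ B := fun a x hx j => by
    rw [hφd a x hx j]
    refine (abs_add_le _ _).trans ?_
    rw [abs_mul, abs_mul, abs_of_nonneg (hψ0 x hx)]
    have h1 := mul_le_mul (hψ'b x hx j) (F.abs_conormal_le hx a) (abs_nonneg _)
      (show 0 ≤ 2 * (ε ^ 3)⁻¹ * M by positivity)
    have h2 := mul_le_mul (hψb x hx) (F.abs_pd_conormal_le hx a j) (abs_nonneg _)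
      (show 0 ≤ (ε ^ 2)⁻¹ by positivity)
    have h3 : 0 ≤ (ε ^ 2)⁻¹ * K := by positivity
    linarith
  have hgL' : WL Ω r (lam + 2 - 1) g := by convert hgL using 1; ring
  have hgXL' : ∀ a, WL Ω r (lam + 2 + 1) (gX a) := fun a => (hgXL a).mono F (by linarith)
  choose D hD hD0 hDe using fun a => HasXD.ibp F hg hg hgL' hgL' hgXL' hgXL'
    (F.contDiffOn_rpow_mul (lam + 2) (hφs a))
    (fun x hx => F.abs_rpow_mul_le (lam + 2) hx (hφB a x hx))
    (fun x hx j => F.abs_pd_rpow_mul_le (lam + 2) (hφs a) hx (hφB a x hx) (hφ'B a x hx j)) a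
  have hDs : IntegrableOn (fun x => ∑ a, D a x) Ω := integrable_finsetSum _ fun a _ => hD a
  have hDs0 : ∫ x in Ω, ∑ a, D a x = 0 := by
    rw [integral_finsetSum _ fun a _ => hD a]
    exact Finset.sum_eq_zero fun a _ => hD0 a
  have hint : IntegrableOn (fun x => r x ^ (lam + 1) * ((r x + ε) ^ 2)⁻¹ * g x ^ 2) Ω := by
    have := WL.integrable_mul (c := fun x => r x ^ (lam + 1) * ((r x + ε) ^ 2)⁻¹) (σ := lam + 1)
      (B := (ε ^ 2)⁻¹) F hgL hgL
      (F.aesm ((F.contDiffOn_rpow (lam + 1)).continuousOn.mul hψs.continuousOn))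
      (fun x hx => by
        have hr := Real.rpow_nonneg (F.pos x hx).le (lam + 1)
        rw [abs_of_nonneg (mul_nonneg hr (hψ0 x hx)), mul_comm]
        exact mul_le_mul_of_nonneg_right (hψb x hx) hr) (by ring)
    refine this.congr (Eventually.of_forall fun x => ?_)
    simp only []; ring
  refine ⟨hint, ?_⟩
  have hpt : ∀ x ∈ Ω, r x ^ (lam + 1) * ((r x + ε) ^ 2)⁻¹ * g x ^ 2
      ≤ 2 * (M / lam * (∑ a, D a x) + C₀ * Φ x) := fun x hx => by
    have hr := F.pos x hx
    have hrp := Real.rpow_nonneg hr.le (lam + 1)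
    have h3 := hrε x hx
    have hk : |∑ a, (frameD S a (fun j => pd j (conormal S r a)) x
        + conormal S r a x * frameDiv S a x)| ≤ L := by
      refine (Finset.abs_sum_le_sum_abs _ _).trans ((Finset.sum_le_sum
        (g := fun _ => 3 * (M * (6 * (M * M))) + K * (3 * M)) fun a _ => ?_).trans (le_of_eq ?_))
      · refine (abs_add_le _ _).trans (add_le_add
          (F.abs_frameD_le hx (F.abs_pd_conormal_le hx a) a) ?_)
        rw [abs_mul]
        exact mul_le_mul (F.abs_conormal_le hx a) (F.abs_frameDiv_le hx a) (abs_nonneg _)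
          (by positivity)
      · simp [L]; ring
    have hw : 2 * r x / (r x + ε) ≤ 2 := by
      rw [div_le_iff₀ h3]; linarith
    have key := hardy_pointwise (a := r x ^ (lam + 1) * ((r x + ε) ^ 2)⁻¹) (g := g x)
      (y := fun a => gX a x) hlam hr (by positivity) hM (F.one_le_conormal hx) hw
      (F.abs_conormal_le hx) hk
    have eD : ∑ a, D a x = 2 * (r x * (r x ^ (lam + 1) * ((r x + ε) ^ 2)⁻¹)) * g x
          * ∑ i, conormal S r i x * gX i x
        + r x ^ (lam + 1) * ((r x + ε) ^ 2)⁻¹ * (∑ i, conormal S r i x ^ 2)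
          * (lam + 2 - 2 * r x / (r x + ε)) * g x ^ 2
        + r x * (r x ^ (lam + 1) * ((r x + ε) ^ 2)⁻¹)
          * (∑ a, (frameD S a (fun j => pd j (conormal S r a)) x
            + conormal S r a x * frameDiv S a x)) * g x ^ 2 := by
      have e1 : r x ^ (lam + 2) = r x ^ (lam + 1) * r x := by
        rw [← Real.rpow_add_one hr.ne']; ring_nf
      have e2 : lam + 2 - 1 = lam + 1 := by ring
      have e3 : ∀ a, frameD S a (fun j => pd j fun y => r y ^ (lam + 2) * φ a y) x
          = r x ^ (lam + 1) * ((r x + ε) ^ 2)⁻¹ * (lam + 2 - 2 * r x / (r x + ε))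
              * conormal S r a x ^ 2
            + r x * (r x ^ (lam + 1) * ((r x + ε) ^ 2)⁻¹)
              * frameD S a (fun j => pd j (conormal S r a)) x := fun a => by
        have : ∀ j, pd j (fun y => r y ^ (lam + 2) * φ a y) x
            = (r x ^ (lam + 1) * ((r x + ε) ^ 2)⁻¹ * (lam + 2 - 2 * r x / (r x + ε))
              * conormal S r a x) * pd j r x + r x * (r x ^ (lam + 1) * ((r x + ε) ^ 2)⁻¹)
              * pd j (conormal S r a) x := fun j => by
          rw [F.pd_rpow_mul (lam + 2) (hφs a) hx j, hφd a x hx j, hψd x hx j, e1, e2]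
          simp only [φ, ψ]
          field_simp
          ring
        simp only [frameD, this, conormal, Fin.sum_univ_three]
        ring
      have e4 : ∀ a, D a x = 2 * (r x * (r x ^ (lam + 1) * ((r x + ε) ^ 2)⁻¹)) * g x
            * (conormal S r a x * gX a x)
          + r x ^ (lam + 1) * ((r x + ε) ^ 2)⁻¹ * (conormal S r a x ^ 2)
            * (lam + 2 - 2 * r x / (r x + ε)) * g x ^ 2
          + r x * (r x ^ (lam + 1) * ((r x + ε) ^ 2)⁻¹)
            * (frameD S a (fun j => pd j (conormal S r a)) x
            + conormal S r a x * frameDiv S a x) * g x ^ 2 := fun a => by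
        rw [hDe a x hx, e3, e1]
        simp only [φ, ψ]
        ring
      simp only [e4, Fin.sum_univ_three]
      ring
    rw [← eD] at key
    have hle : r x ^ 2 * (r x ^ (lam + 1) * ((r x + ε) ^ 2)⁻¹) ≤ r x ^ (lam + 1) := by
      have : r x ^ 2 * ((r x + ε) ^ 2)⁻¹ ≤ 1 := by
        rw [← div_eq_mul_inv, div_le_one (by positivity)]
        exact pow_le_pow_left₀ hr.le (by linarith) 2
      calc _ = r x ^ (lam + 1) * (r x ^ 2 * ((r x + ε) ^ 2)⁻¹) := by ring
        _ ≤ _ := mul_le_of_le_one_right hrp this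
    have hsum : 0 ≤ g x ^ 2 + ∑ a, gX a x ^ 2 :=
      add_nonneg (sq_nonneg _) (Finset.sum_nonneg fun a _ => sq_nonneg _)
    have eΦ : Φ x = r x ^ (lam + 1) * (g x ^ 2 + ∑ a, gX a x ^ 2) := by
      simp only [Φ, mul_add, Finset.mul_sum]
    have := mul_le_mul_of_nonneg_left (mul_le_mul_of_nonneg_right hle hsum) hC₀
    rw [eΦ]
    linarith
  have hbnd : IntegrableOn (fun x => 2 * (M / lam * (∑ a, D a x) + C₀ * Φ x)) Ω :=
    ((hDs.const_mul _).add (hΦ.const_mul _)).const_mul _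
  refine (setIntegral_mono_on hint hbnd F.isOpen.measurableSet hpt).trans (le_of_eq ?_)
  rw [integral_const_mul, integral_add (hDs.const_mul _) (hΦ.const_mul _), integral_const_mul,
    integral_const_mul, hDs0]
  ring

/-- Hardy's inequality, in qualitative form: two powers of the weight are gained from a gradient
bound. -/
theorem VacuumFrame.hardy (F : VacuumFrame M Ω r S) {lam : ℝ} (hlam : 0 < lam)
    (hg : HasXD Ω S g gX) (hgL : WL Ω r (lam + 1) g) (hgXL : ∀ a, WL Ω r (lam + 1) (gX a)) :
    WL Ω r (lam - 1) g := by
  obtain ⟨C, hC⟩ := F.hardy_regularized hlam hg hgL hgXL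
  refine ⟨hgL.1, (F.aesm (F.contDiffOn_rpow _).continuousOn).mul (hgL.1.pow 2), ?_⟩
  have hε : ∀ n : ℕ, (0 : ℝ) < 1 / (n + 1) := fun n => by positivity
  let G : ℕ → Space → ℝ := fun n x => r x ^ (lam + 1) * ((r x + 1 / (n + 1)) ^ 2)⁻¹ * g x ^ 2
  have hlim : ∀ᵐ x ∂(volume.restrict Ω),
      Tendsto (fun n => G n x) atTop (𝓝 (r x ^ (lam - 1) * g x ^ 2)) := by
    filter_upwards [ae_restrict_mem F.isOpen.measurableSet] with x hx
    have hr := F.pos x hx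
    have h1 : Tendsto (fun n : ℕ => r x + 1 / ((n : ℝ) + 1)) atTop (𝓝 (r x + 0)) :=
      tendsto_const_nhds.add tendsto_one_div_add_atTop_nhds_zero_nat
    have h2 := ((h1.pow 2).inv₀ (by positivity)).const_mul (r x ^ (lam + 1))
    have e : r x ^ (lam - 1) = r x ^ (lam + 1) * ((r x + 0) ^ 2)⁻¹ := by
      rw [add_zero, ← Real.rpow_natCast, ← Real.rpow_neg hr.le, ← Real.rpow_add hr]
      congr 1; push_cast; ring
    rw [e]
    exact h2.mul_const _
  have hbd : ∀ n, ∫⁻ x in Ω, ‖G n x‖ₑ ≤ ENNReal.ofReal C := fun n => by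
    have h := hC _ (hε n)
    have hnn : 0 ≤ᵐ[volume.restrict Ω] G n := by
      filter_upwards [ae_restrict_mem F.isOpen.measurableSet] with x hx
      exact mul_nonneg (mul_nonneg (Real.rpow_nonneg (F.pos x hx).le _)
        (inv_nonneg.2 (sq_nonneg _))) (sq_nonneg _)
    calc ∫⁻ x in Ω, ‖G n x‖ₑ = ∫⁻ x in Ω, ENNReal.ofReal (G n x) := by
          refine lintegral_congr_ae ?_
          filter_upwards [hnn] with x hx using Real.enorm_of_nonneg hx
      _ = ENNReal.ofReal (∫ x in Ω, G n x) := (ofReal_integral_eq_lintegral_ofReal h.1 hnn).symm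
      _ ≤ _ := ENNReal.ofReal_le_ofReal h.2
  calc ∫⁻ x in Ω, ‖r x ^ (lam - 1) * g x ^ 2‖ₑ
      = ∫⁻ x in Ω, liminf (fun n => ‖G n x‖ₑ) atTop := by
        refine lintegral_congr_ae ?_
        filter_upwards [hlim] with x hx using hx.enorm.liminf_eq.symm
    _ ≤ liminf (fun n => ∫⁻ x in Ω, ‖G n x‖ₑ) atTop :=
        lintegral_liminf_le' fun n => (hC _ (hε n)).1.1.aemeasurable.enorm
    _ ≤ ENNReal.ofReal C := liminf_le_of_le ⟨0, by simp⟩ fun b hb => by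
        obtain ⟨n, hn⟩ := hb.exists
        exact hn.trans (hbd n)
    _ < ⊤ := ENNReal.ofReal_lt_top

end Setting

end VacuumEuler

namespace VacuumEuler

open Filter Topology

/-! ### Pointwise algebra of the multipliers -/

section Algebra

theorem abs_sum_le_of_le {x : Fin 3 → ℝ} {b : ℝ} (h : ∀ i, |x i| ≤ b) : |∑ i, x i| ≤ 3 * b :=
  (Finset.abs_sum_le_sum_abs _ _).trans
    ((Finset.sum_le_sum fun i _ => h i).trans (le_of_eq (by simp)))

theorem abs_sum_sum_le_of_le {x : Fin 3 → Fin 3 → ℝ} {b : ℝ} (h : ∀ i j, |x i j| ≤ b) :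
    |∑ i, ∑ j, x i j| ≤ 9 * b :=
  (abs_sum_le_of_le fun i => abs_sum_le_of_le (h i)).trans (le_of_eq (by ring))

theorem abs_sum_sum_sum_le_of_le {x : Fin 3 → Fin 3 → Fin 3 → ℝ} {b : ℝ}
    (h : ∀ i j k, |x i j k| ≤ b) : |∑ i, ∑ j, ∑ k, x i j k| ≤ 27 * b :=
  (abs_sum_le_of_le fun i => abs_sum_sum_le_of_le (h i)).trans (le_of_eq (by ring))

/-- The `ℓ¹` norm of a vector. -/
def n1 (w : Fin 3 → ℝ) : ℝ := ∑ i, |w i|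

/-- The entrywise `ℓ¹` norm of a matrix. -/
def n2 (p : Fin 3 → Fin 3 → ℝ) : ℝ := ∑ i, ∑ j, |p i j|

/-- The entrywise `ℓ¹` norm of a tensor with three indices. -/
def n3 (q : Fin 3 → Fin 3 → Fin 3 → ℝ) : ℝ := ∑ i, ∑ j, ∑ k, |q i j k|

/-- The squared Euclidean norm of a vector. -/
def e1 (w : Fin 3 → ℝ) : ℝ := ∑ i, w i ^ 2

/-- The squared Euclidean norm of a matrix. -/
def e2 (p : Fin 3 → Fin 3 → ℝ) : ℝ := ∑ i, ∑ j, p i j ^ 2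

/-- The squared Euclidean norm of a tensor with three indices. -/
def e3 (q : Fin 3 → Fin 3 → Fin 3 → ℝ) : ℝ := ∑ i, ∑ j, ∑ k, q i j k ^ 2

variable {w : Fin 3 → ℝ} {p : Fin 3 → Fin 3 → ℝ} {q : Fin 3 → Fin 3 → Fin 3 → ℝ}

theorem n1_nonneg : 0 ≤ n1 w := Finset.sum_nonneg fun _ _ => abs_nonneg _
theorem n2_nonneg : 0 ≤ n2 p := Finset.sum_nonneg fun i _ => n1_nonneg (w := p i)
theorem n3_nonneg : 0 ≤ n3 q := Finset.sum_nonneg fun i _ => n2_nonneg (p := q i)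
theorem e1_nonneg : 0 ≤ e1 w := Finset.sum_nonneg fun _ _ => sq_nonneg _
theorem e2_nonneg : 0 ≤ e2 p := Finset.sum_nonneg fun i _ => e1_nonneg (w := p i)
theorem e3_nonneg : 0 ≤ e3 q := Finset.sum_nonneg fun i _ => e2_nonneg (p := q i)

theorem abs_le_n1 (i : Fin 3) : |w i| ≤ n1 w :=
  Finset.single_le_sum (f := fun i => |w i|) (fun _ _ => abs_nonneg _) (Finset.mem_univ i)

theorem abs_le_n2 (i j : Fin 3) : |p i j| ≤ n2 p :=
  (abs_le_n1 (w := p i) j).trans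
    (Finset.single_le_sum (f := fun i => n1 (p i)) (fun _ _ => n1_nonneg) (Finset.mem_univ i))

theorem abs_le_n3 (i j k : Fin 3) : |q i j k| ≤ n3 q :=
  (abs_le_n2 (p := q i) j k).trans
    (Finset.single_le_sum (f := fun i => n2 (q i)) (fun _ _ => n2_nonneg) (Finset.mem_univ i))

theorem n1_sq_le : n1 w ^ 2 ≤ 3 * e1 w := by
  have := sq_sum_le_card_mul_sum_sq (s := Finset.univ) (f := fun i => |w i|)
  simpa [n1, e1, sq_abs] using this

theorem n2_sq_le : n2 p ^ 2 ≤ 9 * e2 p := by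
  have h := sq_sum_le_card_mul_sum_sq (s := Finset.univ) (f := fun i => n1 (p i))
  have h2 : ∑ i, n1 (p i) ^ 2 ≤ ∑ i, 3 * e1 (p i) := Finset.sum_le_sum fun i _ => n1_sq_le
  rw [← Finset.mul_sum] at h2
  simp only [Finset.card_univ, Fintype.card_fin, Nat.cast_ofNat] at h
  change (∑ i, n1 (p i)) ^ 2 ≤ 9 * ∑ i, e1 (p i)
  linarith

theorem n3_sq_le : n3 q ^ 2 ≤ 27 * e3 q := by
  have h := sq_sum_le_card_mul_sum_sq (s := Finset.univ) (f := fun i => n2 (q i))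
  have h2 : ∑ i, n2 (q i) ^ 2 ≤ ∑ i, 9 * e2 (q i) := Finset.sum_le_sum fun i _ => n2_sq_le
  rw [← Finset.mul_sum] at h2
  simp only [Finset.card_univ, Fintype.card_fin, Nat.cast_ofNat] at h
  change (∑ i, n2 (q i)) ^ 2 ≤ 27 * ∑ i, e2 (q i)
  linarith

/-- The principal part of the operator contracted with the frame. -/
def principal (lam θ r : ℝ) (n : Fin 3 → ℝ) (p : Fin 3 → Fin 3 → ℝ)
    (q : Fin 3 → Fin 3 → Fin 3 → ℝ) (c : Fin 3) : ℝ :=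
  r * ∑ a, q a a c + lam * ∑ a, n a * p a c + θ * (n c * ∑ a, p a a - ∑ a, n a * p c a)

theorem mul_mul_le_add (x y : ℝ) {η K : ℝ} (hη : 0 < η) :
    K * (x * y) ≤ η * x ^ 2 + K ^ 2 / (4 * η) * y ^ 2 := by
  have : η * x ^ 2 + K ^ 2 / (4 * η) * y ^ 2 - K * (x * y) = η * (x - K / (2 * η) * y) ^ 2 := by
    field_simp; ring
  have h2 : 0 ≤ η * (x - K / (2 * η) * y) ^ 2 := by positivity
  linarith

set_option maxHeartbeats 1000000 in
/-- The zeroth order multiplier `w`. The quantities `D₁, D₂, D₃` are the integrands of the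
integrations by parts, `R = r^{λ-1}`. Coercivity uses `θ < λ`. -/
theorem energy_pointwise {lam θ M N K : ℝ} (hlam : 0 < lam) (hθ : 0 ≤ θ) (hθl : θ < lam)
    (hM : 0 ≤ M) (hN : 0 ≤ N) (hK : 0 ≤ K) : ∃ C₁ C₂ : ℝ, 0 ≤ C₂ ∧
    ∀ (R r : ℝ) (n w l : Fin 3 → ℝ) (p e D₁ D₂ D₃ : Fin 3 → Fin 3 → ℝ)
      (q : Fin 3 → Fin 3 → Fin 3 → ℝ), 0 ≤ R → 0 < r → r ≤ M →
      (∀ a c, |e a c| ≤ N * n1 w) → (∀ a b c, |q a b c - q b a c| ≤ N * n2 p) →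
      (∀ c, |l c - principal lam θ r n p q c| ≤ N * r * n2 p) →
      (∀ a c, |D₁ a c - (R * r * (q a a c * w c + p a c * (p a c + e a c))
        + lam * R * n a * p a c * w c)| ≤ K * (R * r * (n2 p * n1 w))) →
      (∀ a c, |D₂ a c - (R * r * (q c a a * w c + p a a * (p c c + e c c))
        + lam * R * n c * p a a * w c)| ≤ K * (R * r * (n2 p * n1 w))) →
      (∀ a c, |D₃ a c - (R * r * (q a c a * w c + p c a * (p a c + e a c))
        + lam * R * n a * p c a * w c)| ≤ K * (R * r * (n2 p * n1 w))) →
      R * r * e2 p ≤ C₁ * (∑ a, ∑ c, (D₁ a c + θ / lam * (D₂ a c - D₃ a c)))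
        + C₂ * (R * (e1 l + e1 w)) := by
  set t := θ / lam with ht
  have ht0 : 0 ≤ t := by positivity
  have ht1 : t < 1 := (div_lt_one hlam).2 hθl
  have hθt : θ = t * lam := by rw [ht]; field_simp
  set K' := 3 * N + 9 * ((1 + 2 * t) * K) + 9 * ((1 + 3 * t) * N) with hK'
  have hK'0 : 0 ≤ K' := by positivity
  set η := (1 - t) / 18 with hη
  have hη0 : 0 < η := by rw [hη]; linarith
  have hden : 0 < (1 - t) / 2 := by linarith
  set C₁ := 1 / 2 + 3 * M * (K' ^ 2 / (4 * η)) with hC₁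
  have hC₁0 : 0 ≤ C₁ := by positivity
  refine ⟨((1 - t) / 2)⁻¹, ((1 - t) / 2)⁻¹ * C₁, by positivity, ?_⟩
  intro R r n w l p e D₁ D₂ D₃ q hR hr hrM he hq hl h1 h2 h3
  set sp := n2 p
  set sw := n1 w
  have hsp : 0 ≤ sp := n2_nonneg
  have hsw : 0 ≤ sw := n1_nonneg
  set f : Fin 3 → ℝ := fun c => l c - principal lam θ r n p q c with hf
  set d₁ : Fin 3 → Fin 3 → ℝ := fun a c => D₁ a c - (R * r * (q a a c * w c
    + p a c * (p a c + e a c)) + lam * R * n a * p a c * w c) with hd₁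
  set d₂ : Fin 3 → Fin 3 → ℝ := fun a c => D₂ a c - (R * r * (q c a a * w c
    + p a a * (p c c + e c c)) + lam * R * n c * p a a * w c) with hd₂
  set d₃ : Fin 3 → Fin 3 → ℝ := fun a c => D₃ a c - (R * r * (q a c a * w c
    + p c a * (p a c + e a c)) + lam * R * n a * p c a * w c) with hd₃
  have key : R * r * (e2 p + t * ((∑ a, p a a) ^ 2 - ∑ a, ∑ c, p a c * p c a))
      = (∑ a, ∑ c, (D₁ a c + t * (D₂ a c - D₃ a c))) - R * ∑ c, w c * l c
        + R * ∑ c, w c * f c - ∑ a, ∑ c, (d₁ a c + t * (d₂ a c - d₃ a c))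
        - R * r * ∑ a, ∑ c, (p a c * e a c + t * (p a a * e c c - p c a * e a c)
          + t * ((q c a a - q a c a) * w c)) := by
    simp only [hf, hd₁, hd₂, hd₃, principal, hθt, e2, Fin.sum_univ_three]
    ring
  have b1 : |∑ c, w c * f c| ≤ 3 * (sw * (N * r * sp)) := abs_sum_le_of_le fun c => by
    rw [abs_mul]
    exact mul_le_mul (abs_le_n1 c) (hl c) (abs_nonneg _) hsw
  have b2 : |∑ a, ∑ c, (d₁ a c + t * (d₂ a c - d₃ a c))|
      ≤ 9 * ((1 + 2 * t) * (K * (R * r * (sp * sw)))) := abs_sum_sum_le_of_le fun a c => by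
    refine (abs_add_le _ _).trans ?_
    rw [abs_mul, abs_of_nonneg ht0]
    have := mul_le_mul_of_nonneg_left ((abs_sub (d₂ a c) (d₃ a c)).trans
      (add_le_add (h2 a c) (h3 a c))) ht0
    have := h1 a c
    linarith
  have b3 : |∑ a, ∑ c, (p a c * e a c + t * (p a a * e c c - p c a * e a c)
      + t * ((q c a a - q a c a) * w c))| ≤ 9 * ((1 + 3 * t) * (N * (sp * sw))) :=
    abs_sum_sum_le_of_le fun a c => by
      have hpe : ∀ i j k m, |p i j * e k m| ≤ N * (sp * sw) := fun i j k m => by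
        rw [abs_mul]
        refine (mul_le_mul (abs_le_n2 i j) (he k m) (abs_nonneg _) hsp).trans (le_of_eq (by ring))
      have hqw : |(q c a a - q a c a) * w c| ≤ N * (sp * sw) := by
        rw [abs_mul]
        refine (mul_le_mul (hq c a a) (abs_le_n1 c) (abs_nonneg _) (by positivity)).trans
          (le_of_eq (by ring))
      refine (abs_add_three _ _ _).trans ?_
      rw [abs_mul t, abs_mul t, abs_of_nonneg ht0]
      have h5 := mul_le_mul_of_nonneg_left ((abs_sub (p a a * e c c) (p c a * e a c)).trans
        (add_le_add (hpe a a c c) (hpe c a a c))) ht0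
      have h6 := mul_le_mul_of_nonneg_left hqw ht0
      have h7 := hpe a c a c
      linarith
  have hRr : 0 ≤ R * r := mul_nonneg hR hr.le
  have c1 : R * ∑ c, w c * f c ≤ R * (3 * (sw * (N * r * sp))) :=
    mul_le_mul_of_nonneg_left (abs_le.1 b1).2 hR
  have c3 := mul_le_mul_of_nonneg_left (neg_le_of_abs_le b3) hRr
  have c2 := neg_le_of_abs_le b2
  have hwl : -(R * ∑ c, w c * l c) ≤ 1 / 2 * (R * (e1 l + e1 w)) := by
    have : -(∑ c, w c * l c) ≤ 1 / 2 * (e1 l + e1 w) := by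
      simp only [e1, Fin.sum_univ_three]
      nlinarith [sq_nonneg (w 0 + l 0), sq_nonneg (w 1 + l 1), sq_nonneg (w 2 + l 2)]
    nlinarith
  have hcoer : (1 - t) * e2 p ≤ e2 p + t * ((∑ a, p a a) ^ 2 - ∑ a, ∑ c, p a c * p c a) := by
    have : ∑ a, ∑ c, p a c * p c a ≤ e2 p := by
      simp only [e2, Fin.sum_univ_three]
      nlinarith [sq_nonneg (p 0 1 - p 1 0), sq_nonneg (p 0 2 - p 2 0), sq_nonneg (p 1 2 - p 2 1)]
    nlinarith [sq_nonneg (∑ a, p a a)]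
  have hcoer' := mul_le_mul_of_nonneg_left hcoer hRr
  have hKerr : K' * (sp * sw) ≤ (1 - t) / 2 * e2 p + 3 * (K' ^ 2 / (4 * η)) * e1 w := by
    refine (mul_mul_le_add sp sw hη0).trans ?_
    have g1 := mul_le_mul_of_nonneg_left (n2_sq_le (p := p)) hη0.le
    have g2 := mul_le_mul_of_nonneg_left (n1_sq_le (w := w))
      (show 0 ≤ K' ^ 2 / (4 * η) by positivity)
    have g3 : η * (9 * e2 p) = (1 - t) / 2 * e2 p := by rw [hη]; ring
    linarith
  have hKerr' := mul_le_mul_of_nonneg_left hKerr hRr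
  have hrW : R * r * (3 * (K' ^ 2 / (4 * η)) * e1 w) ≤ 3 * M * (K' ^ 2 / (4 * η)) * (R * e1 w) := by
    have hz : 0 ≤ 3 * (K' ^ 2 / (4 * η)) * (R * e1 w) := by
      have := e1_nonneg (w := w); positivity
    nlinarith [mul_le_mul_of_nonneg_right hrM hz]
  have hW := mul_nonneg hR (e1_nonneg (w := w))
  have hL := mul_nonneg hR (e1_nonneg (w := l))
  have fin : (1 - t) / 2 * (R * r * e2 p) ≤ (∑ a, ∑ c, (D₁ a c + t * (D₂ a c - D₃ a c)))
      + C₁ * (R * (e1 l + e1 w)) := by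
    have e5 : R * r * (K' * (sp * sw)) = R * (3 * (sw * (N * r * sp)))
        + 9 * ((1 + 2 * t) * (K * (R * r * (sp * sw))))
        + R * r * (9 * ((1 + 3 * t) * (N * (sp * sw)))) := by rw [hK']; ring
    have e6 : C₁ * (R * (e1 l + e1 w)) = 1 / 2 * (R * (e1 l + e1 w))
        + 3 * M * (K' ^ 2 / (4 * η)) * (R * e1 w) + 3 * M * (K' ^ 2 / (4 * η)) * (R * e1 l) := by
      rw [hC₁]; ring
    have h9 : 0 ≤ 3 * M * (K' ^ 2 / (4 * η)) * (R * e1 l) := by positivity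
    rw [e6]
    linarith
  rw [mul_assoc (((1 - t) / 2)⁻¹), ← mul_add, ← div_eq_inv_mul, le_div_iff₀ hden]
  linarith

end Algebra
end VacuumEuler

namespace VacuumEuler

open Filter Topology

section Algebra

/-- The first order multiplier `X_n w + β (n div w + ∇(w · n))`. -/
def multiplier (β : ℝ) (n : Fin 3 → ℝ) (p : Fin 3 → Fin 3 → ℝ) (c : Fin 3) : ℝ :=
  ∑ a, n a * p a c + β * (n c * ∑ a, p a a + ∑ a, n a * p c a)

/-- The quadratic form in the gradient `p` produced by the first order multiplier. -/
def gradForm (lam θ β : ℝ) (n : Fin 3 → ℝ) (p : Fin 3 → Fin 3 → ℝ) : ℝ :=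
  lam / 2 * e1 n * e2 p
    + θ * ((∑ c, n c * ∑ a, n a * p a c) * ∑ a, p a a
      - ∑ c, (∑ a, n a * p a c) * ∑ a, n a * p c a)
    + β * (θ * e1 n * (∑ a, p a a) ^ 2 + (lam - θ) * ∑ c, (∑ a, n a * p c a) ^ 2)

/-- For `β` large the gradient of the normal component controls the indefinite terms. -/
theorem gradForm_lower {lam θ : ℝ} (hlam : 0 < lam) (hθ : 0 ≤ θ) (hθ1 : θ ≤ 1) (hθl : θ < lam)
    (n : Fin 3 → ℝ) (p : Fin 3 → Fin 3 → ℝ) :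
    lam / 4 * e1 n * e2 p ≤ gradForm lam θ (8 / (lam * (lam - θ))) n p := by
  have hd : 0 < lam - θ := by linarith
  set A : Fin 3 → ℝ := fun c => ∑ a, n a * p a c with hA
  set B : Fin 3 → ℝ := fun c => ∑ a, n a * p c a with hB
  set τ := ∑ a, p a a with hτ
  have hN := e1_nonneg (w := n)
  have hE := e2_nonneg (p := p)
  have hBB : 0 ≤ e1 B := e1_nonneg
  have hAle : e1 A ≤ e1 n * e2 p := by
    have : ∀ c, A c ^ 2 ≤ e1 n * ∑ a, p a c ^ 2 := fun c =>
      Finset.sum_mul_sq_le_sq_mul_sq _ _ _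
    refine (Finset.sum_le_sum fun c _ => this c).trans (le_of_eq ?_)
    rw [← Finset.mul_sum, Finset.sum_comm]; rfl
  have hnA : (∑ c, n c * A c) = ∑ c, n c * B c := by
    simp only [hA, hB, Fin.sum_univ_three]; ring
  have hnB : (∑ c, n c * A c) ^ 2 ≤ e1 n * e1 B := by
    rw [hnA]; exact Finset.sum_mul_sq_le_sq_mul_sq _ _ _
  have hτ2 : τ ^ 2 ≤ 3 * e2 p := by
    have h1 : τ ^ 2 ≤ 3 * ∑ a, p a a ^ 2 := by
      have := sq_sum_le_card_mul_sum_sq (s := Finset.univ) (f := fun a => p a a)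
      simpa using this
    have h2 : ∑ a, p a a ^ 2 ≤ e2 p := Finset.sum_le_sum fun a _ =>
      Finset.single_le_sum (f := fun b => p a b ^ 2) (fun _ _ => sq_nonneg _) (Finset.mem_univ a)
    linarith
  have hAB : (∑ c, A c * B c) ^ 2 ≤ e1 A * e1 B := Finset.sum_mul_sq_le_sq_mul_sq _ _ _
  set x := (∑ c, n c * A c) with hx
  set y := (∑ c, A c * B c) with hy
  have young : ∀ {z u v s : ℝ}, 0 < s → z ^ 2 ≤ u * v → 0 ≤ u → 0 ≤ v →
      |z| ≤ s * u + 1 / (4 * s) * v := fun {z u v s} hs h hu hv => by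
    refine abs_le_of_sq_le_sq (h.trans ?_) (by positivity)
    have : (s * u + 1 / (4 * s) * v) ^ 2 - u * v = (s * u - 1 / (4 * s) * v) ^ 2 := by
      field_simp; ring
    nlinarith [sq_nonneg (s * u - 1 / (4 * s) * v)]
  have h1 : |x * τ| ≤ lam / 24 * (e1 n * (3 * e2 p)) + 6 / lam * e1 B := by
    have h0 : (x * τ) ^ 2 ≤ (e1 n * (3 * e2 p)) * e1 B := by
      rw [mul_pow]
      refine (mul_le_mul hnB hτ2 (sq_nonneg _) (by positivity)).trans (le_of_eq (by ring))
    have := young (s := lam / 24) (by positivity) h0 (by positivity) hBB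
    have e : 1 / (4 * (lam / 24)) = 6 / lam := by field_simp; norm_num
    rwa [e] at this
  have h2 : |y| ≤ lam / 8 * (e1 n * e2 p) + 2 / lam * e1 B := by
    have h0 : y ^ 2 ≤ (e1 n * e2 p) * e1 B := hAB.trans (mul_le_mul_of_nonneg_right hAle hBB)
    have := young (s := lam / 8) (by positivity) h0 (by positivity) hBB
    have e : 1 / (4 * (lam / 8)) = 2 / lam := by field_simp; norm_num
    rwa [e] at this
  have h3 : -(lam / 4 * (e1 n * e2 p) + 8 / lam * e1 B) ≤ θ * (x * τ - y) := by
    have hb : |x * τ - y| ≤ lam / 4 * (e1 n * e2 p) + 8 / lam * e1 B := by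
      refine (abs_sub _ _).trans ((add_le_add h1 h2).trans (le_of_eq ?_))
      ring
    have h4 : |θ * (x * τ - y)| ≤ lam / 4 * (e1 n * e2 p) + 8 / lam * e1 B := by
      rw [abs_mul, abs_of_nonneg hθ]
      exact (mul_le_of_le_one_left (abs_nonneg _) hθ1).trans hb
    exact neg_le_of_abs_le h4
  have h5 : 8 / (lam * (lam - θ)) * ((lam - θ) * e1 B) = 8 / lam * e1 B := by
    field_simp
  have h6 : 0 ≤ 8 / (lam * (lam - θ)) * (θ * e1 n * τ ^ 2) := by positivity
  change _ ≤ lam / 2 * e1 n * e2 p + θ * (x * τ - y)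
    + 8 / (lam * (lam - θ)) * (θ * e1 n * τ ^ 2 + (lam - θ) * e1 B)
  rw [mul_add, h5]
  linarith

/-- The sum over `a, b, c` of these terms is what the integrations by parts with the first order
multiplier produce; `R = r^{λ-1}`. -/
def gradFlux (lam β R r : ℝ) (n : Fin 3 → ℝ) (p : Fin 3 → Fin 3 → ℝ)
    (q : Fin 3 → Fin 3 → Fin 3 → ℝ) (a b c : Fin 3) : ℝ :=
  (R * r * n b * (q a a c * p b c + p a c * q a b c) + lam * R * n a * n b * p a c * p b c)
  - (R * r * n b * (q b a c * p a c + p a c * q b a c) + lam * R * n b * n b * p a c * p a c) / 2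
  + β * ((R * r * n c * (q a a c * p b b + p a c * q a b b) + lam * R * n a * n c * p a c * p b b)
    + (R * r * n b * (q a a c * p c b + p a c * q a c b) + lam * R * n a * n b * p a c * p c b)
    - (R * r * n b * (q c a c * p a b + p a c * q c a b) + lam * R * n c * n b * p a c * p a b))

/-- `gradForm` is the multiplier times the operator, up to the terms integrated by parts and
commutators. -/
theorem gradForm_eq (lam θ β R r : ℝ) (n : Fin 3 → ℝ) (p : Fin 3 → Fin 3 → ℝ)
    (q : Fin 3 → Fin 3 → Fin 3 → ℝ) :
    R * gradForm lam θ β n p = R * (∑ c, multiplier β n p c * principal lam θ r n p q c)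
      - (∑ a, ∑ b, ∑ c, gradFlux lam β R r n p q a b c)
      + R * r * ∑ a, ∑ b, ∑ c, (n b * p a c * (q a b c - q b a c)
        + β * (n c * p a c * (q a b b - q b a b) + n b * p a c * (q a c b - q c a b))) := by
  simp only [gradForm, multiplier, principal, gradFlux, e1, e2, Fin.sum_univ_three]
  ring

/-- The pointwise form of the weighted gradient bound. `D` stands for the integrands of the
integrations by parts, which agree with `gradFlux` up to lower order; the term `R r |p|²` on the
right, with one more power of `r`, also absorbs the region where `n` degenerates. `R = r^{λ-1}`.
-/
theorem gradient_pointwise {lam θ M N K K₀ : ℝ} (hlam : 0 < lam) (hθ : 0 ≤ θ) (hθ1 : θ ≤ 1)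
    (hθl : θ < lam) (hM : 0 ≤ M) (hN : 0 ≤ N) (hK : 0 ≤ K) (hK₀ : 0 ≤ K₀) :
    ∃ C₁ C₂ : ℝ, 0 ≤ C₂ ∧
    ∀ (R r : ℝ) (n l : Fin 3 → ℝ) (p : Fin 3 → Fin 3 → ℝ)
      (q D : Fin 3 → Fin 3 → Fin 3 → ℝ), 0 ≤ R → 0 < r → 1 ≤ M * (e1 n + r) →
      (∀ a, |n a| ≤ K₀) → (∀ a b c, |q a b c - q b a c| ≤ N * n2 p) →
      (∀ c, |l c - principal lam θ r n p q c| ≤ N * r * n2 p) →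
      (∀ a b c, |D a b c - gradFlux lam (8 / (lam * (lam - θ))) R r n p q a b c|
        ≤ K * (R * r * (n2 p * n2 p))) →
      R * e2 p ≤ C₁ * (∑ a, ∑ b, ∑ c, D a b c) + C₂ * (R * e1 l) + C₂ * (R * r * e2 p) := by
  have hd : 0 < lam - θ := by linarith
  set β := 8 / (lam * (lam - θ)) with hβ
  have hβ0 : 0 ≤ β := by positivity
  set Km := 3 * K₀ * (1 + 2 * β) with hKm
  have hKm0 : 0 ≤ Km := by positivity
  set P := 4 * M / lam with hP
  have hP0 : 0 ≤ P := by positivity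
  set C₃ := 3 * ((P * (3 * Km)) ^ 2 / (4 * (1 / 18))) with hC₃
  set C₄ := 9 * (P * (3 * Km * N + 27 * K + 27 * (K₀ * N * (1 + 2 * β)))) + M with hC₄
  have hC₃0 : 0 ≤ C₃ := by positivity
  have hC₄0 : 0 ≤ C₄ := by positivity
  refine ⟨-(2 * P), 2 * (C₃ + C₄), by positivity, ?_⟩
  intro R r n l p q D hR hr hn hnK hq hl hD
  have hQ := gradForm_lower hlam hθ hθ1 hθl n p
  rw [← hβ] at hQ
  have hE := e2_nonneg (p := p)
  have hsp := n2_nonneg (p := p)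
  have hL := e1_nonneg (w := l)
  have hRr : 0 ≤ R * r := mul_nonneg hR hr.le
  have hm : ∀ c, |multiplier β n p c| ≤ Km * n2 p := fun c => by
    have h1 : ∀ (i : Fin 3) (j k : Fin 3), |n i * p j k| ≤ K₀ * n2 p := fun i j k => by
      rw [abs_mul]; exact mul_le_mul (hnK i) (abs_le_n2 j k) (abs_nonneg _) hK₀
    have h2 : |∑ a, n a * p a c| ≤ 3 * (K₀ * n2 p) := abs_sum_le_of_le fun a => h1 a a c
    have h3 : |∑ a, n a * p c a| ≤ 3 * (K₀ * n2 p) := abs_sum_le_of_le fun a => h1 a c a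
    have h4 : |n c * ∑ a, p a a| ≤ 3 * (K₀ * n2 p) := by
      rw [Finset.mul_sum]; exact abs_sum_le_of_le fun a => h1 c a a
    have h5 := mul_le_mul_of_nonneg_left ((abs_add_le _ _).trans (add_le_add h4 h3)) hβ0
    rw [← abs_of_nonneg hβ0, ← abs_mul, abs_of_nonneg hβ0] at h5
    refine (abs_add_le _ _).trans ((add_le_add h2 h5).trans (le_of_eq ?_))
    rw [hKm]; ring
  have b1 : |∑ c, multiplier β n p c * l c| ≤ 3 * (Km * n2 p * n1 l) :=
    abs_sum_le_of_le fun c => by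
      rw [abs_mul]
      exact mul_le_mul (hm c) (abs_le_n1 c) (abs_nonneg _) (by positivity)
  have b2 : |∑ c, multiplier β n p c * (principal lam θ r n p q c - l c)|
      ≤ 3 * (Km * n2 p * (N * r * n2 p)) :=
    abs_sum_le_of_le fun c => by
      rw [abs_mul, abs_sub_comm]
      exact mul_le_mul (hm c) (hl c) (abs_nonneg _) (by positivity)
  have b3 : |∑ a, ∑ b, ∑ c, (D a b c - gradFlux lam β R r n p q a b c)|
      ≤ 27 * (K * (R * r * (n2 p * n2 p))) := abs_sum_sum_sum_le_of_le hD
  have b4 : |∑ a, ∑ b, ∑ c, (n b * p a c * (q a b c - q b a c)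
      + β * (n c * p a c * (q a b b - q b a b) + n b * p a c * (q a c b - q c a b)))|
      ≤ 27 * (K₀ * N * (1 + 2 * β) * (n2 p * n2 p)) := abs_sum_sum_sum_le_of_le fun a b c => by
    have h1 : ∀ i j k : Fin 3, ∀ t : ℝ, |t| ≤ N * n2 p →
        |n i * p j k * t| ≤ K₀ * n2 p * (N * n2 p) := fun i j k t ht => by
      rw [abs_mul, abs_mul]
      exact mul_le_mul (mul_le_mul (hnK i) (abs_le_n2 j k) (abs_nonneg _) hK₀) ht (abs_nonneg _)
        (by positivity)
    have h5 := mul_le_mul_of_nonneg_left ((abs_add_le _ _).trans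
      (add_le_add (h1 c a c _ (hq a b b)) (h1 b a c _ (hq a c b)))) hβ0
    rw [← abs_of_nonneg hβ0, ← abs_mul, abs_of_nonneg hβ0] at h5
    refine (abs_add_le _ _).trans ((add_le_add (h1 b a c _ (hq a b c)) h5).trans (le_of_eq ?_))
    ring
  have key := gradForm_eq lam θ β R r n p q
  have es : ∑ c, multiplier β n p c * principal lam θ r n p q c
      = ∑ c, multiplier β n p c * l c
        + ∑ c, multiplier β n p c * (principal lam θ r n p q c - l c) := by
    rw [← Finset.sum_add_distrib]; exact Finset.sum_congr rfl fun c _ => by ring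
  have eD : ∑ a, ∑ b, ∑ c, gradFlux lam β R r n p q a b c = (∑ a, ∑ b, ∑ c, D a b c)
      - ∑ a, ∑ b, ∑ c, (D a b c - gradFlux lam β R r n p q a b c) := by
    simp only [Finset.sum_sub_distrib]; ring
  rw [es, eD] at key
  have k1 := mul_le_mul_of_nonneg_left (abs_le.1 b1).2 hR
  have k2 := mul_le_mul_of_nonneg_left (abs_le.1 b2).2 hR
  have k3 := (abs_le.1 b3).2
  have k4 := mul_le_mul_of_nonneg_left (abs_le.1 b4).2 hRr
  -- all error terms carry the factor `R * r`
  have hform : R * gradForm lam θ β n p ≤ -(∑ a, ∑ b, ∑ c, D a b c)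
      + R * (3 * Km * (n2 p * n1 l))
      + (3 * Km * N + 27 * K + 27 * (K₀ * N * (1 + 2 * β))) * (R * r * n2 p ^ 2) := by
    rw [key]
    clear_value Km β
    clear hQ hD hq hl b1 b2 b3 b4 hm
    linarith
  have hRA : R * e2 p ≤ P * (R * gradForm lam θ β n p) + M * (R * r * e2 p) := by
    have h1 : R * e2 p ≤ M * (e1 n + r) * (R * e2 p) :=
      le_mul_of_one_le_left (mul_nonneg hR hE) hn
    have h2 := mul_le_mul_of_nonneg_left hQ (mul_nonneg hP0 hR)
    have h3 : P * R * (lam / 4 * e1 n * e2 p) = M * e1 n * (R * e2 p) := by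
      rw [hP]; field_simp
    linarith
  have hab : P * (3 * Km) * (n2 p * n1 l) ≤ 1 / 2 * e2 p + C₃ * e1 l := by
    refine (mul_mul_le_add (n2 p) (n1 l) (show (0 : ℝ) < 1 / 18 by norm_num)).trans ?_
    have g1 := n2_sq_le (p := p)
    have g2 := mul_le_mul_of_nonneg_left (n1_sq_le (w := l))
      (show 0 ≤ (P * (3 * Km)) ^ 2 / (4 * (1 / 18)) by positivity)
    rw [hC₃]
    linarith
  have hab' := mul_le_mul_of_nonneg_left hab hR
  have hform' := mul_le_mul_of_nonneg_left hform hP0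
  have hlast : P * ((3 * Km * N + 27 * K + 27 * (K₀ * N * (1 + 2 * β))) * (R * r * n2 p ^ 2))
      ≤ (C₄ - M) * (R * r * e2 p) := by
    have g1 := mul_le_mul_of_nonneg_left (n2_sq_le (p := p)) hRr
    have g2 := mul_le_mul_of_nonneg_left g1
      (show 0 ≤ P * (3 * Km * N + 27 * K + 27 * (K₀ * N * (1 + 2 * β))) by positivity)
    rw [hC₄]
    linarith
  have n1' : 0 ≤ C₄ * (R * e1 l) := by positivity
  have n2' : 0 ≤ C₃ * (R * r * e2 p) := by positivity
  clear_value Km β P C₃ C₄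
  linarith

/-- The pointwise form of the elliptic bound for second derivatives, from the null form identity;
`R = r^{λ-1}`. -/
theorem hessian_pointwise {lam θ M N K K₀ : ℝ} (hM : 0 ≤ M) (hN : 0 ≤ N) (hK : 0 ≤ K)
    (hK₀ : 0 ≤ K₀) : ∃ C₁ C₂ : ℝ, 0 ≤ C₂ ∧
    ∀ (R r : ℝ) (n l : Fin 3 → ℝ) (p : Fin 3 → Fin 3 → ℝ)
      (q D : Fin 3 → Fin 3 → Fin 3 → ℝ), 0 ≤ R → 0 < r → r ≤ M →
      (∀ a, |n a| ≤ K₀) → (∀ a b c, |q a b c - q b a c| ≤ N * n2 p) →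
      (∀ c, |l c - principal lam θ r n p q c| ≤ N * r * n2 p) →
      (∀ a b c, |D a b c - R * r ^ 2 * (q a a c * q b b c - q b a c * q a b c)|
        ≤ K * (R * r * (n2 p * n3 q))) →
      R * r ^ 2 * e3 q ≤ C₁ * (∑ a, ∑ b, ∑ c, D a b c) + C₂ * (R * (e1 l + e2 p)) := by
  set K₁ := N * M + |lam| * (3 * K₀) + |θ| * (6 * K₀) with hK₁
  have hK₁0 : 0 ≤ K₁ := by positivity
  set K₂ := 27 * K + 27 * N * M with hK₂
  have hK₂0 : 0 ≤ K₂ := by positivity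
  set C := 2 + 54 * K₁ ^ 2 + 9 * (K₂ ^ 2 / (4 * (1 / 54))) with hC
  have hC0 : 0 ≤ C := by positivity
  refine ⟨-2, 2 * C, by positivity, ?_⟩
  intro R r n l p q D hR hr hrM hnK hq hl hD
  have hsp := n2_nonneg (p := p)
  have hsq := n3_nonneg (q := q)
  have hE := e2_nonneg (p := p)
  have hL := e1_nonneg (w := l)
  have hRr : 0 ≤ R * r := mul_nonneg hR hr.le
  have hRr2 : 0 ≤ R * r ^ 2 := by positivity
  have hlap : ∀ c, |r * ∑ a, q a a c| ≤ |l c| + K₁ * n2 p := fun c => by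
    have h1 : ∀ (i : Fin 3) (j k : Fin 3), |n i * p j k| ≤ K₀ * n2 p := fun i j k => by
      rw [abs_mul]; exact mul_le_mul (hnK i) (abs_le_n2 j k) (abs_nonneg _) hK₀
    have h2 : |∑ a, n a * p a c| ≤ 3 * (K₀ * n2 p) := abs_sum_le_of_le fun a => h1 a a c
    have h3 : |∑ a, n a * p c a| ≤ 3 * (K₀ * n2 p) := abs_sum_le_of_le fun a => h1 a c a
    have h4 : |n c * ∑ a, p a a| ≤ 3 * (K₀ * n2 p) := by
      rw [Finset.mul_sum]; exact abs_sum_le_of_le fun a => h1 c a a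
    have e : r * ∑ a, q a a c = l c - (l c - principal lam θ r n p q c)
        - lam * ∑ a, n a * p a c - θ * (n c * ∑ a, p a a - ∑ a, n a * p c a) := by
      simp only [principal]; ring
    have h5 : |lam * ∑ a, n a * p a c| ≤ |lam| * (3 * (K₀ * n2 p)) := by
      rw [abs_mul]; exact mul_le_mul_of_nonneg_left h2 (abs_nonneg _)
    have h6 : |θ * (n c * ∑ a, p a a - ∑ a, n a * p c a)| ≤ |θ| * (6 * (K₀ * n2 p)) := by
      rw [abs_mul]
      refine mul_le_mul_of_nonneg_left ((abs_sub _ _).trans ?_) (abs_nonneg _)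
      linarith
    have h7 : N * r * n2 p ≤ N * M * n2 p := by gcongr
    rw [e]
    refine (abs_sub _ _).trans (le_trans (add_le_add ((abs_sub _ _).trans
      (add_le_add ((abs_sub _ _).trans (add_le_add le_rfl ((hl c).trans h7))) h5)) h6) ?_)
    rw [hK₁]
    linarith
  have hlap2 : r ^ 2 * ∑ c, (∑ a, q a a c) ^ 2 ≤ 2 * e1 l + 54 * K₁ ^ 2 * e2 p := by
    have h1 : ∀ c, (r * ∑ a, q a a c) ^ 2 ≤ 2 * l c ^ 2 + 18 * K₁ ^ 2 * e2 p := fun c => by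
      have g1 : (r * ∑ a, q a a c) ^ 2 ≤ (|l c| + K₁ * n2 p) ^ 2 := by
        rw [← sq_abs (r * ∑ a, q a a c)]
        exact pow_le_pow_left₀ (abs_nonneg _) (hlap c) 2
      have g2 : (|l c| + K₁ * n2 p) ^ 2 ≤ 2 * l c ^ 2 + 2 * (K₁ ^ 2 * n2 p ^ 2) := by
        rw [← sq_abs (l c)]
        nlinarith [sq_nonneg (|l c| - K₁ * n2 p)]
      have g3 := mul_le_mul_of_nonneg_left (n2_sq_le (p := p)) (sq_nonneg K₁)
      linarith
    have h2 := Finset.sum_le_sum fun (c : Fin 3) (_ : c ∈ Finset.univ) => h1 c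
    simp only [mul_pow, ← Finset.mul_sum, Finset.sum_add_distrib, Finset.sum_const,
      Finset.card_univ, Fintype.card_fin, nsmul_eq_mul] at h2
    push_cast at h2
    change _ ≤ 2 * e1 l + _ at h2
    linarith
  have b1 : |∑ a, ∑ b, ∑ c, (D a b c - R * r ^ 2 * (q a a c * q b b c - q b a c * q a b c))|
      ≤ 27 * (K * (R * r * (n2 p * n3 q))) := abs_sum_sum_sum_le_of_le hD
  have b2 : |∑ a, ∑ b, ∑ c, (q a b c - q b a c) * q a b c| ≤ 27 * (N * n2 p * n3 q) :=
    abs_sum_sum_sum_le_of_le fun a b c => by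
      rw [abs_mul]
      exact mul_le_mul (hq a b c) (abs_le_n3 a b c) (abs_nonneg _) (by positivity)
  have key : e3 q = ∑ c, (∑ a, q a a c) ^ 2
      - (∑ a, ∑ b, ∑ c, (q a a c * q b b c - q b a c * q a b c))
      + ∑ a, ∑ b, ∑ c, (q a b c - q b a c) * q a b c := by
    simp only [e3, Fin.sum_univ_three]; ring
  have eD : R * r ^ 2 * ∑ a, ∑ b, ∑ c, (q a a c * q b b c - q b a c * q a b c)
      = (∑ a, ∑ b, ∑ c, D a b c) - ∑ a, ∑ b, ∑ c, (D a b c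
        - R * r ^ 2 * (q a a c * q b b c - q b a c * q a b c)) := by
    simp only [Finset.sum_sub_distrib, ← Finset.mul_sum]; ring
  have k1 := (abs_le.1 b1).2
  have k2 := mul_le_mul_of_nonneg_left (abs_le.1 b2).2 hRr2
  have k3 := mul_le_mul_of_nonneg_left hlap2 hR
  have k4 : R * r ^ 2 * (27 * (N * n2 p * n3 q)) ≤ R * r * (27 * N * M * (n2 p * n3 q)) := by
    have : 0 ≤ R * r * (27 * (N * n2 p * n3 q)) := by positivity
    nlinarith
  have k5 : R * r * (K₂ * (n2 p * n3 q)) ≤ 1 / 2 * (R * r ^ 2 * e3 q)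
      + 9 * (K₂ ^ 2 / (4 * (1 / 54))) * (R * e2 p) := by
    have h0 := mul_mul_le_add (K := K₂) (r * n3 q) (n2 p) (show (0 : ℝ) < 1 / 54 by norm_num)
    have g1 := mul_le_mul_of_nonneg_left (n3_sq_le (q := q)) (sq_nonneg r)
    have g2 := mul_le_mul_of_nonneg_left (n2_sq_le (p := p))
      (show 0 ≤ K₂ ^ 2 / (4 * (1 / 54)) by positivity)
    have h1 : K₂ * (r * n3 q * n2 p) ≤ 1 / 2 * (r ^ 2 * e3 q)
        + 9 * (K₂ ^ 2 / (4 * (1 / 54))) * e2 p := by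
      rw [mul_pow] at h0; linarith
    have := mul_le_mul_of_nonneg_left h1 hR
    linarith
  have e5 : R * r * (K₂ * (n2 p * n3 q)) = 27 * (K * (R * r * (n2 p * n3 q)))
      + R * r * (27 * N * M * (n2 p * n3 q)) := by rw [hK₂]; ring
  have hmain : R * r ^ 2 * e3 q = R * (r ^ 2 * ∑ c, (∑ a, q a a c) ^ 2)
      - R * r ^ 2 * (∑ a, ∑ b, ∑ c, (q a a c * q b b c - q b a c * q a b c))
      + R * r ^ 2 * ∑ a, ∑ b, ∑ c, (q a b c - q b a c) * q a b c := by
    rw [key]; ring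
  have m1 : 0 ≤ R * e1 l := mul_nonneg hR hL
  have m2 : 0 ≤ R * e2 p := mul_nonneg hR hE
  have m3 : 0 ≤ K₁ ^ 2 * (R * e1 l) := by positivity
  have m4 : 0 ≤ K₂ ^ 2 / (4 * (1 / 54)) * (R * e1 l) := by positivity
  rw [hC]
  clear_value K₁ K₂
  linarith

end Algebra
end VacuumEuler

namespace VacuumEuler

open Filter Topology

/-! ### The a priori estimate in frame components -/

/-- `D` is integrable on `Ω` with integral zero; such functions arise from integrations by parts. -/
def ZeroMean (Ω : Set Space) (D : Space → ℝ) : Prop :=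
  IntegrableOn D Ω ∧ ∫ x in Ω, D x = 0

section ZeroMean

variable {Ω : Set Space} {D E : Space → ℝ}

theorem ZeroMean.add (hD : ZeroMean Ω D) (hE : ZeroMean Ω E) : ZeroMean Ω (fun x => D x + E x) :=
  ⟨hD.1.add hE.1, by rw [integral_add hD.1 hE.1, hD.2, hE.2, add_zero]⟩

theorem ZeroMean.const_mul (hD : ZeroMean Ω D) (k : ℝ) : ZeroMean Ω (fun x => k * D x) :=
  ⟨hD.1.const_mul k, by rw [integral_const_mul, hD.2, mul_zero]⟩

theorem ZeroMean.sub (hD : ZeroMean Ω D) (hE : ZeroMean Ω E) : ZeroMean Ω (fun x => D x - E x) :=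
  ⟨hD.1.sub hE.1, by rw [integral_sub hD.1 hE.1, hD.2, hE.2, sub_zero]⟩

theorem ZeroMean.sum {D : Fin 3 → Space → ℝ} (hD : ∀ i, ZeroMean Ω (D i)) :
    ZeroMean Ω (fun x => ∑ i, D i x) :=
  ⟨integrable_finsetSum _ fun i _ => (hD i).1, by
    rw [integral_finsetSum _ fun i _ => (hD i).1]
    exact Finset.sum_eq_zero fun i _ => (hD i).2⟩

end ZeroMean

/-- Frame components of a vector field `w` of class `H²` together with the operator `l` applied to
it: `p = Xw` and `q = Xp` up to lower order terms, and `l` is the degenerate operator with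
principal part `principal lam θ`. -/
structure FrameSystem (N lam θ : ℝ) (Ω : Set Space) (r : Space → ℝ)
    (S : Fin 3 → Fin 3 → Space → ℝ) (w l : Fin 3 → Space → ℝ) (p e : Fin 3 → Fin 3 → Space → ℝ)
    (q : Fin 3 → Fin 3 → Fin 3 → Space → ℝ) : Prop where
  hasXD_w : ∀ c, HasXD Ω S (w c) (fun a x => p a c x + e a c x)
  hasXD_p : ∀ b c, HasXD Ω S (p b c) (fun a => q a b c)
  e_le : ∀ x ∈ Ω, ∀ a c, |e a c x| ≤ N * n1 (fun c => w c x)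
  commutator_le : ∀ x ∈ Ω, ∀ a b c, |q a b c x - q b a c x| ≤ N * n2 (fun a b => p a b x)
  operator_le : ∀ x ∈ Ω, ∀ c, |l c x - principal lam θ (r x) (fun a => conormal S r a x)
    (fun a b => p a b x) (fun a b c => q a b c x) c| ≤ N * r x * n2 (fun a b => p a b x)
  wl_w : ∀ c, WL Ω r (lam - 1) (w c)
  wl_l : ∀ c, WL Ω r (lam - 1) (l c)
  wl_e : ∀ a c, WL Ω r (lam - 1) (e a c)
  wl_p : ∀ a c, WL Ω r (lam - 1) (p a c)
  wl_q : ∀ a b c, WL Ω r (lam + 1) (q a b c)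

section Setting

variable {M N lam θ : ℝ} {Ω : Set Space} {r : Space → ℝ} {S : Fin 3 → Fin 3 → Space → ℝ}
  {w l : Fin 3 → Space → ℝ} {p e : Fin 3 → Fin 3 → Space → ℝ}
  {q : Fin 3 → Fin 3 → Fin 3 → Space → ℝ}

/-- `∫ r^λ |p|²` is controlled by the zeroth order multiplier; `D` collects the integrations by
parts. -/
theorem energy_bound (hlam : 0 < lam) (hθ : 0 ≤ θ) (hθl : θ < lam) (hM : 0 ≤ M) (hN : 0 ≤ N) :
    ∃ C : ℝ, 0 ≤ C ∧ ∀ (Ω : Set Space) (r : Space → ℝ) (S : Fin 3 → Fin 3 → Space → ℝ)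
      (w l : Fin 3 → Space → ℝ) (p e : Fin 3 → Fin 3 → Space → ℝ)
      (q : Fin 3 → Fin 3 → Fin 3 → Space → ℝ), VacuumFrame M Ω r S →
      FrameSystem N lam θ Ω r S w l p e q → ∃ D, ZeroMean Ω D ∧ ∀ x ∈ Ω,
        r x ^ (lam - 1) * r x * e2 (fun a b => p a b x) ≤ D x
          + C * (r x ^ (lam - 1) * (e1 (fun c => l c x) + e1 (fun c => w c x))) := by
  obtain ⟨C₁, C₂, hC₂, H⟩ := energy_pointwise (K := 6 * M) hlam hθ hθl hM hN (by positivity)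
  refine ⟨C₂, hC₂, fun Ω r S w l p e q F h => ?_⟩
  have hq' : ∀ a b c, WL Ω r (lam + 1) (q a b c) := h.wl_q
  have hpe : ∀ a c, WL Ω r (lam + 1) (fun x => p a c x + e a c x) := fun a c =>
    ((h.wl_p a c).add F (h.wl_e a c)).mono F (by linarith)
  have h1 : ∀ x ∈ Ω, ∀ j, |pd j (fun _ : Space => (1 : ℝ)) x| ≤ 1 := fun x _ j => by simp [pd]
  have ibp := fun b c d a => HasXD.weighted_ibp (B := 1) (φ := fun _ => 1) F (h.hasXD_p b c)
    (h.hasXD_w d) (h.wl_p b c) (h.wl_w d) (fun a => hq' a b c) (fun a => hpe a d)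
    contDiffOn_const (fun x _ => by simp) h1 a
  choose D hD hD0 hDe using ibp
  have Z : ∀ b c d a, ZeroMean Ω (D b c d a) := fun b c d a => ⟨hD b c d a, hD0 b c d a⟩
  refine ⟨fun x => C₁ * ∑ a, ∑ c, (D a c c a x + θ / lam * (D a a c c x - D c a c a x)),
    (ZeroMean.sum fun a => ZeroMean.sum fun c =>
      (Z a c c a).add (((Z a a c c).sub (Z c a c a)).const_mul _)).const_mul _, fun x hx => ?_⟩
  have hr := F.pos x hx
  have hR := Real.rpow_nonneg hr.le (lam - 1)
  have herr : ∀ b c d a, |D b c d a x - (r x ^ (lam - 1) * r x * (q a b c x * w d x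
      + p b c x * (p a d x + e a d x)) + lam * r x ^ (lam - 1) * conormal S r a x * p b c x * w d x)|
      ≤ 6 * M * (r x ^ (lam - 1) * r x * (n2 (fun a b => p a b x) * n1 (fun c => w c x))) :=
    fun b c d a => by
      have := hDe b c d a x hx
      rw [F.rpow_succ lam hx] at this
      simp only [mul_one] at this
      refine this.trans ?_
      have h1 := abs_le_n2 (p := fun a b => p a b x) b c
      have h2 := abs_le_n1 (w := fun c => w c x) d
      have := F.M_nonneg
      gcongr
      exact n2_nonneg
  exact H (r x ^ (lam - 1)) (r x) (fun a => conormal S r a x) (fun c => w c x) (fun c => l c x)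
    (fun a b => p a b x) (fun a b => e a b x) (fun a c => D a c c a x) (fun a c => D a a c c x)
    (fun a c => D c a c a x) (fun a b c => q a b c x) hR hr (F.r_le x hx) (h.e_le x hx)
    (h.commutator_le x hx) (h.operator_le x hx) (fun a c => herr a c c a)
    (fun a c => herr a a c c) (fun a c => herr c a c a)

/-- One power of the weight is gained over `energy_bound` by the first order multiplier; `D`
collects the integrations by parts. -/
theorem gradient_bound (hlam : 0 < lam) (hθ : 0 ≤ θ) (hθ1 : θ ≤ 1) (hθl : θ < lam) (hM : 0 ≤ M)
    (hN : 0 ≤ N) : ∃ C : ℝ, 0 ≤ C ∧ ∀ (Ω : Set Space) (r : Space → ℝ)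
      (S : Fin 3 → Fin 3 → Space → ℝ) (w l : Fin 3 → Space → ℝ)
      (p e : Fin 3 → Fin 3 → Space → ℝ) (q : Fin 3 → Fin 3 → Fin 3 → Space → ℝ),
      VacuumFrame M Ω r S → FrameSystem N lam θ Ω r S w l p e q → ∃ D, ZeroMean Ω D ∧ ∀ x ∈ Ω,
        r x ^ (lam - 1) * e2 (fun a b => p a b x) ≤ D x
          + C * (r x ^ (lam - 1) * e1 (fun c => l c x))
          + C * (r x ^ (lam - 1) * r x * e2 (fun a b => p a b x)) := by
  set β := 8 / (lam * (lam - θ)) with hβ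
  have hd : 0 < lam - θ := by linarith
  have hβ0 : 0 ≤ β := by positivity
  set B := 6 * (M * M) with hB
  have hB0 : 0 ≤ B := by positivity
  obtain ⟨C₁, C₂, hC₂, H⟩ := gradient_pointwise (K := (3 / 2 + 3 * β) * (6 * B * M))
    (K₀ := 3 * (M * M)) hlam hθ hθ1 hθl hM hN (by positivity) (by positivity)
  refine ⟨C₂, hC₂, fun Ω r S w l p e q F h => ?_⟩
  have ibp := fun b c d k s a => HasXD.weighted_ibp (B := B) (φ := conormal S r s) F
    (h.hasXD_p b c) (h.hasXD_p d k) (h.wl_p b c) (h.wl_p d k) (fun a => h.wl_q a b c)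
    (fun a => h.wl_q a d k) (F.contDiffOn_conormal s)
    (fun x hx => (F.abs_conormal_le hx s).trans (by nlinarith [mul_nonneg hM hM]))
    (fun x hx j => F.abs_pd_conormal_le hx s j) a
  choose D hD hD0 hDe using ibp
  have Z : ∀ b c d k s a, ZeroMean Ω (D b c d k s a) := fun b c d k s a =>
    ⟨hD b c d k s a, hD0 b c d k s a⟩
  let E : Fin 3 → Fin 3 → Fin 3 → Space → ℝ := fun a b c x =>
    D a c b c b a x - 1 / 2 * D a c a c b b x
      + β * (D a c b b c a x + D a c c b b a x - D a c a b b c x)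
  have ZE : ∀ a b c, ZeroMean Ω (E a b c) := fun a b c =>
    ((Z a c b c b a).sub ((Z a c a c b b).const_mul _)).add
      ((((Z a c b b c a).add (Z a c c b b a)).sub (Z a c a b b c)).const_mul _)
  refine ⟨fun x => C₁ * ∑ a, ∑ b, ∑ c, E a b c x, (ZeroMean.sum fun a => ZeroMean.sum fun b =>
    ZeroMean.sum fun c => ZE a b c).const_mul _, fun x hx => ?_⟩
  have hr := F.pos x hx
  have hR := Real.rpow_nonneg hr.le (lam - 1)
  have herr : ∀ b c d k s a, |D b c d k s a x - (r x ^ (lam - 1) * r x * conormal S r s x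
      * (q a b c x * p d k x + p b c x * q a d k x) + lam * r x ^ (lam - 1) * conormal S r a x
        * conormal S r s x * p b c x * p d k x)|
      ≤ 6 * B * M * (r x ^ (lam - 1) * r x * (n2 (fun a b => p a b x) * n2 (fun a b => p a b x))) :=
    fun b c d k s a => by
      have := hDe b c d k s a x hx
      rw [F.rpow_succ lam hx] at this
      refine this.trans ?_
      have h1 := abs_le_n2 (p := fun a b => p a b x) b c
      have h2 := abs_le_n2 (p := fun a b => p a b x) d k
      gcongr
      exact n2_nonneg
  refine H (r x ^ (lam - 1)) (r x) (fun a => conormal S r a x) (fun c => l c x)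
    (fun a b => p a b x) (fun a b c => q a b c x) (fun a b c => E a b c x) hR hr
    (F.one_le_conormal hx) (F.abs_conormal_le hx) (h.commutator_le x hx) (h.operator_le x hx)
    fun a b c => ?_
  have t1 := herr a c b c b a
  have t2 := herr a c a c b b
  have t3 := herr a c b b c a
  have t4 := herr a c c b b a
  have t5 := herr a c a b b c
  simp only [E, gradFlux, ← hβ]
  set Q := 6 * B * M * (r x ^ (lam - 1) * r x
    * (n2 (fun a b => p a b x) * n2 (fun a b => p a b x)))
  have comb : ∀ {x₁ x₂ x₃ x₄ x₅ y₁ y₂ y₃ y₄ y₅ : ℝ}, |x₁ - y₁| ≤ Q → |x₂ - y₂| ≤ Q →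
      |x₃ - y₃| ≤ Q → |x₄ - y₄| ≤ Q → |x₅ - y₅| ≤ Q →
      |x₁ - 1 / 2 * x₂ + β * (x₃ + x₄ - x₅) - (y₁ - y₂ / 2 + β * (y₃ + y₄ - y₅))|
        ≤ (3 / 2 + 3 * β) * Q := by
    intro x₁ x₂ x₃ x₄ x₅ y₁ y₂ y₃ y₄ y₅ g1 g2 g3 g4 g5
    have e : x₁ - 1 / 2 * x₂ + β * (x₃ + x₄ - x₅) - (y₁ - y₂ / 2 + β * (y₃ + y₄ - y₅))
        = (x₁ - y₁) - 1 / 2 * (x₂ - y₂) + β * ((x₃ - y₃) + (x₄ - y₄) - (x₅ - y₅)) := by ring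
    rw [e]
    have g6 : |(x₃ - y₃) + (x₄ - y₄) - (x₅ - y₅)| ≤ 3 * Q :=
      (abs_sub _ _).trans (by linarith [abs_add_le (x₃ - y₃) (x₄ - y₄)])
    have g7 := mul_le_mul_of_nonneg_left g6 hβ0
    rw [← abs_of_nonneg hβ0, ← abs_mul, abs_of_nonneg hβ0] at g7
    have g8 : |1 / 2 * (x₂ - y₂)| ≤ 1 / 2 * Q := by
      rw [abs_mul, abs_of_nonneg (by norm_num : (0 : ℝ) ≤ 1 / 2)]; linarith
    refine (abs_add_le _ _).trans ((add_le_add ((abs_sub _ _).trans (add_le_add g1 g8)) g7).trans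
      (le_of_eq (by ring)))
  refine (comb t1 t2 t3 t4 t5).trans (le_of_eq ?_)
  simp only [Q]; ring

/-- The bound for second derivatives by the square of the principal part; `D` collects the null-
form integrations by parts. -/
theorem hessian_bound (hM : 0 ≤ M) (hN : 0 ≤ N) : ∃ C : ℝ, 0 ≤ C ∧ ∀ (Ω : Set Space)
      (r : Space → ℝ) (S : Fin 3 → Fin 3 → Space → ℝ) (w l : Fin 3 → Space → ℝ)
      (p e : Fin 3 → Fin 3 → Space → ℝ) (q : Fin 3 → Fin 3 → Fin 3 → Space → ℝ),
      VacuumFrame M Ω r S → FrameSystem N lam θ Ω r S w l p e q → ∃ D, ZeroMean Ω D ∧ ∀ x ∈ Ω,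
        r x ^ (lam + 1) * e3 (fun a b c => q a b c x) ≤ D x
          + C * (r x ^ (lam - 1) * (e1 (fun c => l c x) + e2 (fun a b => p a b x))) := by
  obtain ⟨C₁, C₂, hC₂, H⟩ := hessian_pointwise (lam := lam) (θ := θ)
    (K := 18 * (|lam + 1| + 2) * M ^ 4) (K₀ := 3 * (M * M)) hM hN (by positivity) (by positivity)
  refine ⟨C₂, hC₂, fun Ω r S w l p e q F h => ?_⟩
  have hp : ∀ a c, WL Ω r (lam + 1 - 2) (p a c) := fun a c => by
    convert h.wl_p a c using 1; ring
  have ibp := fun a b c => HasXD.weighted_null_form F (h.hasXD_p a c) (h.hasXD_p b c) (hp a c)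
    (fun k => h.wl_q k a c) (fun k => h.wl_q k b c) a b
  choose D hD hD0 hDe using ibp
  refine ⟨fun x => C₁ * ∑ a, ∑ b, ∑ c, D a b c x, (ZeroMean.sum fun a => ZeroMean.sum fun b =>
    ZeroMean.sum fun c => ⟨hD a b c, hD0 a b c⟩).const_mul _, fun x hx => ?_⟩
  have hr := F.pos x hx
  have hR := Real.rpow_nonneg hr.le (lam - 1)
  have e1' : r x ^ (lam + 1) = r x ^ (lam - 1) * r x ^ 2 := by
    rw [← Real.rpow_natCast, ← Real.rpow_add hr]; congr 1; push_cast; ring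
  have e2' : r x ^ (lam + 1 - 1) = r x ^ (lam - 1) * r x := by
    rw [add_sub_cancel_right, F.rpow_succ lam hx]
  rw [e1']
  refine H (r x ^ (lam - 1)) (r x) (fun a => conormal S r a x) (fun c => l c x)
    (fun a b => p a b x) (fun a b c => q a b c x) (fun a b c => D a b c x) hR hr (F.r_le x hx)
    (F.abs_conormal_le hx) (h.commutator_le x hx) (h.operator_le x hx) fun a b c => ?_
  have := hDe a b c x hx
  rw [e1', e2'] at this
  refine this.trans ?_
  have h1 := abs_le_n2 (p := fun a b => p a b x) a c
  have h2 : ∑ k, |q k b c x| ≤ n3 (fun a b c => q a b c x) := by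
    refine Finset.sum_le_sum fun k _ => ?_
    exact (abs_le_n1 (w := fun c => q k b c x) c).trans
      (Finset.single_le_sum (f := fun i => n1 fun c => q k i c x) (fun _ _ => n1_nonneg)
        (Finset.mem_univ b))
  gcongr
  exact n2_nonneg

/-- The degenerate elliptic estimate for a system in frame components. -/
theorem frame_estimate (hlam : 0 < lam) (hθ : 0 ≤ θ) (hθ1 : θ ≤ 1) (hθl : θ < lam) (hM : 0 ≤ M)
    (hN : 0 ≤ N) : ∃ C : ℝ, 0 ≤ C ∧ ∀ (Ω : Set Space) (r : Space → ℝ)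
      (S : Fin 3 → Fin 3 → Space → ℝ) (w l : Fin 3 → Space → ℝ)
      (p e : Fin 3 → Fin 3 → Space → ℝ) (q : Fin 3 → Fin 3 → Fin 3 → Space → ℝ),
      VacuumFrame M Ω r S → FrameSystem N lam θ Ω r S w l p e q →
      ∫ x in Ω, (r x ^ (lam + 1) * e3 (fun a b c => q a b c x)
        + r x ^ (lam - 1) * e2 (fun a b => p a b x))
      ≤ C * ∫ x in Ω, r x ^ (lam - 1) * (e1 (fun c => l c x) + e1 (fun c => w c x)) := by
  obtain ⟨C₁, hC₁, H₁⟩ := energy_bound hlam hθ hθl hM hN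
  obtain ⟨C₂, hC₂, H₂⟩ := gradient_bound hlam hθ hθ1 hθl hM hN
  obtain ⟨C₃, hC₃, H₃⟩ := hessian_bound (lam := lam) (θ := θ) hM hN
  refine ⟨C₃ + (1 + C₃) * (C₂ + C₂ * C₁), by positivity, fun Ω r S w l p e q F h => ?_⟩
  obtain ⟨D₁, Z₁, E₁⟩ := H₁ Ω r S w l p e q F h
  obtain ⟨D₂, Z₂, E₂⟩ := H₂ Ω r S w l p e q F h
  obtain ⟨D₃, Z₃, E₃⟩ := H₃ Ω r S w l p e q F h
  have Z := Z₃.add ((Z₂.add (Z₁.const_mul C₂)).const_mul (1 + C₃))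
  have hl : IntegrableOn (fun x => r x ^ (lam - 1) * e1 (fun c => l c x)) Ω := by
    simp only [e1, Finset.mul_sum]
    exact integrable_finsetSum _ fun c _ => (h.wl_l c).2
  have hw : IntegrableOn (fun x => r x ^ (lam - 1) * e1 (fun c => w c x)) Ω := by
    simp only [e1, Finset.mul_sum]
    exact integrable_finsetSum _ fun c _ => (h.wl_w c).2
  have hp : IntegrableOn (fun x => r x ^ (lam - 1) * e2 (fun a b => p a b x)) Ω := by
    simp only [e2, Finset.mul_sum]
    exact integrable_finsetSum _ fun a _ => integrable_finsetSum _ fun c _ => (h.wl_p a c).2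
  have hq : IntegrableOn (fun x => r x ^ (lam + 1) * e3 (fun a b c => q a b c x)) Ω := by
    simp only [e3, Finset.mul_sum]
    exact integrable_finsetSum _ fun a _ => integrable_finsetSum _ fun b _ =>
      integrable_finsetSum _ fun c _ => (h.wl_q a b c).2
  have hlw : IntegrableOn (fun x => r x ^ (lam - 1) * (e1 (fun c => l c x)
      + e1 (fun c => w c x))) Ω := by
    simp only [mul_add]; exact hl.add hw
  refine (setIntegral_mono_on (hq.add hp) (Z.1.add (hlw.const_mul
    (C₃ + (1 + C₃) * (C₂ + C₂ * C₁)))) F.isOpen.measurableSet fun x hx => ?_).trans (le_of_eq ?_)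
  · have g1 := mul_le_mul_of_nonneg_left (E₁ x hx) hC₂
    have g2 := E₂ x hx
    have hR := Real.rpow_nonneg (F.pos x hx).le (lam - 1)
    have hL := mul_nonneg hR (e1_nonneg (w := fun c => l c x))
    have hW := mul_nonneg hR (e1_nonneg (w := fun c => w c x))
    have g3 := mul_le_mul_of_nonneg_left (show r x ^ (lam - 1) * e2 (fun a b => p a b x)
      ≤ D₂ x + C₂ * D₁ x + (C₂ + C₂ * C₁) * (r x ^ (lam - 1) * (e1 (fun c => l c x)
        + e1 (fun c => w c x))) by nlinarith [mul_nonneg hC₂ hW]) (show 0 ≤ 1 + C₃ by linarith)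
    have g4 := E₃ x hx
    have g5 := mul_nonneg hC₃ hW
    simp only [Pi.add_apply]
    linarith
  · rw [integral_add' Z.1 (hlw.const_mul _), Z.2, integral_const_mul, zero_add]

end Setting

end VacuumEuler

namespace VacuumEuler

open Filter Topology

/-! ### Calculus of weak gradients -/

section Calculus

variable {Ω : Set Space} {f g h c φ : Space → ℝ} {g' h' : Fin 3 → Space → ℝ}

theorem L2loc.integrableOn_mul_test (hΩ : IsOpen Ω) (hf : L2loc Ω f) (hφ : IsTestFunction Ω φ) :
    IntegrableOn (fun x => f x * φ x) Ω := by
  have := L2loc.integrableOn_mul_mul hΩ hφ.1.continuous hφ.2.1 hφ.2.2 hf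
    (ContDiff.l2loc (Ω := Ω) (contDiff_const (c := (1 : ℝ))))
  refine this.congr (Eventually.of_forall fun x => ?_)
  simp only []; ring

theorem HasWD.add (hΩ : IsOpen Ω) (hg : HasWD Ω g g') (hh : HasWD Ω h h') :
    HasWD Ω (fun x => g x + h x) (fun j x => g' j x + h' j x) where
  l2 := hg.l2.add hh.l2
  l2' j := (hg.l2' j).add (hh.l2' j)
  ibp j φ hφ := by
    simp only [add_mul]
    rw [integral_add (hg.l2.integrableOn_mul_test hΩ (hφ.pd j))
      (hh.l2.integrableOn_mul_test hΩ (hφ.pd j)),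
      integral_add ((hg.l2' j).integrableOn_mul_test hΩ hφ)
      ((hh.l2' j).integrableOn_mul_test hΩ hφ), hg.ibp j φ hφ, hh.ibp j φ hφ]
    ring

theorem HasWD.zero : HasWD Ω (fun _ => 0) (fun _ _ => 0) where
  l2 := ContDiff.l2loc contDiff_const
  l2' _ := ContDiff.l2loc contDiff_const
  ibp j φ _ := by simp

theorem HasWD.sum (hΩ : IsOpen Ω) {ι : Type*} (s : Finset ι) {g : ι → Space → ℝ}
    {g' : ι → Fin 3 → Space → ℝ} (hg : ∀ k ∈ s, HasWD Ω (g k) (g' k)) :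
    HasWD Ω (fun x => ∑ k ∈ s, g k x) (fun j x => ∑ k ∈ s, g' k j x) := by
  classical
  induction s using Finset.induction_on with
  | empty => simpa using HasWD.zero
  | insert i s hi ih =>
    simp only [Finset.sum_insert hi]
    exact (hg i (Finset.mem_insert_self i s)).add hΩ
      (ih fun j hj => hg j (Finset.mem_insert_of_mem hj))

/-- The Leibniz rule for a smooth coefficient. -/
theorem HasWD.smul (hΩ : IsOpen Ω) (hg : HasWD Ω g g') (hc : ContDiffOn ℝ ∞ c Ω) :
    HasWD Ω (fun x => c x * g x) (fun j x => pd j c x * g x + c x * g' j x) where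
  l2 := L2loc.mul_continuousOn hc.continuousOn hg.l2
  l2' j := (L2loc.mul_continuousOn (contDiffOn_pd hΩ j hc).continuousOn hg.l2).add
    (L2loc.mul_continuousOn hc.continuousOn (hg.l2' j))
  ibp j φ hφ := by
    have h1 := hg.ibp j _ (hφ.smul hΩ hc)
    have i1 := hg.l2.integrableOn_mul_test hΩ (hφ.smul hΩ (contDiffOn_pd hΩ j hc))
    have i2 := hg.l2.integrableOn_mul_test hΩ ((hφ.pd j).smul hΩ hc)
    have i3 := (hg.l2' j).integrableOn_mul_test hΩ (hφ.smul hΩ hc)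
    have e1 : ∫ x in Ω, g x * pd j (fun x => c x * φ x) x
        = (∫ x in Ω, g x * (pd j c x * φ x)) + ∫ x in Ω, g x * (c x * pd j φ x) := by
      rw [← integral_add i1 i2]
      refine setIntegral_congr_fun hΩ.measurableSet fun x hx => ?_
      rw [pd_mul j (diffAt_of_contDiffOn hΩ hc hx) (hφ.1.differentiable (by simp) x)]
      ring
    have e2 : ∫ x in Ω, (pd j c x * g x + c x * g' j x) * φ x
        = (∫ x in Ω, g x * (pd j c x * φ x)) + ∫ x in Ω, g' j x * (c x * φ x) := by
      rw [← integral_add i1 i3]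
      refine integral_congr_ae (Eventually.of_forall fun x => ?_)
      simp only []; ring
    have e3 : ∫ x in Ω, c x * g x * pd j φ x = ∫ x in Ω, g x * (c x * pd j φ x) :=
      integral_congr_ae (Eventually.of_forall fun x => by simp only []; ring)
    rw [e2, e3]
    linarith

end Calculus

/-! ### The a priori estimate in Cartesian components -/

/-- Cartesian components of a covector field `v` of class `H²` with first and second derivatives
`P i k = ∂_i v_k`, `Q l i k = ∂_l ∂_i v_k`, and the degenerate operator `L` applied to it, with
`∑_a S_{aj} S_{ak}` as inverse metric. The parameter `θ` weights the null-form lower order term. -/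
structure CoordSystem (lam θ : ℝ) (Ω : Set Space) (r : Space → ℝ)
    (S : Fin 3 → Fin 3 → Space → ℝ) (v L : Fin 3 → Space → ℝ) (P : Fin 3 → Fin 3 → Space → ℝ)
    (Q : Fin 3 → Fin 3 → Fin 3 → Space → ℝ) : Prop where
  hasWD_v : ∀ k, HasWD Ω (v k) (fun i => P i k)
  hasWD_P : ∀ i k, HasWD Ω (P i k) (fun l => Q l i k)
  symm : ∀ x ∈ Ω, ∀ l i k, Q l i k x = Q i l k x
  operator_eq : ∀ x ∈ Ω, ∀ i, L i x = ∑ j, ∑ k, (∑ a, S a j x * S a k x) *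
    (r x * Q j k i x + lam * pd k r x * P j i x
      + θ * (pd i r x * P j k x - pd j r x * P i k x))
  wl_v : ∀ k, WL Ω r (lam - 1) (v k)
  wl_L : ∀ k, WL Ω r (lam - 1) (L k)
  wl_P : ∀ i k, WL Ω r (lam + 1) (P i k)
  wl_Q : ∀ l i k, WL Ω r (lam + 1) (Q l i k)

/-- The derivative `X_a (S_{bi} S_{ck})` of the coefficients of the second frame components. -/
def frameCoeff (S : Fin 3 → Fin 3 → Space → ℝ) (a b c i k : Fin 3) : Space → ℝ :=
  frameD S a fun l => pd l fun y => S b i y * S c k y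

section Setting

variable {M lam θ B : ℝ} {Ω : Set Space} {r : Space → ℝ} {S : Fin 3 → Fin 3 → Space → ℝ}
  {v L : Fin 3 → Space → ℝ} {P : Fin 3 → Fin 3 → Space → ℝ}
  {Q : Fin 3 → Fin 3 → Fin 3 → Space → ℝ}

theorem VacuumFrame.abs_frameCoeff_le (F : VacuumFrame M Ω r S) {x : Space} (hx : x ∈ Ω)
    (a b c i k : Fin 3) : |frameCoeff S a b c i k x| ≤ 6 * M ^ 3 := by
  have hM := F.M_nonneg
  refine (F.abs_frameD_le hx (B := 2 * M ^ 2) (fun l => ?_) a).trans (le_of_eq (by ring))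
  rw [pd_mul l (diffAt_of_contDiffOn F.isOpen (F.smooth_S b i) hx)
    (diffAt_of_contDiffOn F.isOpen (F.smooth_S c k) hx)]
  refine (abs_add_le _ _).trans ?_
  rw [abs_mul, abs_mul]
  have h1 := mul_le_mul (F.pd_S_le x hx l b i) (F.S_le x hx c k) (abs_nonneg _) hM
  have h2 := mul_le_mul (F.S_le x hx b i) (F.pd_S_le x hx l c k) (abs_nonneg _) hM
  linarith

theorem VacuumFrame.continuousOn_frameD (F : VacuumFrame M Ω r S) {f : Space → ℝ}
    (hf : ContDiffOn ℝ ∞ f Ω) (a : Fin 3) : ContinuousOn (frameD S a fun l => pd l f) Ω :=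
  continuousOn_finsetSum _ fun j _ =>
    (F.smooth_S a j).continuousOn.mul (contDiffOn_pd F.isOpen j hf).continuousOn

/-- Inverting the frame in one slot. -/
theorem VacuumFrame.coercive_one (F : VacuumFrame M Ω r S) {x : Space} (hx : x ∈ Ω)
    (ξ : Fin 3 → ℝ) (j : Fin 3) : |ξ j| ≤ M * n1 fun c => ∑ k, S c k x * ξ k :=
  F.coercive x hx ξ j

/-- Inverting the frame in two slots. -/
theorem VacuumFrame.coercive_two (F : VacuumFrame M Ω r S) {x : Space} (hx : x ∈ Ω)
    (ξ : Fin 3 → Fin 3 → ℝ) (i k : Fin 3) :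
    |ξ i k| ≤ M ^ 2 * n2 fun a c => ∑ i, ∑ k, S a i x * S c k x * ξ i k := by
  have hM := F.M_nonneg
  refine (F.coercive x hx (fun i => ξ i k) i).trans ?_
  rw [pow_two, mul_assoc]
  refine mul_le_mul_of_nonneg_left ?_ hM
  rw [n2, Finset.mul_sum]
  refine Finset.sum_le_sum fun a _ => ?_
  refine (F.coercive x hx (fun k => ∑ i, S a i x * ξ i k) k).trans (le_of_eq ?_)
  congr 1
  refine Finset.sum_congr rfl fun c _ => ?_
  congr 1
  rw [Finset.sum_comm]
  refine Finset.sum_congr rfl fun k _ => ?_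
  rw [Finset.mul_sum]
  exact Finset.sum_congr rfl fun i _ => by ring

/-- Inverting the frame in three slots. -/
theorem VacuumFrame.coercive_three (F : VacuumFrame M Ω r S) {x : Space} (hx : x ∈ Ω)
    (ξ : Fin 3 → Fin 3 → Fin 3 → ℝ) (l i k : Fin 3) :
    |ξ l i k| ≤ M ^ 3 * n3 fun a b c =>
      ∑ i, ∑ k, S b i x * S c k x * ∑ l, S a l x * ξ l i k := by
  have hM := F.M_nonneg
  refine (F.coercive x hx (fun l => ξ l i k) l).trans ?_
  rw [show M ^ 3 = M * M ^ 2 by ring, mul_assoc]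
  refine mul_le_mul_of_nonneg_left ?_ hM
  rw [n3, Finset.mul_sum]
  exact Finset.sum_le_sum fun a _ => F.coercive_two hx (fun i k => ∑ l, S a l x * ξ l i k) i k

/-- The Cartesian system in the frame: a covector field becomes a `FrameSystem`. -/
theorem CoordSystem.frameSystem (F : VacuumFrame M Ω r S) (hlam : 0 < lam)
    (C : CoordSystem lam θ Ω r S v L P Q) :
    FrameSystem (162 * M ^ 5 + 9 * M ^ 3) lam θ Ω r S
      (fun c x => ∑ k, S c k x * v k x) (fun c x => ∑ k, S c k x * L k x)
      (fun a c x => ∑ i, ∑ k, S a i x * S c k x * P i k x)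
      (fun a c x => ∑ k, frameD S a (fun l => pd l (S c k)) x * v k x)
      (fun a b c x => ∑ i, ∑ k, (frameCoeff S a b c i k x * P i k x
        + S b i x * S c k x * ∑ l, S a l x * Q l i k x)) := by
  have hM := F.M_nonneg
  have hΩ := F.isOpen
  have hSS : ∀ b i c k, ContDiffOn ℝ ∞ (fun x => S b i x * S c k x) Ω := fun b i c k =>
    (F.smooth_S b i).mul (F.smooth_S c k)
  have hSSb : ∀ b i c k, ∀ x ∈ Ω, |S b i x * S c k x| ≤ M * M := fun b i c k x hx => by
    rw [abs_mul]; exact mul_le_mul (F.S_le x hx b i) (F.S_le x hx c k) (abs_nonneg _) hM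
  have hPl : ∀ i k, WL Ω r (lam - 1) (P i k) := fun i k =>
    F.hardy hlam ⟨_, C.hasWD_P i k, fun a x _ => rfl⟩ (C.wl_P i k) fun a =>
      WL.sum F _ fun j _ => (C.wl_Q j i k).bdd_mul F (F.smooth_S a j).continuousOn
        fun x hx => F.S_le x hx a j
  have hvb : ∀ x ∈ Ω, ∀ k, |v k x| ≤ M * n1 fun c => ∑ k, S c k x * v k x := fun x hx k =>
    F.coercive_one hx (fun k => v k x) k
  have hPb : ∀ x ∈ Ω, ∀ i k, |P i k x| ≤ M ^ 2 * n2 fun a c =>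
      ∑ i, ∑ k, S a i x * S c k x * P i k x := fun x hx i k =>
    F.coercive_two hx (fun i k => P i k x) i k
  have hcP : ∀ x ∈ Ω, ∀ a b c, |∑ i, ∑ k, frameCoeff S a b c i k x * P i k x|
      ≤ 54 * M ^ 5 * n2 fun a c => ∑ i, ∑ k, S a i x * S c k x * P i k x := by
    intro x hx a b c
    refine (abs_sum_sum_le_of_le (b := 6 * M ^ 3 * (M ^ 2 * n2 fun a c =>
      ∑ i, ∑ k, S a i x * S c k x * P i k x)) fun i k => ?_).trans (le_of_eq (by ring))
    rw [abs_mul]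
    exact mul_le_mul (F.abs_frameCoeff_le hx a b c i k) (hPb x hx i k) (abs_nonneg _)
      (by positivity)
  have hfb : ∀ a c k, ∀ x ∈ Ω, |frameD S a (fun l => pd l (S c k)) x| ≤ 3 * (M * M) :=
    fun a c k x hx => F.abs_frameD_le hx (fun l => F.pd_S_le x hx l c k) a
  refine
    { hasXD_w := fun c => ⟨_, HasWD.sum hΩ Finset.univ fun k _ =>
        (C.hasWD_v k).smul hΩ (F.smooth_S c k), fun a x _ => ?_⟩
      hasXD_p := fun b c => ⟨_, HasWD.sum hΩ Finset.univ fun i _ =>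
        HasWD.sum hΩ Finset.univ fun k _ => (C.hasWD_P i k).smul hΩ (hSS b i c k),
        fun a x _ => ?_⟩
      e_le := fun x hx a c => ?_
      commutator_le := fun x hx a b c => ?_
      operator_le := fun x hx c => ?_
      wl_w := fun c => WL.sum F _ fun k _ => (C.wl_v k).bdd_mul F (F.smooth_S c k).continuousOn
        fun x hx => F.S_le x hx c k
      wl_l := fun c => WL.sum F _ fun k _ => (C.wl_L k).bdd_mul F (F.smooth_S c k).continuousOn
        fun x hx => F.S_le x hx c k
      wl_e := fun a c => WL.sum F _ fun k _ => (C.wl_v k).bdd_mul F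
        (F.continuousOn_frameD (F.smooth_S c k) a) (hfb a c k)
      wl_p := fun a c => WL.sum F _ fun i _ => WL.sum F _ fun k _ => (hPl i k).bdd_mul F
        (hSS a i c k).continuousOn (hSSb a i c k)
      wl_q := fun a b c => WL.sum F _ fun i _ => WL.sum F _ fun k _ =>
        ((C.wl_P i k).bdd_mul F (F.continuousOn_frameD (hSS b i c k) a)
          (fun x hx => F.abs_frameCoeff_le hx a b c i k)).add F
        ((WL.sum F _ fun l _ => (C.wl_Q l i k).bdd_mul F (F.smooth_S a l).continuousOn
          fun x hx => F.S_le x hx a l).bdd_mul F (hSS b i c k).continuousOn (hSSb b i c k)) }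
  · simp only [frameD, Fin.sum_univ_three]; ring
  · simp only [frameD, frameCoeff, Fin.sum_univ_three]; ring
  · refine (abs_sum_le_of_le (b := 3 * (M * M) * (M * n1 fun c => ∑ k, S c k x * v k x))
      fun k => ?_).trans ?_
    · rw [abs_mul]
      exact mul_le_mul (hfb a c k x hx) (hvb x hx k) (abs_nonneg _) (by positivity)
    · have : 0 ≤ M ^ 5 * n1 fun c => ∑ k, S c k x * v k x := mul_nonneg (by positivity) n1_nonneg
      linarith
  · have e : (∑ i, ∑ k, S b i x * S c k x * ∑ l, S a l x * Q l i k x)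
        = ∑ i, ∑ k, S a i x * S c k x * ∑ l, S b l x * Q l i k x := by
      simp only [Fin.sum_univ_three, C.symm x hx 1 0, C.symm x hx 2 0, C.symm x hx 2 1]
      ring
    simp only [Finset.sum_add_distrib]
    rw [e, add_sub_add_right_eq_sub]
    refine (abs_sub _ _).trans ?_
    have h1 := hcP x hx a b c
    have h2 := hcP x hx b a c
    have : 0 ≤ (54 * M ^ 5 + 9 * M ^ 3) * n2 fun a c => ∑ i, ∑ k, S a i x * S c k x * P i k x :=
      mul_nonneg (by positivity) n2_nonneg
    linarith
  · have e : (∑ k, S c k x * L k x) - principal lam θ (r x) (fun a => conormal S r a x)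
        (fun a c => ∑ i, ∑ k, S a i x * S c k x * P i k x)
        (fun a b c => ∑ i, ∑ k, (frameCoeff S a b c i k x * P i k x
          + S b i x * S c k x * ∑ l, S a l x * Q l i k x)) c
        = - (r x * ∑ a, ∑ i, ∑ k, frameCoeff S a a c i k x * P i k x) := by
      simp only [C.operator_eq x hx, principal, conormal, frameD, Fin.sum_univ_three]
      ring
    rw [e, abs_neg, abs_mul, abs_of_pos (F.pos x hx)]
    have h1 := abs_sum_le_of_le fun a => hcP x hx a a c
    have h2 := mul_le_mul_of_nonneg_left h1 (F.pos x hx).le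
    have : 0 ≤ r x * (9 * M ^ 3) * n2 fun a c => ∑ i, ∑ k, S a i x * S c k x * P i k x :=
      mul_nonneg (mul_nonneg (F.pos x hx).le (by positivity)) n2_nonneg
    linarith

theorem integrableOn_rpow_mul_e1 {μ : ℝ} (hv : ∀ k, WL Ω r μ (v k)) :
    IntegrableOn (fun x => r x ^ μ * e1 fun k => v k x) Ω := by
  simp only [e1, Finset.mul_sum]
  exact integrable_finsetSum _ fun k _ => (hv k).2

theorem integrableOn_rpow_mul_e2 {μ : ℝ} (hP : ∀ i k, WL Ω r μ (P i k)) :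
    IntegrableOn (fun x => r x ^ μ * e2 fun i k => P i k x) Ω := by
  simp only [e2, Finset.mul_sum]
  exact integrable_finsetSum _ fun i _ => integrable_finsetSum _ fun k _ => (hP i k).2

theorem integrableOn_rpow_mul_e3 {μ : ℝ} (hQ : ∀ l i k, WL Ω r μ (Q l i k)) :
    IntegrableOn (fun x => r x ^ μ * e3 fun l i k => Q l i k x) Ω := by
  simp only [e3, Finset.mul_sum]
  exact integrable_finsetSum _ fun l _ => integrable_finsetSum _ fun i _ =>
    integrable_finsetSum _ fun k _ => (hQ l i k).2

theorem VacuumFrame.e1_frame_le (F : VacuumFrame M Ω r S) {x : Space} (hx : x ∈ Ω)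
    (ξ : Fin 3 → ℝ) : (e1 fun c => ∑ k, S c k x * ξ k) ≤ 9 * M ^ 2 * e1 ξ := by
  have h : ∀ c, (∑ k, S c k x * ξ k) ^ 2 ≤ M ^ 2 * (3 * e1 ξ) := fun c => by
    have h1 : |∑ k, S c k x * ξ k| ≤ M * n1 ξ := by
      refine (Finset.abs_sum_le_sum_abs _ _).trans ?_
      rw [n1, Finset.mul_sum]
      refine Finset.sum_le_sum fun k _ => ?_
      rw [abs_mul]
      exact mul_le_mul_of_nonneg_right (F.S_le x hx c k) (abs_nonneg _)
    rw [← sq_abs]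
    refine (pow_le_pow_left₀ (abs_nonneg _) h1 2).trans ?_
    rw [mul_pow]
    exact mul_le_mul_of_nonneg_left n1_sq_le (sq_nonneg _)
  refine (Finset.sum_le_sum fun c _ => h c).trans (le_of_eq ?_)
  simp; ring

/-- Second derivatives in Cartesian components from those in frame components. -/
theorem VacuumFrame.coord_le_frame (F : VacuumFrame M Ω r S) {x : Space} (hx : x ∈ Ω)
    (P : Fin 3 → Fin 3 → ℝ) (Q : Fin 3 → Fin 3 → Fin 3 → ℝ) :
    e2 P ≤ 81 * M ^ 4 * e2 (fun a c => ∑ i, ∑ k, S a i x * S c k x * P i k) ∧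
    e3 Q ≤ 1458 * M ^ 6 * e3 (fun a b c => ∑ i, ∑ k, (frameCoeff S a b c i k x * P i k
        + S b i x * S c k x * ∑ l, S a l x * Q l i k))
      + 486 * M ^ 6 * (1458 * M ^ 5) ^ 2
        * e2 (fun a c => ∑ i, ∑ k, S a i x * S c k x * P i k) := by
  have hM := F.M_nonneg
  set p : Fin 3 → Fin 3 → ℝ := fun a c => ∑ i, ∑ k, S a i x * S c k x * P i k with hp
  set q : Fin 3 → Fin 3 → Fin 3 → ℝ := fun a b c => ∑ i, ∑ k, (frameCoeff S a b c i k x * P i k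
        + S b i x * S c k x * ∑ l, S a l x * Q l i k) with hq
  have hP : ∀ i k, |P i k| ≤ M ^ 2 * n2 p := fun i k => F.coercive_two hx P i k
  have hn2 : 0 ≤ n2 p := n2_nonneg
  have hn3 : 0 ≤ n3 q := n3_nonneg
  have h2 := n2_sq_le (p := p)
  have h3 := n3_sq_le (q := q)
  constructor
  · have h : ∀ i k, P i k ^ 2 ≤ 9 * M ^ 4 * e2 p := fun i k => by
      rw [← sq_abs]
      refine (pow_le_pow_left₀ (abs_nonneg _) (hP i k) 2).trans ?_
      rw [mul_pow]
      have := mul_le_mul_of_nonneg_left h2 (by positivity : (0 : ℝ) ≤ (M ^ 2) ^ 2)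
      linarith
    refine (Finset.sum_le_sum fun i _ => Finset.sum_le_sum fun k _ => h i k).trans (le_of_eq ?_)
    simp; ring
  · have hq' : ∀ a b c, |∑ i, ∑ k, S b i x * S c k x * ∑ l, S a l x * Q l i k|
        ≤ |q a b c| + 54 * M ^ 5 * n2 p := fun a b c => by
      have e : ∑ i, ∑ k, S b i x * S c k x * ∑ l, S a l x * Q l i k
          = q a b c - ∑ i, ∑ k, frameCoeff S a b c i k x * P i k := by
        simp only [hq, Finset.sum_add_distrib]; ring
      rw [e]
      refine (abs_sub _ _).trans (add_le_add le_rfl ?_)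
      refine (abs_sum_sum_le_of_le (b := 6 * M ^ 3 * (M ^ 2 * n2 p)) fun i k => ?_).trans
        (le_of_eq (by ring))
      rw [abs_mul]
      exact mul_le_mul (F.abs_frameCoeff_le hx a b c i k) (hP i k) (abs_nonneg _) (by positivity)
    have hQ : ∀ l i k, |Q l i k| ≤ M ^ 3 * (n3 q + 1458 * M ^ 5 * n2 p) := fun l i k => by
      refine (F.coercive_three hx Q l i k).trans (mul_le_mul_of_nonneg_left ?_ (by positivity))
      refine (Finset.sum_le_sum fun a _ => Finset.sum_le_sum fun b _ =>
        Finset.sum_le_sum fun c _ => hq' a b c).trans (le_of_eq ?_)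
      simp only [Finset.sum_add_distrib, Finset.sum_const, Finset.card_univ, Fintype.card_fin, n3]
      ring
    have h : ∀ l i k, Q l i k ^ 2 ≤ 54 * M ^ 6 * e3 q
        + 18 * M ^ 6 * (1458 * M ^ 5) ^ 2 * e2 p := fun l i k => by
      rw [← sq_abs]
      refine (pow_le_pow_left₀ (abs_nonneg _) (hQ l i k) 2).trans ?_
      have h4 : (n3 q + 1458 * M ^ 5 * n2 p) ^ 2
          ≤ 2 * (27 * e3 q) + 2 * ((1458 * M ^ 5) ^ 2 * (9 * e2 p)) := by
        have h5 := mul_le_mul_of_nonneg_left h2 (sq_nonneg (1458 * M ^ 5))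
        nlinarith [sq_nonneg (n3 q - 1458 * M ^ 5 * n2 p)]
      have := mul_le_mul_of_nonneg_left h4 (by positivity : (0 : ℝ) ≤ (M ^ 3) ^ 2)
      rw [mul_pow]
      refine this.trans (le_of_eq ?_)
      ring
    refine (Finset.sum_le_sum fun l _ => Finset.sum_le_sum fun i _ => Finset.sum_le_sum
      fun k _ => h l i k).trans (le_of_eq ?_)
    simp; ring

/-- The a priori estimate in Cartesian components. -/
theorem coordinate_estimate (hlam : 0 < lam) (hθ : 0 ≤ θ) (hθ1 : θ ≤ 1) (hθl : θ < lam)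
    (hM : 0 ≤ M) : ∃ C : ℝ, 0 ≤ C ∧ ∀ (Ω : Set Space) (r : Space → ℝ)
      (S : Fin 3 → Fin 3 → Space → ℝ) (v L : Fin 3 → Space → ℝ) (P : Fin 3 → Fin 3 → Space → ℝ)
      (Q : Fin 3 → Fin 3 → Fin 3 → Space → ℝ), VacuumFrame M Ω r S →
      CoordSystem lam θ Ω r S v L P Q →
      ∫ x in Ω, r x ^ (lam + 1) * (e3 (fun l i k => Q l i k x) + e2 (fun i k => P i k x)
          + e1 (fun k => v k x))
        ≤ C * ∫ x in Ω, r x ^ (lam - 1) * (e1 (fun k => L k x) + e1 (fun k => v k x)) := by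
  obtain ⟨C, hC, H⟩ := frame_estimate (N := 162 * M ^ 5 + 9 * M ^ 3) hlam hθ hθ1 hθl hM
    (by positivity)
  set K := 1458 * M ^ 6 + M ^ 2 * (81 * M ^ 4 + 486 * M ^ 6 * (1458 * M ^ 5) ^ 2) with hK
  have hK0 : 0 ≤ K := by positivity
  refine ⟨K * C * (9 * M ^ 2) + M ^ 2, by positivity, fun Ω r S v L P Q F c => ?_⟩
  have h := c.frameSystem F hlam
  have hest := H Ω r S _ _ _ _ _ F h
  have hmeas := F.isOpen.measurableSet
  have I1 := (integrableOn_rpow_mul_e3 h.wl_q).fun_add (integrableOn_rpow_mul_e2 h.wl_p)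
  have I2 := (integrableOn_rpow_mul_e1 c.wl_L).fun_add (integrableOn_rpow_mul_e1 c.wl_v)
  simp only [← mul_add] at I2
  have I3 := (integrableOn_rpow_mul_e1 h.wl_l).fun_add (integrableOn_rpow_mul_e1 h.wl_w)
  simp only [← mul_add] at I3
  have I4 := ((integrableOn_rpow_mul_e3 c.wl_Q).fun_add (integrableOn_rpow_mul_e2 c.wl_P)).fun_add
    (integrableOn_rpow_mul_e1 fun k => (c.wl_v k).mono F (by linarith : lam - 1 ≤ lam + 1))
  simp only [← mul_add] at I4
  have s1 := setIntegral_mono_on I4 ((I1.const_mul K).fun_add (I2.const_mul (M ^ 2))) hmeas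
    fun x hx => ?_
  · refine s1.trans ?_
    rw [integral_add (I1.const_mul K) (I2.const_mul (M ^ 2)), integral_const_mul,
      integral_const_mul]
    have s2 := setIntegral_mono_on I3 (I2.const_mul (9 * M ^ 2)) hmeas fun x hx => ?_
    · rw [integral_const_mul] at s2
      have s3 := mul_le_mul_of_nonneg_left (hest.trans (mul_le_mul_of_nonneg_left s2 hC)) hK0
      linarith
    · have hR := Real.rpow_nonneg (F.pos x hx).le (lam - 1)
      have h1 := F.e1_frame_le hx fun k => L k x
      have h2 := F.e1_frame_le hx fun k => v k x
      have := mul_le_mul_of_nonneg_left (add_le_add h1 h2) hR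
      linarith
  · have hr := F.pos x hx
    have hR := Real.rpow_nonneg hr.le (lam - 1)
    have hrM : r x * r x ≤ M ^ 2 := by
      rw [pow_two]; exact mul_self_le_mul_self hr.le (F.r_le x hx)
    have e : r x ^ (lam + 1) = r x ^ (lam - 1) * (r x * r x) := by
      rw [F.rpow_succ (lam + 1) hx, add_sub_cancel_right, F.rpow_succ lam hx]; ring
    obtain ⟨h2, h3⟩ := F.coord_le_frame hx (fun i k => P i k x) (fun l i k => Q l i k x)
    rw [e]
    set E2 := e2 fun a c => ∑ i, ∑ k, S a i x * S c k x * P i k x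
    set E3 := e3 fun a b c => ∑ i, ∑ k, (frameCoeff S a b c i k x * P i k x
        + S b i x * S c k x * ∑ l, S a l x * Q l i k x)
    have hE2 : 0 ≤ E2 := e2_nonneg
    have hE3 : 0 ≤ E3 := e3_nonneg
    have hv : 0 ≤ e1 fun k => v k x := e1_nonneg
    have hL : 0 ≤ e1 fun k => L k x := e1_nonneg
    set K2 := 81 * M ^ 4 + 486 * M ^ 6 * (1458 * M ^ 5) ^ 2 with hK2
    have hK2' : 0 ≤ K2 := by positivity
    have a1 := mul_le_mul_of_nonneg_left (add_le_add h3 h2)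
      (mul_nonneg hR (mul_self_nonneg (r x)))
    have a2 := mul_le_mul_of_nonneg_right hrM (mul_nonneg hR (mul_nonneg hK2' hE2))
    have a3 := mul_le_mul_of_nonneg_right hrM (mul_nonneg hR hv)
    have a4 : 0 ≤ M ^ 2 * (r x ^ (lam - 1) * e1 fun k => L k x) := by positivity
    have a5 : 0 ≤ M ^ 2 * K2 * (r x ^ (lam - 1) * (r x * r x) * E3) := by positivity
    have a6 : 0 ≤ 1458 * M ^ 6 * (r x ^ (lam - 1) * E2) := by positivity
    have e' : K * (r x ^ (lam - 1) * (r x * r x) * E3 + r x ^ (lam - 1) * E2)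
        = 1458 * M ^ 6 * (r x ^ (lam - 1) * (r x * r x) * E3)
          + M ^ 2 * K2 * (r x ^ (lam - 1) * (r x * r x) * E3)
          + 1458 * M ^ 6 * (r x ^ (lam - 1) * E2) + M ^ 2 * (r x ^ (lam - 1) * (K2 * E2)) := by
      rw [hK]; ring
    rw [e']
    have e'' : r x ^ (lam - 1) * (K2 * E2) = r x ^ (lam - 1) *
      (81 * M ^ 4 * E2 + 486 * M ^ 6 * (1458 * M ^ 5) ^ 2 * E2) := by rw [hK2]; ring
    rw [e''] at a2 ⊢
    clear_value K2 E2 E3 K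
    nlinarith

end Setting
end VacuumEuler

namespace VacuumEuler

open Filter Topology

/-! ### Uniform bounds for the background -/

/-- `f t` is smooth on the slice `Ω t` and its derivatives of order at most two are bounded,
uniformly in `t ∈ [0, T]`. -/
def UnifC2 (T : ℝ) (Ω : ℝ → Set Space) (f : ℝ → Space → ℝ) : Prop :=
  (∀ t ∈ Icc 0 T, ContDiffOn ℝ ∞ (f t) (Ω t)) ∧
    ∃ A, ∀ t ∈ Icc 0 T, ∀ x ∈ Ω t, |f t x| ≤ A ∧ (∀ i, |pd i (f t) x| ≤ A) ∧
      ∀ i j, |pd i (pd j (f t)) x| ≤ A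

section UnifC2

variable {T : ℝ} {Ω : ℝ → Set Space} {f g : ℝ → Space → ℝ}

theorem pd_congr_on {Ω : Set Space} {f g : Space → ℝ} (hΩ : IsOpen Ω) (h : ∀ x ∈ Ω, f x = g x)
    {x : Space} (hx : x ∈ Ω) (i : Fin 3) : pd i f x = pd i g x :=
  pd_congr i (by filter_upwards [hΩ.mem_nhds hx] with y hy using h y hy)

/-- The time slices of a function that is smooth up to the boundary extend to all of space with
uniformly bounded derivatives. -/
theorem SmoothUpToBoundary.exists_extension
    (hf : SmoothUpToBoundary (movingDomain T Ω) f) : ∃ A, ∀ t ∈ Icc 0 T, ∃ G : Space → ℝ,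
      ContDiff ℝ ∞ G ∧ (∀ x ∈ Ω t, f t x = G x) ∧ (∀ x, |G x| ≤ A) ∧ (∀ x i, |pd i G x| ≤ A) ∧
      (∀ x i j, |pd i (pd j G) x| ≤ A) ∧
      ∀ x y, ‖fderiv ℝ G x - fderiv ℝ G y‖ ≤ A * ‖x - y‖ := by
  obtain ⟨F, hF, hb, he⟩ := hf
  obtain ⟨A0, h0⟩ := hb 0
  obtain ⟨A1, h1⟩ := hb 1
  obtain ⟨A2, h2⟩ := hb 2
  simp only [norm_iteratedFDeriv_zero] at h0
  simp only [norm_iteratedFDeriv_one] at h1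
  have h2' : ∀ p, ‖fderiv ℝ (fderiv ℝ F) p‖ ≤ A2 := fun p => by
    have := h2 p
    rwa [← norm_iteratedFDeriv_fderiv, norm_iteratedFDeriv_one] at this
  have hF1 : ContDiff ℝ ∞ (fderiv ℝ F) := hF.fderiv_right (m := ∞) le_rfl
  have hA0 := (norm_nonneg _).trans (h0 0)
  have hA1 := (norm_nonneg _).trans (h1 0)
  have hA2 := (norm_nonneg (fderiv ℝ (fderiv ℝ F) 0)).trans (h2' 0)
  refine ⟨A0 + A1 + A2, fun t ht => ?_⟩
  let J : Space →L[ℝ] ℝ × Space := ContinuousLinearMap.inr ℝ ℝ Space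
  have hJ : ‖J‖ ≤ 1 := ContinuousLinearMap.norm_inr_le_one ℝ ℝ Space
  have hι : ∀ x : Space, HasFDerivAt (fun x : Space => (t, x)) J x := fun x =>
    hasFDerivAt_prodMk_right t x
  have hιs : ContDiff ℝ ∞ (fun x : Space => (t, x)) := contDiff_prodMk_right t
  have hfd : ∀ x : Space, fderiv ℝ (fun x => F (t, x)) x = (fderiv ℝ F (t, x)).comp J := fun x =>
    (((hF.differentiable (by simp)) (t, x)).hasFDerivAt.comp x (hι x)).fderiv
  have hJe : ∀ i, ‖J (EuclideanSpace.single i 1)‖ ≤ 1 := fun i => by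
    refine (J.le_opNorm _).trans ?_
    simpa using hJ
  have hpd : ∀ i x, pd i (fun x => F (t, x)) x = fderiv ℝ F (t, x) (J (EuclideanSpace.single i 1)) :=
    fun i x => by rw [pd, hfd]; rfl
  refine ⟨fun x => F (t, x), hF.comp hιs, fun x hx => he (t, x) ⟨ht, hx⟩, fun x => ?_,
    fun x i => ?_, fun x i j => ?_, fun x y => ?_⟩
  · exact (h0 (t, x)).trans (by linarith)
  · rw [hpd]
    have := (fderiv ℝ F (t, x)).le_of_opNorm_le_of_le (h1 (t, x)) (hJe i)
    rw [Real.norm_eq_abs] at this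
    linarith
  · have e : pd i (pd j (fun x => F (t, x))) x = fderiv ℝ (fderiv ℝ F) (t, x)
        (J (EuclideanSpace.single i 1)) (J (EuclideanSpace.single j 1)) := by
      rw [show pd j (fun x => F (t, x)) =
        fun x => fderiv ℝ F (t, x) (J (EuclideanSpace.single j 1)) from funext (hpd j)]
      have hd : HasFDerivAt (fun x : Space => fderiv ℝ F (t, x))
          ((fderiv ℝ (fderiv ℝ F) (t, x)).comp J) x :=
        ((hF1.differentiable (by simp)) (t, x)).hasFDerivAt.comp x (hι x)
      have := hd.clm_apply (hasFDerivAt_const (J (EuclideanSpace.single j (1 : ℝ))) x)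
      rw [pd, this.fderiv]
      simp
    rw [e]
    have h3 := (fderiv ℝ (fderiv ℝ F) (t, x)).le_of_opNorm_le_of_le (h2' (t, x)) (hJe i)
    have := ContinuousLinearMap.le_of_opNorm_le_of_le _ h3 (hJe j)
    rw [Real.norm_eq_abs] at this
    linarith
  · rw [hfd, hfd, ← ContinuousLinearMap.sub_comp]
    have h3 := Convex.norm_image_sub_le_of_norm_fderiv_le (𝕜 := ℝ) (f := fderiv ℝ F) (s := univ)
      (fun p _ => (hF1.differentiable (by simp)) p) (fun p _ => h2' p) convex_univ
      (mem_univ (t, y)) (mem_univ (t, x))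
    have h4 : ‖((t, x) : ℝ × Space) - (t, y)‖ = ‖x - y‖ := by
      simp [Prod.norm_def]
    rw [h4] at h3
    refine (ContinuousLinearMap.opNorm_comp_le _ _).trans
      ((mul_le_of_le_one_right (norm_nonneg _) hJ).trans (h3.trans ?_))
    exact mul_le_mul_of_nonneg_right (by linarith) (norm_nonneg _)

theorem SmoothUpToBoundary.unifC2 (hΩ : ∀ t ∈ Icc 0 T, IsOpen (Ω t))
    (hf : SmoothUpToBoundary (movingDomain T Ω) f) : UnifC2 T Ω f := by
  obtain ⟨A, hA⟩ := hf.exists_extension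
  refine ⟨fun t ht => ?_, A, fun t ht x hx => ?_⟩
  · obtain ⟨G, hG, he, -⟩ := hA t ht
    exact hG.contDiffOn.congr he
  · obtain ⟨G, hG, he, h0, h1, h2, -⟩ := hA t ht
    have e1 : ∀ i, ∀ y ∈ Ω t, pd i (f t) y = pd i G y := fun i y hy =>
      pd_congr_on (hΩ t ht) he hy i
    refine ⟨by rw [he x hx]; exact h0 x, fun i => by rw [e1 i x hx]; exact h1 x i, fun i j => ?_⟩
    rw [pd_congr_on (hΩ t ht) (e1 j) hx i]
    exact h2 x i j

theorem UnifC2.const (k : ℝ) : UnifC2 T Ω fun _ _ => k := by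
  have h0 : ∀ (i : Fin 3) (c : ℝ), pd i (fun _ : Space => c) = fun _ => 0 := fun i c => by
    funext x; simp [pd]
  refine ⟨fun t _ => contDiffOn_const, |k|, fun t _ x _ => ⟨le_rfl, fun i => ?_, fun i j => ?_⟩⟩
  · simp [h0]
  · simp [h0]

theorem UnifC2.add (hΩ : ∀ t ∈ Icc 0 T, IsOpen (Ω t)) (hf : UnifC2 T Ω f) (hg : UnifC2 T Ω g) :
    UnifC2 T Ω fun t x => f t x + g t x := by
  obtain ⟨hfs, A, hA⟩ := hf
  obtain ⟨hgs, B, hB⟩ := hg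
  refine ⟨fun t ht => (hfs t ht).add (hgs t ht), A + B, fun t ht x hx => ?_⟩
  have h1 : ∀ i, ∀ y ∈ Ω t, pd i (fun x => f t x + g t x) y = pd i (f t) y + pd i (g t) y :=
    fun i y hy => pd_add i (diffAt_of_contDiffOn (hΩ t ht) (hfs t ht) hy)
      (diffAt_of_contDiffOn (hΩ t ht) (hgs t ht) hy)
  have h2 : ∀ i j, pd i (pd j fun x => f t x + g t x) x
      = pd i (pd j (f t)) x + pd i (pd j (g t)) x := fun i j => by
    rw [pd_congr_on (hΩ t ht) (h1 j) hx i]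
    exact pd_add i
      (diffAt_of_contDiffOn (hΩ t ht) (contDiffOn_pd (hΩ t ht) j (hfs t ht)) hx)
      (diffAt_of_contDiffOn (hΩ t ht) (contDiffOn_pd (hΩ t ht) j (hgs t ht)) hx)
  obtain ⟨a0, a1, a2⟩ := hA t ht x hx
  obtain ⟨b0, b1, b2⟩ := hB t ht x hx
  refine ⟨(abs_add_le _ _).trans (add_le_add a0 b0), fun i => ?_, fun i j => ?_⟩
  · rw [h1 i x hx]; exact (abs_add_le _ _).trans (add_le_add (a1 i) (b1 i))
  · rw [h2]; exact (abs_add_le _ _).trans (add_le_add (a2 i j) (b2 i j))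

theorem UnifC2.mul (hΩ : ∀ t ∈ Icc 0 T, IsOpen (Ω t)) (hf : UnifC2 T Ω f) (hg : UnifC2 T Ω g) :
    UnifC2 T Ω fun t x => f t x * g t x := by
  obtain ⟨hfs, A, hA⟩ := hf
  obtain ⟨hgs, B, hB⟩ := hg
  refine ⟨fun t ht => (hfs t ht).mul (hgs t ht), 4 * (A * B), fun t ht x hx => ?_⟩
  have d : ∀ {h : Space → ℝ}, ContDiffOn ℝ ∞ h (Ω t) → ∀ y ∈ Ω t, DifferentiableAt ℝ h y :=
    fun hh y hy => diffAt_of_contDiffOn (hΩ t ht) hh hy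
  have p : ∀ {h : Space → ℝ}, ContDiffOn ℝ ∞ h (Ω t) → ∀ j, ContDiffOn ℝ ∞ (pd j h) (Ω t) :=
    fun hh j => contDiffOn_pd (hΩ t ht) j hh
  have h1 : ∀ i, ∀ y ∈ Ω t, pd i (fun x => f t x * g t x) y
      = pd i (f t) y * g t y + f t y * pd i (g t) y :=
    fun i y hy => pd_mul i (d (hfs t ht) y hy) (d (hgs t ht) y hy)
  have h2 : ∀ i j, pd i (pd j fun x => f t x * g t x) x
      = pd i (pd j (f t)) x * g t x + pd j (f t) x * pd i (g t) x
        + (pd i (f t) x * pd j (g t) x + f t x * pd i (pd j (g t)) x) := fun i j => by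
    have d1 := d (hfs t ht) x hx
    have d2 := d (hgs t ht) x hx
    have d3 := d (p (hfs t ht) j) x hx
    have d4 := d (p (hgs t ht) j) x hx
    rw [pd_congr_on (hΩ t ht) (h1 j) hx i, pd_add i (d3.fun_mul d2) (d1.fun_mul d4),
      pd_mul i d3 d2, pd_mul i d1 d4]
  obtain ⟨a0, a1, a2⟩ := hA t ht x hx
  obtain ⟨b0, b1, b2⟩ := hB t ht x hx
  have hA0 : 0 ≤ A := (abs_nonneg _).trans a0
  have hB0 : 0 ≤ B := (abs_nonneg _).trans b0
  have hm : ∀ {a b : ℝ}, |a| ≤ A → |b| ≤ B → |a * b| ≤ A * B := fun ha hb => by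
    rw [abs_mul]; exact mul_le_mul ha hb (abs_nonneg _) hA0
  have hAB : 0 ≤ A * B := mul_nonneg hA0 hB0
  refine ⟨(hm a0 b0).trans (by linarith), fun i => ?_, fun i j => ?_⟩
  · rw [h1 i x hx]
    refine (abs_add_le _ _).trans ((add_le_add (hm (a1 i) b0) (hm a0 (b1 i))).trans (by linarith))
  · rw [h2]
    refine (abs_add_le _ _).trans ((add_le_add ((abs_add_le _ _).trans (add_le_add
      (hm (a2 i j) b0) (hm (a1 j) (b1 i)))) ((abs_add_le _ _).trans (add_le_add
      (hm (a1 i) (b1 j)) (hm a0 (b2 i j))))).trans (by linarith))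

theorem UnifC2.inv (hΩ : ∀ t ∈ Icc 0 T, IsOpen (Ω t)) (hf : UnifC2 T Ω f)
    (h1f : ∀ t ∈ Icc 0 T, ∀ x ∈ Ω t, 1 ≤ f t x) : UnifC2 T Ω fun t x => (f t x)⁻¹ := by
  obtain ⟨hfs, A, hA⟩ := hf
  have hne : ∀ t ∈ Icc 0 T, ∀ x ∈ Ω t, f t x ≠ 0 := fun t ht x hx =>
    (zero_lt_one.trans_le (h1f t ht x hx)).ne'
  refine ⟨fun t ht => (hfs t ht).inv (hne t ht), 1 + A + 2 * A ^ 2, fun t ht x hx => ?_⟩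
  have hs := hfs t ht
  have hi : ContDiffOn ℝ ∞ (fun x => (f t x)⁻¹) (Ω t) := hs.inv (hne t ht)
  have h1 : ∀ i, ∀ y ∈ Ω t, pd i (fun x => (f t x)⁻¹) y
      = (-1 * pd i (f t) y) * ((f t y)⁻¹ * (f t y)⁻¹) := fun i y hy => by
    rw [pd_comp (ψ := fun z => z⁻¹) i (differentiableAt_inv (hne t ht y hy))
      (diffAt_of_contDiffOn (hΩ t ht) hs hy), deriv_inv]
    have := hne t ht y hy
    field_simp
  have d1 := diffAt_of_contDiffOn (hΩ t ht) hi hx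
  have h2 : ∀ i j, pd i (pd j fun x => (f t x)⁻¹) x
      = -(pd i (pd j (f t)) x * ((f t x)⁻¹ * (f t x)⁻¹))
        + 2 * (pd j (f t) x * pd i (f t) x) * ((f t x)⁻¹ * (f t x)⁻¹ * (f t x)⁻¹) := fun i j => by
    have d2 := diffAt_of_contDiffOn (hΩ t ht) (contDiffOn_pd (hΩ t ht) j hs) hx
    rw [pd_congr_on (hΩ t ht) (h1 j) hx i, pd_mul i (d2.const_mul (-1)) (d1.fun_mul d1),
      pd_mul i d1 d1, h1 i x hx, pd_mul i (differentiableAt_const _) d2]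
    have : pd i (fun _ : Space => (-1 : ℝ)) x = 0 := by simp [pd]
    rw [this]
    ring
  obtain ⟨a0, a1, a2⟩ := hA t ht x hx
  have hA0 : 0 ≤ A := (abs_nonneg _).trans a0
  have hv : |(f t x)⁻¹| ≤ 1 := by
    rw [abs_inv]
    exact inv_le_one_of_one_le₀ ((h1f t ht x hx).trans (le_abs_self _))
  have hv2 : |(f t x)⁻¹ * (f t x)⁻¹| ≤ 1 := by
    rw [abs_mul]; exact mul_le_one₀ hv (abs_nonneg _) hv
  have hv3 : |(f t x)⁻¹ * (f t x)⁻¹ * (f t x)⁻¹| ≤ 1 := by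
    rw [abs_mul]; exact mul_le_one₀ hv2 (abs_nonneg _) hv
  refine ⟨hv.trans (by nlinarith), fun i => ?_, fun i j => ?_⟩
  · rw [h1 i x hx, abs_mul, abs_mul, abs_neg, abs_one, one_mul]
    have := mul_le_mul (a1 i) hv2 (abs_nonneg _) hA0
    nlinarith
  · rw [h2]
    refine (abs_add_le _ _).trans ?_
    rw [abs_neg, abs_mul (pd i (pd j (f t)) x), abs_mul (2 * _), abs_mul 2, abs_two,
      abs_mul (pd j (f t) x)]
    have e1 := mul_le_mul (a2 i j) hv2 (abs_nonneg _) hA0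
    have e2 := mul_le_mul (mul_le_mul (a1 j) (a1 i) (abs_nonneg _) hA0) hv3 (abs_nonneg _)
      (mul_nonneg hA0 hA0)
    nlinarith

theorem UnifC2.exists_bound (hf : UnifC2 T Ω f) : ∃ A, 0 ≤ A ∧ ∀ B, A ≤ B →
    ∀ t ∈ Icc 0 T, ∀ x ∈ Ω t, |f t x| ≤ B ∧ (∀ i, |pd i (f t) x| ≤ B) ∧
      ∀ i j, |pd i (pd j (f t)) x| ≤ B := by
  obtain ⟨-, A, hA⟩ := hf
  refine ⟨|A|, abs_nonneg _, fun B hB t ht x hx => ?_⟩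
  obtain ⟨a0, a1, a2⟩ := hA t ht x hx
  have := (le_abs_self A).trans hB
  exact ⟨a0.trans this, fun i => (a1 i).trans this, fun i j => (a2 i j).trans this⟩

end UnifC2

/-! ### The frame orthonormalising the acoustical metric -/

/-- The symmetric square root `S^{ij} = δ^{ij} - u^i u^j / (u^0 (1 + u^0))` of `H`. -/
def bgFrame (u : Space → Fin 4 → ℝ) (i j : Fin 3) (x : Space) : ℝ :=
  (if i = j then 1 else 0) + (-1) * (u x i.succ * u x j.succ) * ((u x 0)⁻¹ * (1 + u x 0)⁻¹)

theorem sq_time_eq {u : Fin 4 → ℝ} (hu : minkProd u u = -1) :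
    u 0 ^ 2 = 1 + (u 1 ^ 2 + u 2 ^ 2 + u 3 ^ 2) := by
  simp [minkProd, mink, Fin.sum_univ_four] at hu
  linarith

theorem one_le_time {u : Fin 4 → ℝ} (hu : minkProd u u = -1) (h0 : 0 < u 0) : 1 ≤ u 0 := by
  have := sq_time_eq hu
  nlinarith [sq_nonneg (u 1), sq_nonneg (u 2), sq_nonneg (u 3)]

/-- `∑_a S_{aj} S_{ak} = H_{jk}`. -/
theorem sum_bgFrame_mul {u : Space → Fin 4 → ℝ} {x : Space} (hu : minkProd (u x) (u x) = -1)
    (h0 : 0 < u x 0) (j k : Fin 3) :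
    ∑ a, bgFrame u a j x * bgFrame u a k x = Hmat (u x) j k := by
  have hq : u x 1 ^ 2 + u x 2 ^ 2 + u x 3 ^ 2 = u x 0 ^ 2 - 1 := by
    rw [sq_time_eq hu]; ring
  have h1 : 1 + u x 0 ≠ 0 := by positivity
  have hδ : ∀ f : Fin 3 → ℝ, ∑ a, (if a = j then (1 : ℝ) else 0) * f a = f j := fun f => by simp
  have hδ' : ∀ f : Fin 3 → ℝ, ∑ a, f a * (if a = k then (1 : ℝ) else 0) = f k := fun f => by simp
  set β := (u x 0)⁻¹ * (1 + u x 0)⁻¹ with hβ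
  have key : ∑ a, bgFrame u a j x * bgFrame u a k x = (if j = k then 1 else 0)
      - 2 * β * (u x j.succ * u x k.succ)
      + β ^ 2 * (u x 1 ^ 2 + u x 2 ^ 2 + u x 3 ^ 2) * (u x j.succ * u x k.succ) := by
    have e : ∀ a, bgFrame u a j x * bgFrame u a k x
        = (if a = j then (1 : ℝ) else 0) * (if a = k then 1 else 0)
          - β * ((if a = j then (1 : ℝ) else 0) * (u x a.succ * u x k.succ))
          - β * ((u x a.succ * u x j.succ) * (if a = k then (1 : ℝ) else 0))
          + β ^ 2 * (u x j.succ * u x k.succ) * u x a.succ ^ 2 := fun a => by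
      simp only [bgFrame, ← hβ]; ring
    simp only [e, Finset.sum_add_distrib, Finset.sum_sub_distrib, ← Finset.mul_sum, hδ, hδ']
    have : ∑ a : Fin 3, u x a.succ ^ 2 = u x 1 ^ 2 + u x 2 ^ 2 + u x 3 ^ 2 := by
      simp [Fin.sum_univ_three]
    rw [this]; ring
  rw [key, hq, Hmat, hβ]
  field_simp
  ring

/-- The inverse of the frame is `δ^{ij} + u^i u^j / (1 + u^0)`. -/
theorem bgFrame_inverse {u : Space → Fin 4 → ℝ} {x : Space} (hu : minkProd (u x) (u x) = -1)
    (h0 : 0 < u x 0) (ξ : Fin 3 → ℝ) (j : Fin 3) :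
    ξ j = ∑ a, ((if j = a then 1 else 0) + u x j.succ * u x a.succ * (1 + u x 0)⁻¹)
      * ∑ k, bgFrame u a k x * ξ k := by
  have hq : u x 1 ^ 2 + u x 2 ^ 2 + u x 3 ^ 2 = u x 0 ^ 2 - 1 := by
    rw [sq_time_eq hu]; ring
  have h1 : 1 + u x 0 ≠ 0 := by positivity
  set m := ∑ k : Fin 3, u x k.succ * ξ k with hm
  set β := (u x 0)⁻¹ * (1 + u x 0)⁻¹ with hβ
  have e1 : ∀ a, ∑ k, bgFrame u a k x * ξ k = ξ a - β * u x a.succ * m := fun a => by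
    have : ∀ k, bgFrame u a k x * ξ k = (if a = k then 1 else 0) * ξ k
        - β * u x a.succ * (u x k.succ * ξ k) := fun k => by
      simp only [bgFrame, ← hβ]; ring
    simp only [this, Finset.sum_sub_distrib, ← Finset.mul_sum]
    simp [hm]
  have e2 : ∑ a, ((if j = a then 1 else 0) + u x j.succ * u x a.succ * (1 + u x 0)⁻¹)
      * (ξ a - β * u x a.succ * m) = (ξ j - β * u x j.succ * m) + u x j.succ * (1 + u x 0)⁻¹ * m
        - u x j.succ * (1 + u x 0)⁻¹ * β * m * (u x 1 ^ 2 + u x 2 ^ 2 + u x 3 ^ 2) := by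
    have : ∀ a, ((if j = a then 1 else 0) + u x j.succ * u x a.succ * (1 + u x 0)⁻¹)
        * (ξ a - β * u x a.succ * m) = (if j = a then 1 else 0) * (ξ a - β * u x a.succ * m)
        + u x j.succ * (1 + u x 0)⁻¹ * (u x a.succ * ξ a)
        - u x j.succ * (1 + u x 0)⁻¹ * β * m * u x a.succ ^ 2 := fun a => by ring
    simp only [this, Finset.sum_add_distrib, Finset.sum_sub_distrib, ← Finset.mul_sum]
    have h3 : ∑ a : Fin 3, u x a.succ ^ 2 = u x 1 ^ 2 + u x 2 ^ 2 + u x 3 ^ 2 := by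
      simp [Fin.sum_univ_three]
    rw [h3, ← hm]
    simp
  simp only [e1]
  rw [e2, hq, hβ]
  field_simp
  ring

section Background

variable {T : ℝ} {Ω : ℝ → Set Space} {s r : ℝ → Space → ℝ} {u : ℝ → Space → Fin 4 → ℝ}

/-- Near the boundary `r` vanishes to first order, so that its gradient cannot vanish there. -/
theorem le_norm_fderiv_of_vacuum {O : Set Space} {ρ G : Space → ℝ} {c₁ c₂ A : ℝ} (hO : IsOpen O)
    (hc₁ : 0 < c₁) (hA : 0 ≤ A) (hG : ContDiff ℝ ∞ G) (hGe : ∀ x ∈ O, ρ x = G x)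
    (hpos : ∀ x ∈ O, 0 < ρ x)
    (hLip : ∀ x y, ‖fderiv ℝ G x - fderiv ℝ G y‖ ≤ A * ‖x - y‖)
    (h₁ : ∀ x ∈ O, c₁ * Metric.infDist x (frontier O) ≤ ρ x)
    (h₂ : ∀ x ∈ O, ρ x ≤ c₂ * Metric.infDist x (frontier O)) {x : Space} (hx : x ∈ O) :
    c₁ ≤ ‖fderiv ℝ G x‖ + A / c₁ * ρ x := by
  set d := Metric.infDist x (frontier O) with hd
  have hd0 : 0 < d := by
    refine lt_of_le_of_ne Metric.infDist_nonneg fun h => ?_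
    have := h₂ x hx
    rw [← hd, ← h, mul_zero] at this
    exact absurd (hpos x hx) (not_lt.2 this)
  have hne : (frontier O).Nonempty := by
    by_contra h
    rw [not_nonempty_iff_eq_empty] at h
    rw [hd, h, Metric.infDist_empty] at hd0
    exact lt_irrefl _ hd0
  have hc₂ : 0 < c₂ := by
    have := (hpos x hx).trans_le (h₂ x hx)
    exact pos_of_mul_pos_left this hd0.le
  obtain ⟨y, hy, hxy⟩ := isClosed_frontier.exists_infDist_eq_dist hne x
  have hball : Metric.ball x d ⊆ O := by
    have hfr : ∀ w ∈ Metric.ball x d, w ∈ closure O → w ∈ O := fun w hw hwc => by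
      by_contra hwO
      have := Metric.infDist_le_dist_of_mem (x := x) (show w ∈ frontier O from
        ⟨hwc, by rwa [hO.interior_eq]⟩)
      rw [Metric.mem_ball, dist_comm] at hw
      linarith
    refine fun z hz => hfr z hz ?_
    by_contra hzc
    obtain ⟨w, -, hwO, hwc⟩ := (convex_ball x d).isPreconnected O (closure O)ᶜ hO
      isClosed_closure.isOpen_compl
      (fun w hw => (em (w ∈ closure O)).imp (hfr w hw) id)
      ⟨x, Metric.mem_ball_self hd0, hx⟩ ⟨z, hz, hzc⟩
    exact hwc (subset_closure hwO)
  have hGy : G y = 0 := by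
    have hcl : y ∈ closure (Metric.ball x d) := by
      rw [closure_ball x hd0.ne', Metric.mem_closedBall, dist_comm, ← hxy]
    have hsub : closure (Metric.ball x d) ⊆ {z | 0 ≤ G z} ∩ {z | G z ≤ c₂ * dist z y} := by
      refine closure_minimal (fun z hz => ?_) ((isClosed_le continuous_const hG.continuous).inter
        (isClosed_le hG.continuous (by fun_prop)))
      have hzO := hball hz
      refine ⟨?_, ?_⟩
      · rw [mem_ofPred_eq, ← hGe z hzO]; exact (hpos z hzO).le
      · rw [mem_ofPred_eq, ← hGe z hzO]
        exact (h₂ z hzO).trans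
          (mul_le_mul_of_nonneg_left (Metric.infDist_le_dist_of_mem hy) hc₂.le)
    have h := hsub hcl
    have h2 : G y ≤ c₂ * dist y y := h.2
    rw [dist_self, mul_zero] at h2
    exact le_antisymm h2 h.1
  have hyd : ‖y - x‖ = d := by rw [← dist_eq_norm, dist_comm, ← hxy]
  have hT := Convex.norm_image_sub_le_of_norm_fderiv_le' (𝕜 := ℝ) (f := G) (φ := fderiv ℝ G x)
    (C := A * d) (s := Metric.closedBall x d) (x := x) (y := y)
    (fun z _ => (hG.differentiable (by simp)) z) (fun z hz => (hLip z x).trans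
      (mul_le_mul_of_nonneg_left (by rwa [Metric.mem_closedBall, dist_eq_norm] at hz) hA))
    (convex_closedBall x d) (Metric.mem_closedBall_self hd0.le)
    (by rw [Metric.mem_closedBall, dist_eq_norm, hyd])
  have h3 := (fderiv ℝ G x).le_opNorm (y - x)
  rw [hGy, zero_sub, hyd, Real.norm_eq_abs, ← hGe x hx] at hT
  rw [hyd, Real.norm_eq_abs] at h3
  have h4 := h₁ x hx
  rw [← hd] at h4
  have h5 : c₁ * d ≤ (‖fderiv ℝ G x‖ + A * d) * d := by
    have := (abs_le.1 hT).1
    have := (abs_le.1 h3).1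
    linarith
  have h6 : c₁ ≤ ‖fderiv ℝ G x‖ + A * d := le_of_mul_le_mul_right h5 hd0
  have h7 : A * d ≤ A / c₁ * ρ x := by
    rw [div_mul_eq_mul_div, le_div_iff₀ hc₁]
    nlinarith
  linarith

/-- `r` vanishes at the boundary: superlevel sets of the restriction of a continuous function are
closed because of the upper bound by the distance to the boundary. -/
theorem isClosed_superlevel_of_vacuum {O : Set Space} {ρ G : Space → ℝ} {c₂ δ : ℝ}
    (hO : IsOpen O) (hδ : 0 < δ) (hG : Continuous G) (hGe : ∀ x ∈ O, ρ x = G x)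
    (h₂ : ∀ x ∈ O, ρ x ≤ c₂ * Metric.infDist x (frontier O)) :
    IsClosed {x | x ∈ O ∧ δ ≤ ρ x} := by
  have e : {x | x ∈ O ∧ δ ≤ ρ x}
      = closure O ∩ ({x | δ ≤ c₂ * Metric.infDist x (frontier O)} ∩ {x | δ ≤ G x}) := by
    ext x
    constructor
    · rintro ⟨hx, hδx⟩
      exact ⟨subset_closure hx, hδx.trans (h₂ x hx), by rwa [mem_ofPred_eq, ← hGe x hx]⟩
    · rintro ⟨hx, hδx, hGx⟩
      have hxO : x ∈ O := by
        by_contra hn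
        have hf : x ∈ frontier O := ⟨hx, by rwa [hO.interior_eq]⟩
        rw [mem_ofPred_eq, Metric.infDist_zero_of_mem hf, mul_zero] at hδx
        linarith
      exact ⟨hxO, by rw [hGe x hxO]; exact hGx⟩
  rw [e]
  exact isClosed_closure.inter ((isClosed_le continuous_const
    (continuous_const.mul (Metric.continuous_infDist_pt _))).inter
    (isClosed_le continuous_const hG))

theorem norm_fderiv_le_sum_pd (G : Space → ℝ) (x : Space) : ‖fderiv ℝ G x‖ ≤ ∑ i, |pd i G x| := by
  refine ContinuousLinearMap.opNorm_le_bound _ (Finset.sum_nonneg fun i _ => abs_nonneg _)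
    fun v => ?_
  have e : v = ∑ i, v i • EuclideanSpace.single i (1 : ℝ) := by
    ext j; simp [Finset.sum_apply, Pi.single_apply]
  have e2 : fderiv ℝ G x v = ∑ i, v i * pd i G x := by
    conv_lhs => rw [e]
    simp [map_sum, pd]
  rw [e2, Finset.sum_mul]
  refine (norm_sum_le _ _).trans (Finset.sum_le_sum fun i _ => ?_)
  rw [norm_mul, mul_comm, Real.norm_eq_abs]
  exact mul_le_mul_of_nonneg_left (PiLp.norm_apply_le v i) (abs_nonneg _)

theorem VacuumBackground.unifC2_bgFrame (hB : VacuumBackground T Ω s r u) (a i : Fin 3) :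
    UnifC2 T Ω fun t x => bgFrame (u t) a i x := by
  have hΩ := hB.isOpen
  have hu := fun μ => (hB.smooth_u μ).unifC2 hΩ
  have h1 : ∀ t ∈ Icc 0 T, ∀ x ∈ Ω t, 1 ≤ u t x 0 := fun t ht x hx =>
    one_le_time (hB.unit_u t ht x hx) (hB.future_u t ht x hx)
  exact (UnifC2.const (if a = i then 1 else 0)).add hΩ
    (((UnifC2.const (-1)).mul hΩ ((hu _).mul hΩ (hu _))).mul hΩ
      (((hu 0).inv hΩ h1).mul hΩ (((UnifC2.const 1).add hΩ (hu 0)).inv hΩ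
        fun t ht x hx => by linarith [h1 t ht x hx])))

theorem VacuumBackground.unifC2_velocity (hB : VacuumBackground T Ω s r u) (i : Fin 3) :
    UnifC2 T Ω fun t x => u t x i.succ * (u t x 0)⁻¹ :=
  ((hB.smooth_u _).unifC2 hB.isOpen).mul hB.isOpen
    (((hB.smooth_u 0).unifC2 hB.isOpen).inv hB.isOpen fun t ht x hx =>
      one_le_time (hB.unit_u t ht x hx) (hB.future_u t ht x hx))

theorem Gam_le {γ σ A : ℝ} (hγ : 1 < γ) (h : |σ| ≤ A) : Gam γ σ ≤ Gam γ (-A) := by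
  have h1 : 0 < γ - 1 := by linarith
  have h2 : 0 < γ := by linarith
  have h3 : -A ≤ σ := (abs_le.1 h).1
  unfold Gam
  refine div_le_div_of_nonneg_left (by positivity) (by positivity) ?_
  gcongr

theorem Gam_pos {γ σ : ℝ} (hγ : 1 < γ) : 0 < Gam γ σ := by
  have h1 : 0 < γ - 1 := by linarith
  have h2 : 0 < γ := by linarith
  unfold Gam
  positivity

/-- On every time slice the background provides a `VacuumFrame`, with a constant independent of
time. -/
theorem VacuumBackground.exists_vacuumFrame (hB : VacuumBackground T Ω s r u) {γ : ℝ}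
    (hγ : 1 < γ) : ∃ M, ∀ t ∈ Icc 0 T, VacuumFrame M (Ω t) (r t) (bgFrame (u t)) ∧
      (∀ x ∈ Ω t, (Gam γ (s t x) + r t x) / (γ - 1) ≤ M) ∧
      ∀ x ∈ Ω t, ∀ k : Fin 3, |u t x k.succ * (u t x 0)⁻¹| ≤ M ∧
        (∀ i, |pd i (fun x => u t x k.succ * (u t x 0)⁻¹) x| ≤ M) ∧
        ∀ i j, |pd i (pd j fun x => u t x k.succ * (u t x 0)⁻¹) x| ≤ M := by
  have hΩ := hB.isOpen
  have hγ0 : 0 < γ - 1 := by linarith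
  have h1 : ∀ t ∈ Icc 0 T, ∀ x ∈ Ω t, 1 ≤ u t x 0 := fun t ht x hx =>
    one_le_time (hB.unit_u t ht x hx) (hB.future_u t ht x hx)
  obtain ⟨c₁, c₂, hc₁, hc₂, hvac⟩ := hB.vacuum
  obtain ⟨A, hA⟩ := hB.smooth_r.exists_extension
  obtain ⟨Mr, hMr, hr⟩ := (hB.smooth_r.unifC2 hΩ).exists_bound
  obtain ⟨Ms, hMs, hs⟩ := (hB.smooth_s.unifC2 hΩ).exists_bound
  choose MS hMS hS using fun a i => (hB.unifC2_bgFrame a i).exists_bound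
  choose MV hMV hV using fun i => (hB.unifC2_velocity i).exists_bound
  choose Mu hMu hu using fun μ => ((hB.smooth_u μ).unifC2 hΩ).exists_bound
  -- a bound for the entries of the inverse frame
  set K := 1 + ∑ i : Fin 3, ∑ j : Fin 3, Mu i.succ * Mu j.succ with hK
  have hK0 : 0 ≤ K := add_nonneg zero_le_one (Finset.sum_nonneg fun i _ =>
    Finset.sum_nonneg fun j _ => mul_nonneg (hMu _) (hMu _))
  set K' := 3 * K with hK'
  set Mn := 9 * K' ^ 2 / c₁ ^ 2 + 2 * (|A| / c₁) / c₁ with hMn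
  have hMn0 : 0 ≤ Mn := by positivity
  set M := 1 + Mr + (∑ a, ∑ i, MS a i) + (∑ i, MV i) + K + Mn
    + (Gam γ (-Ms) + Mr) / (γ - 1) with hM
  have s1 : 0 ≤ ∑ a, ∑ i, MS a i :=
    Finset.sum_nonneg fun a _ => Finset.sum_nonneg fun i _ => hMS a i
  have s2 : 0 ≤ ∑ i, MV i := Finset.sum_nonneg fun i _ => hMV i
  have s3 : 0 ≤ (Gam γ (-Ms) + Mr) / (γ - 1) :=
    div_nonneg (add_nonneg (Gam_pos hγ).le hMr) hγ0.le
  have b1 : Mr ≤ M := by linarith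
  have b2 : ∀ a i, MS a i ≤ M := fun a i => by
    have := Finset.single_le_sum (f := fun i => MS a i) (fun i _ => hMS a i) (Finset.mem_univ i)
    have := Finset.single_le_sum (f := fun a => ∑ i, MS a i)
      (fun a _ => Finset.sum_nonneg fun i _ => hMS a i) (Finset.mem_univ a)
    linarith
  have b3 : ∀ i, MV i ≤ M := fun i => by
    have := Finset.single_le_sum (f := MV) (fun i _ => hMV i) (Finset.mem_univ i)
    linarith
  have b4 : K ≤ M := by linarith
  have b5 : Mn ≤ M := by linarith
  have b6 : (Gam γ (-Ms) + Mr) / (γ - 1) ≤ M := by linarith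
  have b7 : 1 ≤ M := by linarith
  clear_value M
  refine ⟨M, fun t ht => ⟨?_, fun x hx => ?_, fun x hx k => hV k M (b3 k) t ht x hx⟩⟩
  · have hcoer : ∀ x ∈ Ω t, ∀ (ξ : Fin 3 → ℝ) (j : Fin 3),
        |ξ j| ≤ K * ∑ a, |∑ k, bgFrame (u t) a k x * ξ k| := by
      intro x hx ξ j
      have hu' : ∀ i : Fin 3, |u t x i.succ| ≤ Mu i.succ := fun i =>
        (hu i.succ _ le_rfl t ht x hx).1
      rw [bgFrame_inverse (hB.unit_u t ht x hx) (hB.future_u t ht x hx) ξ j, Finset.mul_sum]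
      refine (Finset.abs_sum_le_sum_abs _ _).trans (Finset.sum_le_sum fun a _ => ?_)
      rw [abs_mul]
      refine mul_le_mul_of_nonneg_right ?_ (abs_nonneg _)
      refine (abs_add_le _ _).trans (add_le_add ?_ ?_)
      · split_ifs <;> simp
      · have hinv : |(1 + u t x 0)⁻¹| ≤ 1 := by
          have := h1 t ht x hx
          rw [abs_inv]
          exact inv_le_one_of_one_le₀ (by rw [abs_of_pos] <;> linarith)
        have e1 : Mu j.succ * Mu a.succ ≤ ∑ i : Fin 3, ∑ j : Fin 3, Mu i.succ * Mu j.succ := by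
          refine (Finset.single_le_sum (f := fun a : Fin 3 => Mu j.succ * Mu a.succ)
            (fun a _ => mul_nonneg (hMu _) (hMu _)) (Finset.mem_univ a)).trans
            (Finset.single_le_sum (f := fun i : Fin 3 => ∑ j : Fin 3, Mu i.succ * Mu j.succ)
            (fun i _ => Finset.sum_nonneg fun j _ => mul_nonneg (hMu _) (hMu _))
            (Finset.mem_univ j))
        refine le_trans ?_ e1
        rw [abs_mul, abs_mul]
        exact (mul_le_of_le_one_right (by positivity) hinv).trans
          (mul_le_mul (hu' j) (hu' a) (abs_nonneg _) (hMu _))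
    refine
      { one_le := b7
        isOpen := hΩ t ht
        smooth_r := ((hB.smooth_r.unifC2 hΩ).1 t ht)
        smooth_S := fun a i => (hB.unifC2_bgFrame a i).1 t ht
        pos := hB.pos_r t ht
        r_le := fun x hx => (le_abs_self _).trans (hr M b1 t ht x hx).1
        pd_r_le := fun x hx => (hr M b1 t ht x hx).2.1
        pd_pd_r_le := fun x hx => (hr M b1 t ht x hx).2.2
        S_le := fun x hx a i => (hS a i M (b2 a i) t ht x hx).1
        pd_S_le := fun x hx j a i => (hS a i M (b2 a i) t ht x hx).2.1 j
        coercive := fun x hx ξ j => (hcoer x hx ξ j).trans (mul_le_mul_of_nonneg_right b4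
          (Finset.sum_nonneg fun a _ => abs_nonneg _))
        nondegenerate := fun x hx => ?_
        isClosed_superlevel := fun δ hδ => ?_ }
    · obtain ⟨G, hG, he, -, -, -, hLip⟩ := hA t ht
      have hm := le_norm_fderiv_of_vacuum (A := |A|) (hΩ t ht) hc₁ (abs_nonneg A) hG he
        (hB.pos_r t ht) (fun x y => (hLip x y).trans (mul_le_mul_of_nonneg_right (le_abs_self A)
          (norm_nonneg _))) (fun x hx => (hvac t ht x hx).1) (fun x hx => (hvac t ht x hx).2) hx
      set N := ∑ a, |∑ j, bgFrame (u t) a j x * pd j (r t) x| with hN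
      set E := ∑ a, (∑ j, bgFrame (u t) a j x * pd j (r t) x) ^ 2 with hE
      have hNE : N ^ 2 ≤ 3 * E :=
        n1_sq_le (w := fun a => ∑ j, bgFrame (u t) a j x * pd j (r t) x)
      have hgr : ‖fderiv ℝ G x‖ ≤ K' * N := by
        refine (norm_fderiv_le_sum_pd G x).trans ?_
        refine (Finset.sum_le_sum fun i _ => ?_).trans (le_of_eq (?_ : ∑ i : Fin 3, K * N = _))
        · rw [← pd_congr_on (hΩ t ht) he hx i]
          exact hcoer x hx (fun j => pd j (r t) x) i
        · simp [hK']; ring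
      have hrx := hB.pos_r t ht x hx
      have hE0 : 0 ≤ E := Finset.sum_nonneg fun a _ => sq_nonneg _
      have h3 : c₁ ≤ K' * N + |A| / c₁ * r t x := by linarith
      -- absorb the linear term in `N`
      have h4 : 1 ≤ 9 * K' ^ 2 / c₁ ^ 2 * E + 2 * (|A| / c₁) / c₁ * r t x := by
        have h5 : K' * N ≤ c₁ / 2 + K' ^ 2 * N ^ 2 / (2 * c₁) := by
          have : c₁ / 2 + K' ^ 2 * N ^ 2 / (2 * c₁) - K' * N = (c₁ - K' * N) ^ 2 / (2 * c₁) := by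
            field_simp; ring
          have : 0 ≤ (c₁ - K' * N) ^ 2 / (2 * c₁) := by positivity
          linarith
        have h6 : K' ^ 2 * N ^ 2 / (2 * c₁) ≤ K' ^ 2 * (3 * E) / (2 * c₁) := by gcongr
        have h7 : c₁ / 2 ≤ K' ^ 2 * (3 * E) / (2 * c₁) + |A| / c₁ * r t x := by linarith
        have h8 := mul_le_mul_of_nonneg_left h7 (by positivity : 0 ≤ 2 / c₁)
        have e1 : 2 / c₁ * (c₁ / 2) = 1 := by field_simp
        have e2 : 2 / c₁ * (K' ^ 2 * (3 * E) / (2 * c₁) + |A| / c₁ * r t x)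
            = 3 * K' ^ 2 / c₁ ^ 2 * E + 2 * (|A| / c₁) / c₁ * r t x := by field_simp
        rw [e1, e2] at h8
        have h9 : 3 * K' ^ 2 / c₁ ^ 2 * E ≤ 9 * K' ^ 2 / c₁ ^ 2 * E := by
          gcongr; norm_num
        linarith
      have h10 : 9 * K' ^ 2 / c₁ ^ 2 * E ≤ Mn * E :=
        mul_le_mul_of_nonneg_right (le_add_of_nonneg_right (by positivity)) hE0
      have h11 : 2 * (|A| / c₁) / c₁ * r t x ≤ Mn * r t x :=
        mul_le_mul_of_nonneg_right (le_add_of_nonneg_left (by positivity)) hrx.le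
      have h12 := mul_le_mul_of_nonneg_right b5 (add_nonneg hE0 hrx.le)
      linarith
    · obtain ⟨G, hG, he, -⟩ := hA t ht
      exact isClosed_superlevel_of_vacuum (hΩ t ht) hδ hG.continuous he
        fun x hx => (hvac t ht x hx).2
  · refine le_trans ?_ b6
    have h2 := Gam_le hγ (hs Ms le_rfl t ht x hx).1
    have h3 := (le_abs_self _).trans (hr Mr le_rfl t ht x hx).1
    gcongr

end Background

end VacuumEuler

namespace VacuumEuler

open Filter Topology

/-! ### Weak derivatives as weak gradients -/

theorem multiPd_e (i : Fin 3) (φ : Space → ℝ) : multiPd (e i) φ = pd i φ := by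
  fin_cases i <;> simp [multiPd, e]

theorem multiPd_e_add_e {φ : Space → ℝ} (hφ : ContDiff ℝ ∞ φ) (i j : Fin 3) :
    multiPd (e i + e j) φ = pd i (pd j φ) := by
  fin_cases i <;> fin_cases j <;> simp [multiPd, e] <;> exact pd_comm _ _ hφ

theorem sum_e (i : Fin 3) : ∑ k, e i k = 1 := by simp [e]

theorem sum_e_add_e (i j : Fin 3) : ∑ k, (e i + e j) k = 2 := by
  simp [Finset.sum_add_distrib, sum_e]

/-- The multi-indices of order at most two. -/
theorem eq_of_mem_multiIndices_two {α : Fin 3 → ℕ} (h : α ∈ multiIndices 2) :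
    α = 0 ∨ (∃ i, α = e i) ∨ ∃ i j, α = e i + e j := by
  revert α
  decide

theorem mem_multiIndices_two :
    (0 : Fin 3 → ℕ) ∈ multiIndices 2 ∧ (∀ i, e i ∈ multiIndices 2) ∧
      ∀ i j, e i + e j ∈ multiIndices 2 := by
  decide

theorem multiIndices_zero : multiIndices 0 = {0} := by decide

section Weak

variable {Ω : Set Space} {α : Fin 3 → ℕ} {f f₂ g h : Space → ℝ} {g' h' : Fin 3 → Space → ℝ}

theorem IsWeakDeriv.ae_unique (hΩ : IsOpen Ω) (h₁ : IsWeakDeriv Ω α f g)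
    (h₂ : IsWeakDeriv Ω α f h) : g =ᵐ[volume.restrict Ω] h := by
  have hs : ∀ᵐ x ∂volume, x ∈ Ω → (fun x => g x - h x) x = 0 := by
    refine hΩ.ae_eq_zero_of_integral_contDiff_smul_eq_zero (h₁.2.1.sub h₂.2.1)
      fun φ hφ hc hs => ?_
    have ht : IsTestFunction Ω φ := ⟨hφ, hc, hs⟩
    have hi : ∀ {g : Space → ℝ}, LocallyIntegrableOn g Ω →
        IntegrableOn (fun x => g x * φ x) Ω := fun {g} hg => by
      have h3 : IntegrableOn (fun x => g x * φ x) (tsupport φ) := by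
        have := ((locallyIntegrableOn_iff hΩ.isLocallyClosed).1 hg) _ hs hc
        exact this.mul_continuousOn hφ.continuous.continuousOn hc
      exact h3.of_forall_sdiff_eq_zero hΩ.measurableSet
        fun x hx => by simp [image_eq_zero_of_notMem_tsupport hx.2]
    have e1 := (h₁.2.2 φ ht).symm.trans (h₂.2.2 φ ht)
    have e2 : ∫ x in Ω, g x * φ x = ∫ x in Ω, h x * φ x :=
      mul_left_cancel₀ (pow_ne_zero _ (by norm_num)) e1
    rw [← setIntegral_eq_integral_of_forall_compl_eq_zero (s := Ω) fun x hx => by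
      simp [image_eq_zero_of_notMem_tsupport fun h0 => hx (hs h0)]]
    have e3 : ∀ x, φ x • (g x - h x) = g x * φ x - h x * φ x := fun x => by
      simp only [smul_eq_mul]; ring
    simp only [e3]
    rw [integral_sub (hi h₁.2.1) (hi h₂.2.1), e2, sub_self]
  rw [EventuallyEq, ae_restrict_iff' hΩ.measurableSet]
  filter_upwards [hs] with x hx hxΩ
  exact sub_eq_zero.1 (hx hxΩ)

theorem isWeakDeriv_weakDeriv (h : ∃ g, IsWeakDeriv Ω α f g) :
    IsWeakDeriv Ω α f (weakDeriv Ω α f) := by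
  rw [weakDeriv, dif_pos h]; exact h.choose_spec

theorem IsWeakDeriv.weakDeriv_ae_eq (hΩ : IsOpen Ω) (h : IsWeakDeriv Ω α f g) :
    weakDeriv Ω α f =ᵐ[volume.restrict Ω] g :=
  (isWeakDeriv_weakDeriv ⟨g, h⟩).ae_unique hΩ h

theorem LocallyIntegrableOn.congr_ae_restrict (hΩ : IsOpen Ω) (hf : LocallyIntegrableOn f Ω)
    (h : f =ᵐ[volume.restrict Ω] f₂) : LocallyIntegrableOn f₂ Ω := by
  rw [locallyIntegrableOn_iff hΩ.isLocallyClosed] at hf ⊢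
  exact fun K hK hKc => (hf K hK hKc).congr (ae_restrict_of_ae_restrict_of_subset hK h)

theorem isWeakDeriv_congr (hΩ : IsOpen Ω) (h : f =ᵐ[volume.restrict Ω] f₂) :
    IsWeakDeriv Ω α f g ↔ IsWeakDeriv Ω α f₂ g := by
  have key : ∀ {f f₂ : Space → ℝ}, f =ᵐ[volume.restrict Ω] f₂ → IsWeakDeriv Ω α f g →
      IsWeakDeriv Ω α f₂ g := fun h hw =>
    ⟨LocallyIntegrableOn.congr_ae_restrict hΩ hw.1 h, hw.2.1, fun φ hφ => by
      rw [← hw.2.2 φ hφ]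
      exact integral_congr_ae (by filter_upwards [h] with x hx; rw [hx])⟩
  exact ⟨key h, key h.symm⟩

theorem weakDeriv_congr (hΩ : IsOpen Ω) (h : f =ᵐ[volume.restrict Ω] f₂) :
    weakDeriv Ω α f = weakDeriv Ω α f₂ := by
  have : (fun g => IsWeakDeriv Ω α f g) = fun g => IsWeakDeriv Ω α f₂ g :=
    funext fun g => propext (isWeakDeriv_congr hΩ h)
  classical
  unfold weakDeriv
  change (if h : ∃ g, (fun g => IsWeakDeriv Ω α f g) g then
    Exists.choose (p := fun g => IsWeakDeriv Ω α f g) h else 0) = _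
  simp only [this]

theorem isWeakDeriv_zero (hf : LocallyIntegrableOn f Ω) : IsWeakDeriv Ω 0 f f :=
  ⟨hf, hf, fun φ _ => by simp [multiPd]⟩

theorem L2loc.locallyIntegrableOn (hΩ : IsOpen Ω) (hf : L2loc Ω f) : LocallyIntegrableOn f Ω :=
  (locallyIntegrableOn_iff hΩ.isLocallyClosed).2 fun K hK hKc => by
    have : IsFiniteMeasure (volume.restrict K) := ⟨by simpa using hKc.measure_lt_top⟩
    exact (hf K hK hKc).integrable (by norm_num)

theorem HasWD.isWeakDeriv (hΩ : IsOpen Ω) (hg : HasWD Ω g g') (j : Fin 3) :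
    IsWeakDeriv Ω (e j) g (g' j) :=
  ⟨hg.l2.locallyIntegrableOn hΩ, (hg.l2' j).locallyIntegrableOn hΩ, fun φ hφ => by
    rw [multiPd_e, sum_e, hg.ibp j φ hφ]; ring⟩

/-- The iterated weak gradient is the weak derivative of second order. -/
theorem HasWD.isWeakDeriv_two (hΩ : IsOpen Ω) (hg : HasWD Ω g g') {j : Fin 3}
    (hh : HasWD Ω (g' j) h') (i : Fin 3) : IsWeakDeriv Ω (e i + e j) g (h' i) :=
  ⟨hg.l2.locallyIntegrableOn hΩ, (hh.l2' i).locallyIntegrableOn hΩ, fun φ hφ => by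
    rw [multiPd_e_add_e hφ.1, sum_e_add_e, pd_comm i j hφ.1, hg.ibp j _ (hφ.pd i),
      hh.ibp i φ hφ]; ring⟩

theorem HasWD.of_isWeakDeriv (hg : L2loc Ω g) (hg' : ∀ j, L2loc Ω (g' j))
    (h : ∀ j, IsWeakDeriv Ω (e j) g (g' j)) : HasWD Ω g g' where
  l2 := hg
  l2' := hg'
  ibp j φ hφ := by
    have := (h j).2.2 φ hφ
    rw [multiPd_e, sum_e] at this
    rw [this]; ring

/-- The second weak derivative `∂_i ∂_j f` is a weak derivative of the first weak derivative `∂_j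
f`. -/
theorem IsWeakDeriv.of_two {i j : Fin 3} (h₁ : IsWeakDeriv Ω (e j) f g)
    (h₂ : IsWeakDeriv Ω (e i + e j) f h) : IsWeakDeriv Ω (e i) g h :=
  ⟨h₁.2.1, h₂.2.1, fun φ hφ => by
    have e1 := h₂.2.2 φ hφ
    have e2 := h₁.2.2 _ (hφ.pd i)
    rw [multiPd_e_add_e hφ.1, sum_e_add_e, pd_comm i j hφ.1] at e1
    rw [multiPd_e, sum_e] at e2
    rw [multiPd_e, sum_e]
    linarith⟩

theorem HasWD.neg (hg : HasWD Ω g g') : HasWD Ω (fun x => -g x) (fun j x => -g' j x) where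
  l2 K hK hKc := (hg.l2 K hK hKc).neg
  l2' j K hK hKc := (hg.l2' j K hK hKc).neg
  ibp j φ hφ := by
    simp only [neg_mul, integral_neg]
    rw [hg.ibp j φ hφ]

theorem HasWD.sub (hΩ : IsOpen Ω) (hg : HasWD Ω g g') (hh : HasWD Ω h h') :
    HasWD Ω (fun x => g x - h x) (fun j x => g' j x - h' j x) := by
  simpa only [sub_eq_add_neg] using hg.add hΩ hh.neg

end Weak

/-! ### Weighted norms as lower integrals -/

/-- The squared weighted norm `∫_Ω r^μ f²`, possibly infinite. -/
def wInt (Ω : Set Space) (r : Space → ℝ) (μ : ℝ) (f : Space → ℝ) : ℝ≥0∞ :=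
  ∫⁻ x in Ω, ENNReal.ofReal (r x ^ μ * f x ^ 2)

section Norms

variable {M μ σ : ℝ} {Ω : Set Space} {r : Space → ℝ} {S : Fin 3 → Fin 3 → Space → ℝ}
  {f g : Space → ℝ}

theorem rpow_half_sq (a : ℝ≥0∞) : (a ^ (1 / 2 : ℝ)) ^ 2 = a := by
  rw [← ENNReal.rpow_natCast, ← ENNReal.rpow_mul]; norm_num

theorem weightedL2Norm_sq : weightedL2Norm Ω (fun x => r x ^ μ) f ^ 2 = wInt Ω r μ f := by
  rw [weightedL2Norm, rpow_half_sq]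
  simp only [sq_abs, wInt]

theorem eLpNorm_rpow_mul_sq (F : VacuumFrame M Ω r S) (σ : ℝ) (f : Space → ℝ) :
    eLpNorm (fun x => r x ^ σ * f x) 2 (volume.restrict Ω) ^ 2 = wInt Ω r (2 * σ) f := by
  rw [eLpNorm_eq_lintegral_rpow_enorm_toReal (by norm_num) (by norm_num)]
  simp only [ENNReal.toReal_ofNat]
  rw [rpow_half_sq, wInt]
  refine setLIntegral_congr_fun F.isOpen.measurableSet fun x hx => ?_
  have hr := F.pos x hx
  have e : r x ^ (2 * σ) * f x ^ 2 = |r x ^ σ * f x| ^ 2 := by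
    rw [sq_abs, mul_pow, ← Real.rpow_natCast (r x ^ σ), ← Real.rpow_mul hr.le]
    norm_num [mul_comm]
  rw [e, ENNReal.ofReal_pow (abs_nonneg _), ← Real.norm_eq_abs, ofReal_norm]
  norm_num

theorem wInt_congr (h : f =ᵐ[volume.restrict Ω] g) : wInt Ω r μ f = wInt Ω r μ g :=
  lintegral_congr_ae (by filter_upwards [h] with x hx; rw [hx])

theorem WL.wInt_eq (F : VacuumFrame M Ω r S) (hf : WL Ω r μ f) :
    wInt Ω r μ f = ENNReal.ofReal (∫ x in Ω, r x ^ μ * f x ^ 2) := by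
  refine (ofReal_integral_eq_lintegral_ofReal hf.2 ?_).symm
  filter_upwards [ae_restrict_mem F.isOpen.measurableSet] with x hx
  exact mul_nonneg (Real.rpow_nonneg (F.pos x hx).le _) (sq_nonneg _)

theorem WL.of_wInt_ne_top (F : VacuumFrame M Ω r S)
    (hf : AEStronglyMeasurable f (volume.restrict Ω)) (h : wInt Ω r μ f ≠ ⊤) : WL Ω r μ f := by
  have hm : AEStronglyMeasurable (fun x => r x ^ μ * f x ^ 2) (volume.restrict Ω) :=
    (F.aesm (F.contDiffOn_rpow μ).continuousOn).mul (hf.pow 2)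
  refine ⟨hf, (lintegral_ofReal_ne_top_iff_integrable hm ?_).1 h⟩
  filter_upwards [ae_restrict_mem F.isOpen.measurableSet] with x hx
  exact mul_nonneg (Real.rpow_nonneg (F.pos x hx).le _) (sq_nonneg _)

theorem wInt_le_of_sq_le (F : VacuumFrame M Ω r S) {K : ℝ} (hK : 0 ≤ K) {E : Space → ℝ}
    (h : ∀ᵐ x ∂(volume.restrict Ω), f x ^ 2 ≤ K * E x) :
    wInt Ω r μ f ≤ ENNReal.ofReal K * ∫⁻ x in Ω, ENNReal.ofReal (r x ^ μ * E x) := by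
  rw [← lintegral_const_mul' _ _ ENNReal.ofReal_ne_top]
  refine lintegral_mono_ae ?_
  filter_upwards [h, ae_restrict_mem F.isOpen.measurableSet] with x hx hxΩ
  rw [← ENNReal.ofReal_mul hK]
  refine ENNReal.ofReal_le_ofReal ?_
  have := mul_le_mul_of_nonneg_left hx (Real.rpow_nonneg (F.pos x hxΩ).le μ)
  linarith

/-- The zeroth order norm dominates the weighted `L²` norm. -/
theorem wInt_le_hNorm_zero_sq (F : VacuumFrame M Ω r S) (σ : ℝ) (f : Space → ℝ) :
    wInt Ω r (2 * σ) f ≤ hNorm Ω r 0 σ f ^ 2 := by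
  rw [hNorm]
  split_ifs with h
  · rw [rpow_half_sq, multiIndices_zero, Finset.sum_singleton, eLpNorm_rpow_mul_sq F]
    obtain ⟨g, hg⟩ := h 0 (by simp [multiIndices_zero])
    rw [wInt_congr ((isWeakDeriv_zero hg.1).weakDeriv_ae_eq F.isOpen)]
  · simp

theorem WL.l2loc (F : VacuumFrame M Ω r S) (hf : WL Ω r μ f) : L2loc Ω f := by
  intro K hK hKc
  have hm := hf.1.mono_measure (Measure.restrict_mono hK le_rfl)
  rw [memLp_two_iff_integrable_sq hm]
  have hi := hf.2.mono_set hK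
  have hc : ContinuousOn (fun x => r x ^ (-μ)) K := (F.contDiffOn_rpow (-μ)).continuousOn.mono hK
  refine (IntegrableOn.continuousOn_mul hc hi hKc).congr_fun (fun x hx => ?_) hKc.measurableSet
  have hr := F.pos x (hK hx)
  simp only []
  rw [← mul_assoc, ← Real.rpow_add hr]
  simp

/-- A function in the weighted space of order two has weak first and second derivatives in the
weighted `L²` space. -/
theorem MemH.wl_weakDeriv (F : VacuumFrame M Ω r S) (hf : MemH Ω r 2 σ f) {α : Fin 3 → ℕ}
    (hα : α ∈ multiIndices 2) :
    IsWeakDeriv Ω α f (weakDeriv Ω α f) ∧ WL Ω r (2 * σ) (weakDeriv Ω α f) := by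
  rw [MemH, hNorm] at hf
  split_ifs at hf with h
  · have hw := isWeakDeriv_weakDeriv (h α hα)
    refine ⟨hw, WL.of_wInt_ne_top F hw.2.1.aestronglyMeasurable ?_⟩
    rw [← eLpNorm_rpow_mul_sq F]
    have h1 : (∑ α ∈ multiIndices 2,
        eLpNorm (fun x => r x ^ σ * weakDeriv Ω α f x) 2 (volume.restrict Ω) ^ 2) ≠ ⊤ := by
      intro h0
      rw [h0] at hf
      simp at hf
    exact ne_top_of_le_ne_top h1 (Finset.single_le_sum (f := fun α =>
      eLpNorm (fun x => r x ^ σ * weakDeriv Ω α f x) 2 (volume.restrict Ω) ^ 2)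
      (fun _ _ => zero_le) hα)
  · exact absurd hf (lt_irrefl _)

theorem MemH.wl (F : VacuumFrame M Ω r S) (hf : MemH Ω r 2 σ f) : WL Ω r (2 * σ) f := by
  obtain ⟨h1, h2⟩ := hf.wl_weakDeriv F mem_multiIndices_two.1
  exact h2.congr ((isWeakDeriv_zero h1.1).weakDeriv_ae_eq F.isOpen).symm

theorem MemH.hasWD (F : VacuumFrame M Ω r S) (hf : MemH Ω r 2 σ f) :
    HasWD Ω f (fun i => weakDeriv Ω (e i) f) :=
  HasWD.of_isWeakDeriv ((hf.wl F).l2loc F)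
    (fun j => (hf.wl_weakDeriv F (mem_multiIndices_two.2.1 j)).2.l2loc F)
    fun j => (hf.wl_weakDeriv F (mem_multiIndices_two.2.1 j)).1

theorem MemH.hasWD_two (F : VacuumFrame M Ω r S) (hf : MemH Ω r 2 σ f) (i : Fin 3) :
    HasWD Ω (weakDeriv Ω (e i) f) (fun l => weakDeriv Ω (e l + e i) f) :=
  HasWD.of_isWeakDeriv ((hf.wl_weakDeriv F (mem_multiIndices_two.2.1 i)).2.l2loc F)
    (fun l => (hf.wl_weakDeriv F (mem_multiIndices_two.2.2 l i)).2.l2loc F)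
    fun l => (hf.wl_weakDeriv F (mem_multiIndices_two.2.1 i)).1.of_two
      (hf.wl_weakDeriv F (mem_multiIndices_two.2.2 l i)).1

/-- The norm of order two is controlled by any common bound for the weak derivatives. -/
theorem MemH.hNorm_sq_le (F : VacuumFrame M Ω r S) (hf : MemH Ω r 2 σ f) {B : ℝ≥0∞}
    (h0 : wInt Ω r (2 * σ) f ≤ B) (h1 : ∀ i, wInt Ω r (2 * σ) (weakDeriv Ω (e i) f) ≤ B)
    (h2 : ∀ i j, wInt Ω r (2 * σ) (weakDeriv Ω (e i + e j) f) ≤ B) :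
    hNorm Ω r 2 σ f ^ 2 ≤ 27 * B := by
  rw [hNorm, if_pos fun α hα => ⟨_, (hf.wl_weakDeriv F hα).1⟩, rpow_half_sq]
  refine (Finset.sum_le_card_nsmul _ _ B fun α hα => ?_).trans ?_
  · rw [eLpNorm_rpow_mul_sq F]
    rcases eq_of_mem_multiIndices_two hα with rfl | ⟨i, rfl⟩ | ⟨i, j, rfl⟩
    · rwa [wInt_congr ((isWeakDeriv_zero (hf.wl_weakDeriv F hα).1.1).weakDeriv_ae_eq F.isOpen)]
    · exact h1 i
    · exact h2 i j
  · rw [nsmul_eq_mul]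
    gcongr
    have : (multiIndices 2).card ≤ 27 := by decide
    exact_mod_cast this

theorem rpow_half_le {A a b : ℝ≥0∞} {K : ℝ≥0} (h : A ≤ K * (a ^ 2 + b ^ 2)) :
    A ^ (1 / 2 : ℝ) ≤ (NNReal.sqrt K : ℝ≥0) * (a + b) := by
  have h1 : A ≤ ((NNReal.sqrt K : ℝ≥0) * (a + b)) ^ 2 := by
    refine h.trans ?_
    rw [mul_pow, ← ENNReal.coe_pow, NNReal.sq_sqrt]
    gcongr
    rw [add_sq]
    exact add_le_add le_self_add le_rfl
  refine (ENNReal.rpow_le_rpow h1 (by norm_num)).trans (le_of_eq ?_)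
  rw [← ENNReal.rpow_natCast, ← ENNReal.rpow_mul]; norm_num

end Norms

end VacuumEuler

namespace VacuumEuler

open Filter Topology

/-! ### The estimates on a time slice -/

section Slice

variable {M lam θ γ : ℝ} {Ω : Set Space} {s r : Space → ℝ} {S : Fin 3 → Fin 3 → Space → ℝ}
  {u : Space → Fin 4 → ℝ} {v L : Fin 3 → Space → ℝ} {P : Fin 3 → Fin 3 → Space → ℝ}
  {Q : Fin 3 → Fin 3 → Fin 3 → Space → ℝ}

theorem sum_wInt_eq (F : VacuumFrame M Ω r S) {μ : ℝ} (hv : ∀ k, WL Ω r μ (v k)) :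
    ∑ k, wInt Ω r μ (v k) = ENNReal.ofReal (∫ x in Ω, r x ^ μ * e1 fun k => v k x) := by
  simp only [e1, Finset.mul_sum]
  rw [integral_finsetSum _ fun k _ => (hv k).2, ENNReal.ofReal_sum_of_nonneg fun k _ => ?_]
  · exact Finset.sum_congr rfl fun k _ => (hv k).wInt_eq F
  · exact setIntegral_nonneg F.isOpen.measurableSet fun x hx =>
      mul_nonneg (Real.rpow_nonneg (F.pos x hx).le _) (sq_nonneg _)

/-- The a priori estimate for possibly infinite right-hand sides. -/
theorem lintegral_estimate (hlam : 0 < lam) (hθ : 0 ≤ θ) (hθ1 : θ ≤ 1) (hθl : θ < lam)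
    (hM : 0 ≤ M) : ∃ C : ℝ≥0, ∀ (Ω : Set Space) (r : Space → ℝ)
      (S : Fin 3 → Fin 3 → Space → ℝ) (v L : Fin 3 → Space → ℝ) (P : Fin 3 → Fin 3 → Space → ℝ)
      (Q : Fin 3 → Fin 3 → Fin 3 → Space → ℝ), VacuumFrame M Ω r S →
      (∀ k, HasWD Ω (v k) (fun i => P i k)) → (∀ i k, HasWD Ω (P i k) (fun l => Q l i k)) →
      (∀ l i k, Q l i k = Q i l k) →
      (∀ x ∈ Ω, ∀ i, L i x = ∑ j, ∑ k, (∑ a, S a j x * S a k x) *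
        (r x * Q j k i x + lam * pd k r x * P j i x
          + θ * (pd i r x * P j k x - pd j r x * P i k x))) →
      (∀ k, WL Ω r (lam + 1) (v k)) → (∀ i k, WL Ω r (lam + 1) (P i k)) →
      (∀ l i k, WL Ω r (lam + 1) (Q l i k)) →
      ∫⁻ x in Ω, ENNReal.ofReal (r x ^ (lam + 1) * (e3 (fun l i k => Q l i k x)
          + e2 (fun i k => P i k x) + e1 (fun k => v k x)))
        ≤ C * (∑ i, wInt Ω r (lam - 1) (L i) + ∑ i, wInt Ω r (lam - 1) (v i)) := by
  obtain ⟨C, hC, H⟩ := coordinate_estimate hlam hθ hθ1 hθl hM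
  refine ⟨C.toNNReal + 1, fun Ω r S v L P Q F hv hP hs hL wv wP wQ => ?_⟩
  by_cases htop : ∑ i, wInt Ω r (lam - 1) (L i) + ∑ i, wInt Ω r (lam - 1) (v i) = ⊤
  · rw [htop, ENNReal.mul_top (by simp)]
    exact le_top
  have hmeas := F.isOpen.measurableSet
  have hLm : ∀ i, AEStronglyMeasurable (L i) (volume.restrict Ω) := fun i => by
    have hSm : ∀ a j, AEStronglyMeasurable (S a j) (volume.restrict Ω) := fun a j =>
      F.aesm (F.smooth_S a j).continuousOn
    have hpm : ∀ i, AEStronglyMeasurable (pd i r) (volume.restrict Ω) := fun i =>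
      F.aesm (contDiffOn_pd F.isOpen i F.smooth_r).continuousOn
    have hrm := F.aesm F.smooth_r.continuousOn
    have : AEStronglyMeasurable (fun x => ∑ j, ∑ k, (∑ a, S a j x * S a k x) *
        (r x * Q j k i x + lam * pd k r x * P j i x
          + θ * (pd i r x * P j k x - pd j r x * P i k x))) (volume.restrict Ω) :=
      Finset.univ.aestronglyMeasurable_fun_sum fun j _ =>
        Finset.univ.aestronglyMeasurable_fun_sum fun k _ =>
          (Finset.univ.aestronglyMeasurable_fun_sum fun a _ => (hSm a j).mul (hSm a k)).mul
            (((hrm.mul (wQ j k i).1).add (((hpm k).const_mul lam).mul (wP j i).1)).add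
              ((((hpm i).mul (wP j k).1).sub ((hpm j).mul (wP i k).1)).const_mul θ))
    refine this.congr ?_
    filter_upwards [ae_restrict_mem hmeas] with x hx
    exact (hL x hx i).symm
  have hfin : ∀ {w : Fin 3 → Space → ℝ}, ∑ i, wInt Ω r (lam - 1) (w i) ≠ ⊤ →
      ∀ i, wInt Ω r (lam - 1) (w i) ≠ ⊤ := fun {w} h i =>
    ne_top_of_le_ne_top h (Finset.single_le_sum (f := fun i => wInt Ω r (lam - 1) (w i)) (fun _ _ => zero_le) (Finset.mem_univ i))
  rw [ENNReal.add_eq_top, not_or] at htop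
  have wL' : ∀ i, WL Ω r (lam - 1) (L i) := fun i => WL.of_wInt_ne_top F (hLm i) (hfin htop.1 i)
  have wv' : ∀ i, WL Ω r (lam - 1) (v i) := fun i =>
    WL.of_wInt_ne_top F (wv i).1 (hfin htop.2 i)
  have hest := H Ω r S v L P Q F ⟨hv, hP, fun x _ l i k => by rw [hs], hL, wv', wL', wP, wQ⟩
  have I4 := ((integrableOn_rpow_mul_e3 wQ).fun_add (integrableOn_rpow_mul_e2 wP)).fun_add
    (integrableOn_rpow_mul_e1 wv)
  simp only [← mul_add] at I4
  have n1 : ∀ (w : Fin 3 → Space → ℝ), 0 ≤ ∫ x in Ω, r x ^ (lam - 1) * e1 fun k => w k x :=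
    fun w => setIntegral_nonneg hmeas fun x hx =>
      mul_nonneg (Real.rpow_nonneg (F.pos x hx).le _) e1_nonneg
  rw [sum_wInt_eq F wL', sum_wInt_eq F wv', ← ENNReal.ofReal_add (n1 L) (n1 v),
    ← integral_add (integrableOn_rpow_mul_e1 wL') (integrableOn_rpow_mul_e1 wv'),
    ← ofReal_integral_eq_lintegral_ofReal I4]
  · simp only [← mul_add]
    refine (ENNReal.ofReal_le_ofReal hest).trans ?_
    rw [ENNReal.ofReal_mul hC]
    gcongr
    rw [ENNReal.ofReal]
    exact_mod_cast le_self_add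
  · filter_upwards [ae_restrict_mem hmeas] with x hx
    exact mul_nonneg (Real.rpow_nonneg (F.pos x hx).le _)
      (add_nonneg (add_nonneg e3_nonneg e2_nonneg) e1_nonneg)

theorem sq_le_e1 (w : Fin 3 → ℝ) (k : Fin 3) : w k ^ 2 ≤ e1 w :=
  Finset.single_le_sum (f := fun k => w k ^ 2) (fun _ _ => sq_nonneg _) (Finset.mem_univ k)

theorem sq_le_e2 (p : Fin 3 → Fin 3 → ℝ) (i k : Fin 3) : p i k ^ 2 ≤ e2 p :=
  (sq_le_e1 (p i) k).trans (Finset.single_le_sum (f := fun i => e1 (p i))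
    (fun _ _ => e1_nonneg) (Finset.mem_univ i))

theorem sq_le_e3 (q : Fin 3 → Fin 3 → Fin 3 → ℝ) (l i k : Fin 3) : q l i k ^ 2 ≤ e3 q :=
  (sq_le_e2 (q l) i k).trans (Finset.single_le_sum (f := fun l => e2 (q l))
    (fun _ _ => e2_nonneg) (Finset.mem_univ l))

theorem sq_rpow_half (a : ℝ≥0∞) : (a ^ 2) ^ (1 / 2 : ℝ) = a := by
  rw [← ENNReal.rpow_natCast, ← ENNReal.rpow_mul]; norm_num

theorem Hmat_symm (u : Fin 4 → ℝ) (i j : Fin 3) : Hmat u i j = Hmat u j i := by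
  simp only [Hmat, eq_comm (a := i), mul_comm (u i.succ)]

theorem lower_succ (X : Fin 4 → ℝ) (k : Fin 3) : lower X k.succ = X k.succ := by
  simp [lower, mink]

theorem Bmat_succ (u : Fin 4 → ℝ) (i j : Fin 3) :
    Bmat u i.succ j = if i = j then 1 else 0 := by
  simp [Bmat, mink]

theorem sq_mul_le {a m X Y : ℝ} (ha : 0 < a) (hY : Y = a⁻¹ * X) (hm : a ≤ m) :
    X ^ 2 ≤ m ^ 2 * Y ^ 2 := by
  have hX : X = a * Y := by rw [hY]; field_simp
  rw [hX, mul_pow]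
  exact mul_le_mul_of_nonneg_right (pow_le_pow_left₀ ha.le hm 2) (sq_nonneg _)

/-- A norm of `X` is controlled by that of `X / a` when `0 < a ≤ M`. Applied with `a = (Γ + r) /
(γ - 1)`, it removes the factor in front of the operators. -/
theorem wInt_le_of_eq_mul (F : VacuumFrame M Ω r S) {μ : ℝ} {a X Y : Space → ℝ}
    (ha : ∀ x ∈ Ω, 0 < a x) (hm : ∀ x ∈ Ω, a x ≤ M)
    (h : ∀ᵐ x ∂(volume.restrict Ω), Y x = (a x)⁻¹ * X x) :
    wInt Ω r μ X ≤ ENNReal.ofReal (M ^ 2) * wInt Ω r μ Y := by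
  refine wInt_le_of_sq_le F (sq_nonneg M) ?_
  filter_upwards [h, ae_restrict_mem F.isOpen.measurableSet] with x hx hxΩ
  exact sq_mul_le (ha x hxΩ) hx (hm x hxΩ)

/-- The estimate for `L̃₁`: the system with `λ = 1 / (γ - 1)` and `θ = 0` decouples, and is
applied to the vector field with three equal components `f`. -/
theorem scalar_estimate (hγ : 1 < γ) (hM : 0 ≤ M) : ∃ C : ℝ≥0, ∀ (Ω : Set Space)
    (s r : Space → ℝ) (u : Space → Fin 4 → ℝ), VacuumFrame M Ω r (bgFrame u) →
    (∀ x ∈ Ω, minkProd (u x) (u x) = -1) → (∀ x ∈ Ω, 0 < u x 0) →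
    (∀ x ∈ Ω, (Gam γ (s x) + r x) / (γ - 1) ≤ M) → ∀ f : Space → ℝ,
    MemH Ω r 2 (1 / (2 * (γ - 1)) + 1 / 2) f →
    hNorm Ω r 2 (1 / (2 * (γ - 1)) + 1 / 2) f ≤
      C * (hNorm Ω r 0 (1 / (2 * (γ - 1)) - 1 / 2) (L1 γ Ω s r u f)
        + weightedL2Norm Ω (fun x => r x ^ ((2 - γ) / (γ - 1))) f) := by
  have hγ0 : 0 < γ - 1 := by linarith
  obtain ⟨C, H⟩ := lintegral_estimate (lam := 1 / (γ - 1)) (θ := 0) (by positivity) le_rfl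
    zero_le_one (by positivity) hM
  refine ⟨NNReal.sqrt (27 * (C * (3 * ((M ^ 2).toNNReal + 1)))),
    fun Ω s r u F hu hu0 hΓ f hf => ?_⟩
  have hE := H Ω r (bgFrame u) (fun _ => f)
    (fun _ x => (Gam γ (s x) + r x) / (γ - 1) * L1 γ Ω s r u f x)
    (fun i _ => weakDeriv Ω (e i) f) (fun l i _ => weakDeriv Ω (e l + e i) f) F
    (fun _ => hf.hasWD F) (fun i _ => hf.hasWD_two F i) (fun l i _ => by rw [add_comm])
  have hσ : 2 * (1 / (2 * (γ - 1)) + 1 / 2) = 1 / (γ - 1) + 1 := by field_simp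
  have hσ' : 2 * (1 / (2 * (γ - 1)) - 1 / 2) = 1 / (γ - 1) - 1 := by field_simp
  have hσ'' : (2 - γ) / (γ - 1) = 1 / (γ - 1) - 1 := by field_simp; ring
  have hfac : ∀ x ∈ Ω, 0 < (Gam γ (s x) + r x) / (γ - 1) := fun x hx =>
    div_pos (add_pos (Gam_pos hγ) (F.pos x hx)) hγ0
  have w0 := hf.wl F
  have w1 := fun i => (hf.wl_weakDeriv F (mem_multiIndices_two.2.1 i)).2
  have w2 := fun i j => (hf.wl_weakDeriv F (mem_multiIndices_two.2.2 i j)).2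
  rw [hσ] at w0
  simp only [hσ] at w1 w2
  specialize hE (fun x hx i => ?_) (fun _ => w0) (fun i _ => w1 i) (fun l i _ => w2 l i)
  · simp only [sum_bgFrame_mul (hu x hx) (hu0 x hx), L1, zero_mul, add_zero]
    have hne := (hfac x hx).ne'
    have e1 : ∀ A : ℝ, (Gam γ (s x) + r x) / (γ - 1) * ((γ - 1) / (Gam γ (s x) + r x) * A) = A :=
      fun A => by
        have := (add_pos (Gam_pos (σ := s x) hγ) (F.pos x hx)).ne'
        field_simp
    rw [e1]
    have hs := Hmat_symm (u x)
    simp only [Fin.sum_univ_three, hs 1 0, hs 2 0, hs 2 1]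
    ring
  set E := ∫⁻ x in Ω, ENNReal.ofReal (r x ^ (1 / (γ - 1) + 1) *
    (e3 (fun l i k => weakDeriv Ω (e l + e i) f x)
      + e2 (fun i k => weakDeriv Ω (e i) f x) + e1 (fun k => f x))) with hEdef
  have hle : ∀ {g : Space → ℝ}, (∀ x, g x ^ 2 ≤ 1 * (e3 (fun l i k => weakDeriv Ω (e l + e i) f x)
      + e2 (fun i k => weakDeriv Ω (e i) f x) + e1 (fun k => f x))) →
      wInt Ω r (2 * (1 / (2 * (γ - 1)) + 1 / 2)) g ≤ E := fun h => by
    rw [hσ]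
    refine (wInt_le_of_sq_le F zero_le_one (Eventually.of_forall h)).trans ?_
    rw [ENNReal.ofReal_one, one_mul]
  have p1 : ∀ x, 0 ≤ e1 (fun _ : Fin 3 => f x) := fun x => e1_nonneg
  have p2 : ∀ x, 0 ≤ e2 (fun i (_ : Fin 3) => weakDeriv Ω (e i) f x) := fun x => e2_nonneg
  have p3 : ∀ x, 0 ≤ e3 (fun l i (_ : Fin 3) => weakDeriv Ω (e l + e i) f x) :=
    fun x => e3_nonneg
  have hN := hf.hNorm_sq_le F (B := E)
    (hle fun x => by
      linarith [p1 x, p2 x, p3 x, sq_le_e1 (fun _ => f x) 0])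
    (fun i => hle fun x => by
      linarith [p1 x, p2 x, p3 x, sq_le_e2 (fun i _ => weakDeriv Ω (e i) f x) i 0])
    (fun i j => hle fun x => by
      linarith [p1 x, p2 x, p3 x, sq_le_e3 (fun l i _ => weakDeriv Ω (e l + e i) f x) i j 0])
  have hL := wInt_le_hNorm_zero_sq F (1 / (2 * (γ - 1)) - 1 / 2) (L1 γ Ω s r u f)
  have hW : weightedL2Norm Ω (fun x => r x ^ ((2 - γ) / (γ - 1))) f ^ 2
      = wInt Ω r (1 / (γ - 1) - 1) f := by rw [weightedL2Norm_sq, hσ'']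
  rw [hσ'] at hL
  have hL' := wInt_le_of_eq_mul F (μ := 1 / (γ - 1) - 1) hfac hΓ
    (X := fun x => (Gam γ (s x) + r x) / (γ - 1) * L1 γ Ω s r u f x) (Y := L1 γ Ω s r u f)
    (by
      filter_upwards [ae_restrict_mem F.isOpen.measurableSet] with x hx
      have := (hfac x hx).ne'
      rw [inv_mul_cancel_left₀ this])
  have key : hNorm Ω r 2 (1 / (2 * (γ - 1)) + 1 / 2) f ^ 2
      ≤ ((27 * (C * (3 * ((M ^ 2).toNNReal + 1))) : ℝ≥0) : ℝ≥0∞)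
        * (hNorm Ω r 0 (1 / (2 * (γ - 1)) - 1 / 2) (L1 γ Ω s r u f) ^ 2
          + weightedL2Norm Ω (fun x => r x ^ ((2 - γ) / (γ - 1))) f ^ 2) := by
    rw [hW]
    refine hN.trans (le_trans (mul_le_mul_right (hE.trans (mul_le_mul_right
      (add_le_add (Finset.sum_le_sum fun _ _ => hL'.trans (mul_le_mul_right hL _)) le_rfl) _)) _) ?_)
    simp only [Finset.sum_const, Finset.card_univ, Fintype.card_fin, nsmul_eq_mul]
    push_cast
    rw [ENNReal.ofReal]
    set X := hNorm Ω r 0 (1 / (2 * (γ - 1)) - 1 / 2) (L1 γ Ω s r u f) ^ 2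
    set W := wInt Ω r (1 / (γ - 1) - 1) f
    have h1 : ((M ^ 2).toNNReal : ℝ≥0∞) * X + W ≤ ((M ^ 2).toNNReal + 1) * (X + W) := by
      rw [mul_add]
      exact add_le_add (mul_le_mul_left le_self_add _)
        (le_mul_of_one_le_left zero_le le_add_self)
    calc 27 * (C * (3 * (((M ^ 2).toNNReal : ℝ≥0∞) * X) + 3 * W))
        = 27 * C * 3 * (((M ^ 2).toNNReal : ℝ≥0∞) * X + W) := by ring
      _ ≤ 27 * C * 3 * (((M ^ 2).toNNReal + 1) * (X + W)) := mul_le_mul_right h1 _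
      _ = 27 * (C * (3 * ((M ^ 2).toNNReal + 1))) * (X + W) := by ring
  have := rpow_half_le key
  rwa [sq_rpow_half] at this

end Slice

end VacuumEuler

namespace VacuumEuler

open Filter Topology

/-! ### The div-curl operator on a time slice -/

section DivCurl

variable {M γ : ℝ} {Ω : Set Space} {s r : Space → ℝ} {S : Fin 3 → Fin 3 → Space → ℝ}
  {u ut : Space → Fin 4 → ℝ}

/-- Algebraic form of `L̃₂ + L̃₃`: the second derivatives of div-curl type add up to `H^{jk}∂_j∂_k`,
and the first order terms to the null-form structure with `θ = 1`. Here `h = H`, `d = ∂r`,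
`ρ = r^{-1/(γ-1)}`. -/
theorem divCurl_algebra {κ r ρ ρ₀ ρ₁ : ℝ} {h P : Fin 3 → Fin 3 → ℝ} {d : Fin 3 → ℝ}
    {Q : Fin 3 → Fin 3 → Fin 3 → ℝ} (hs : ∀ i j, h i j = h j i)
    (hQ : ∀ l i k, Q l i k = Q i l k) (hρ₀ : ρ * ρ₀ = 1) (hρ₁ : ρ * ρ₁ = r) (i : Fin 3) :
    (∑ j, ∑ k, h j k * ((d i * P j k + r * Q i j k) + κ * d j * P i k))
      + (∑ m, ∑ l, ρ * h m l * ((1 + κ) * ρ₀ * d l * (P m i - P i m)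
        + ρ₁ * (Q l m i - Q l i m)))
      = ∑ j, ∑ k, h j k * (r * Q j k i + (1 + κ) * d k * P j i
        + 1 * (d i * P j k - d j * P i k)) := by
  have e : ∀ m l, ρ * h m l * ((1 + κ) * ρ₀ * d l * (P m i - P i m)
        + ρ₁ * (Q l m i - Q l i m))
      = h m l * ((1 + κ) * d l * (P m i - P i m) + r * (Q m l i - Q i l m)) := fun m l => by
    rw [hQ l m, hQ l i]
    linear_combination (h m l * ((1 + κ) * d l * (P m i - P i m))) * hρ₀
      + h m l * (Q m l i - Q i l m) * hρ₁
  have e2 : ∑ j, ∑ k, h j k * (d k * P i j) = ∑ j, ∑ k, h j k * (d j * P i k) := by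
    rw [Finset.sum_comm]
    exact Finset.sum_congr rfl fun k _ => Finset.sum_congr rfl fun j _ => by rw [hs]
  have e3 : ∑ j, ∑ k, h j k * Q i k j = ∑ j, ∑ k, h j k * Q i j k := by
    rw [Finset.sum_comm]
    exact Finset.sum_congr rfl fun k _ => Finset.sum_congr rfl fun j _ => by rw [hs]
  simp only [e]
  have e4 : (∑ j, ∑ k, h j k * ((d i * P j k + r * Q i j k) + κ * d j * P i k))
      + (∑ m, ∑ l, h m l * ((1 + κ) * d l * (P m i - P i m) + r * (Q m l i - Q i l m)))
      - ∑ j, ∑ k, h j k * (r * Q j k i + (1 + κ) * d k * P j i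
        + 1 * (d i * P j k - d j * P i k))
      = r * (∑ j, ∑ k, h j k * Q i j k) - r * (∑ j, ∑ k, h j k * Q i k j)
        + (1 + κ) * ((∑ j, ∑ k, h j k * (d j * P i k)) - ∑ j, ∑ k, h j k * (d k * P i j)) := by
    simp only [Finset.mul_sum, ← Finset.sum_add_distrib, ← Finset.sum_sub_distrib]
    exact Finset.sum_congr rfl fun j _ => Finset.sum_congr rfl fun k _ => by ring
  rw [e2, e3] at e4
  linarith

/-- The spatial components of `(L̃₂ + L̃₃) ũ` in terms of the second derivatives of `ũ`. -/
theorem divCurl_eq (F : VacuumFrame M Ω r S) {σ : ℝ}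
    (hf : ∀ μ, MemH Ω r 2 σ (fun x => ut x μ)) (i : Fin 3) :
    ∀ᵐ x ∂(volume.restrict Ω), (L2 γ Ω s r u ut x + L3 γ Ω s r u ut x) i.succ
      = (γ - 1) / (Gam γ (s x) + r x) * ∑ j, ∑ k, Hmat (u x) j k *
        (r x * weakDeriv Ω (e j + e k) (fun z => ut z i.succ) x
          + (1 + 1 / (γ - 1)) * pd k r x * weakDeriv Ω (e j) (fun z => ut z i.succ) x
          + 1 * (pd i r x * weakDeriv Ω (e j) (fun z => ut z k.succ) x
            - pd j r x * weakDeriv Ω (e i) (fun z => ut z k.succ) x)) := by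
  have hΩ := F.isOpen
  have hQ2 := fun (k i : Fin 3) => (hf k.succ).hasWD_two F i
  have hA : ∀ j k : Fin 3, ∀ᵐ x ∂(volume.restrict Ω),
      weakDeriv Ω (e i) (fun y => r y * weakDeriv Ω (e j) (fun z => ut z k.succ) y) x
      = pd i r x * weakDeriv Ω (e j) (fun z => ut z k.succ) x
        + r x * weakDeriv Ω (e i + e j) (fun z => ut z k.succ) x := fun j k =>
    (((hQ2 k j).smul hΩ F.smooth_r).isWeakDeriv hΩ i).weakDeriv_ae_eq hΩ
  have hB : ∀ m l : Fin 3, ∀ᵐ x ∂(volume.restrict Ω),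
      weakDeriv Ω (e l) (fun y => r y ^ (1 + 1 / (γ - 1)) *
        (weakDeriv Ω (e m) (fun z => ut z i.succ) y
          - weakDeriv Ω (e i) (fun z => ut z m.succ) y)) x
      = pd l (fun y => r y ^ (1 + 1 / (γ - 1))) x * (weakDeriv Ω (e m) (fun z => ut z i.succ) x
          - weakDeriv Ω (e i) (fun z => ut z m.succ) x)
        + r x ^ (1 + 1 / (γ - 1)) * (weakDeriv Ω (e l + e m) (fun z => ut z i.succ) x
          - weakDeriv Ω (e l + e i) (fun z => ut z m.succ) x) := fun m l =>
    ((((hQ2 i m).sub hΩ (hQ2 m i)).smul hΩ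
      (F.contDiffOn_rpow (1 + 1 / (γ - 1)))).isWeakDeriv hΩ l).weakDeriv_ae_eq hΩ
  have hA' := ae_all_iff.2 fun j => ae_all_iff.2 fun k => hA j k
  have hB' := ae_all_iff.2 fun m => ae_all_iff.2 fun l => hB m l
  filter_upwards [hA', hB', ae_restrict_mem hΩ.measurableSet] with x hAx hBx hx
  have hr := F.pos x hx
  have e2 : L2 γ Ω s r u ut x i.succ = (γ - 1) / (Gam γ (s x) + r x) *
      ∑ j, ∑ k, Hmat (u x) j k * ((pd i r x * weakDeriv Ω (e j) (fun z => ut z k.succ) x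
        + r x * weakDeriv Ω (e i + e j) (fun z => ut z k.succ) x)
        + 1 / (γ - 1) * pd j r x * weakDeriv Ω (e i) (fun z => ut z k.succ) x) := by
    simp only [L2, lower_succ, Bmat_succ]
    rw [Finset.sum_eq_single i (fun i' _ hi => by simp [hi.symm]) (by simp)]
    simp only [if_true, one_mul, hAx]
  have e3 : L3 γ Ω s r u ut x i.succ = (γ - 1) / (Gam γ (s x) + r x) *
      ∑ m, ∑ l, r x ^ (-(1 / (γ - 1))) * Hmat (u x) m l *
        ((1 + 1 / (γ - 1)) * r x ^ (1 / (γ - 1)) * pd l r x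
          * (weakDeriv Ω (e m) (fun z => ut z i.succ) x
            - weakDeriv Ω (e i) (fun z => ut z m.succ) x)
        + r x ^ (1 + 1 / (γ - 1)) * (weakDeriv Ω (e l + e m) (fun z => ut z i.succ) x
          - weakDeriv Ω (e l + e i) (fun z => ut z m.succ) x)) := by
    simp only [L3, lower_succ, Bmat_succ]
    rw [Finset.sum_eq_single i (fun i' _ hi => by simp [hi.symm]) (by simp)]
    simp only [if_true, one_mul, hBx, F.pd_rpow _ hx, add_sub_cancel_left]
  rw [Pi.add_apply, e2, e3, ← mul_add]
  congr 1
  refine divCurl_algebra (κ := 1 / (γ - 1)) (r := r x) (h := Hmat (u x))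
    (P := fun j k => weakDeriv Ω (e j) (fun z => ut z k.succ) x) (d := fun j => pd j r x)
    (Q := fun l j k => weakDeriv Ω (e l + e j) (fun z => ut z k.succ) x)
    (Hmat_symm (u x)) (fun l i k => by rw [add_comm]) ?_ ?_ i
  · rw [← Real.rpow_add hr]; simp
  · rw [← Real.rpow_add hr]; simp

/-- The bound for an expression linear in `v`, `P`, `Q` with at most twelve terms. -/
theorem sq_le_of_abs_le {w : Fin 3 → ℝ} {p : Fin 3 → Fin 3 → ℝ} {q : Fin 3 → Fin 3 → Fin 3 → ℝ}
    {z : ℝ} (hz : |z| ≤ 12 * (M * (n1 w + n2 p + n3 q))) :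
    z ^ 2 ≤ 11664 * M ^ 2 * (e3 q + e2 p + e1 w) := by
  have h1 := n1_sq_le (w := w)
  have h2 := n2_sq_le (p := p)
  have h3 := n3_sq_le (q := q)
  have hn : (n1 w + n2 p + n3 q) ^ 2 ≤ 81 * (e3 q + e2 p + e1 w) := by
    have := e1_nonneg (w := w)
    have := e2_nonneg (p := p)
    nlinarith [sq_nonneg (n1 w - n2 p), sq_nonneg (n1 w - n3 q), sq_nonneg (n2 p - n3 q)]
  rw [← sq_abs]
  refine (pow_le_pow_left₀ (abs_nonneg _) hz 2).trans ?_
  have := mul_le_mul_of_nonneg_left hn (sq_nonneg (12 * M))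
  calc (12 * (M * (n1 w + n2 p + n3 q))) ^ 2 = (12 * M) ^ 2 * (n1 w + n2 p + n3 q) ^ 2 := by ring
    _ ≤ _ := this
    _ = _ := by ring

/-- The density controlling a vector field and its first two derivatives. -/
def jetDensity (Ω : Set Space) (v : Fin 3 → Space → ℝ) (x : Space) : ℝ :=
  e3 (fun l i k => weakDeriv Ω (e l + e i) (v k) x) + e2 (fun i k => weakDeriv Ω (e i) (v k) x)
    + e1 (fun k => v k x)

/-- A combination of the `v k` with coefficients bounded up to second order is controlled by the
`v k` up to second order. -/
theorem combination_jet_le (F : VacuumFrame M Ω r S) {σ : ℝ} {v V : Fin 3 → Space → ℝ}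
    {f : Space → ℝ} (hv : ∀ k, MemH Ω r 2 σ (v k)) (hV : ∀ k, ContDiffOn ℝ ∞ (V k) Ω)
    (hV0 : ∀ x ∈ Ω, ∀ k, |V k x| ≤ M) (hV1 : ∀ x ∈ Ω, ∀ k i, |pd i (V k) x| ≤ M)
    (hV2 : ∀ x ∈ Ω, ∀ k i j, |pd i (pd j (V k)) x| ≤ M)
    (hf : ∀ᵐ x ∂(volume.restrict Ω), f x = ∑ k, V k x * v k x) :
    (∀ᵐ x ∂(volume.restrict Ω), f x ^ 2 ≤ 11664 * M ^ 2 * jetDensity Ω v x) ∧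
    (∀ j, ∀ᵐ x ∂(volume.restrict Ω),
      weakDeriv Ω (e j) f x ^ 2 ≤ 11664 * M ^ 2 * jetDensity Ω v x) ∧
    ∀ l j, ∀ᵐ x ∂(volume.restrict Ω),
      weakDeriv Ω (e l + e j) f x ^ 2 ≤ 11664 * M ^ 2 * jetDensity Ω v x := by
  have hΩ := F.isOpen
  have hM := F.M_nonneg
  have hW := HasWD.sum hΩ Finset.univ fun k _ => ((hv k).hasWD F).smul hΩ (hV k)
  have hW2 := fun j => HasWD.sum hΩ Finset.univ fun k _ =>
    (((hv k).hasWD F).smul hΩ (contDiffOn_pd hΩ j (hV k))).add hΩ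
      (((hv k).hasWD_two F j).smul hΩ (hV k))
  have hmem := ae_restrict_mem (μ := volume) hΩ.measurableSet
  have hmul : ∀ {a b N : ℝ}, |a| ≤ M → |b| ≤ N → |a * b| ≤ M * N := fun ha hb => by
    rw [abs_mul]; exact mul_le_mul ha hb (abs_nonneg _) hM
  set N : Space → ℝ := fun x => n1 (fun k => v k x)
    + n2 (fun i k => weakDeriv Ω (e i) (v k) x)
    + n3 (fun l i k => weakDeriv Ω (e l + e i) (v k) x) with hN
  have b0 : ∀ x k, |v k x| ≤ N x := fun x k => by
    have h1 := abs_le_n1 (w := fun k => v k x) k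
    have h2 := n2_nonneg (p := fun i k => weakDeriv Ω (e i) (v k) x)
    have h3 := n3_nonneg (q := fun l i k => weakDeriv Ω (e l + e i) (v k) x)
    simp only [hN]; linarith
  have b1 : ∀ x i k, |weakDeriv Ω (e i) (v k) x| ≤ N x := fun x i k => by
    have h1 := n1_nonneg (w := fun k => v k x)
    have h2 := abs_le_n2 (p := fun i k => weakDeriv Ω (e i) (v k) x) i k
    have h3 := n3_nonneg (q := fun l i k => weakDeriv Ω (e l + e i) (v k) x)
    simp only [hN]; linarith
  have b2 : ∀ x l i k, |weakDeriv Ω (e l + e i) (v k) x| ≤ N x := fun x l i k => by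
    have h1 := n1_nonneg (w := fun k => v k x)
    have h2 := n2_nonneg (p := fun i k => weakDeriv Ω (e i) (v k) x)
    have h3 := abs_le_n3 (q := fun l i k => weakDeriv Ω (e l + e i) (v k) x) l i k
    simp only [hN]; linarith
  have hN0 : ∀ x, 0 ≤ M * N x := fun x => mul_nonneg hM ((abs_nonneg _).trans (b0 x 0))
  refine ⟨?_, fun j => ?_, fun l j => ?_⟩
  · filter_upwards [hf, hmem] with x hx hxΩ
    refine sq_le_of_abs_le ?_
    rw [hx]
    have := abs_sum_le_of_le fun k => hmul (hV0 x hxΩ k) (b0 x k)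
    have := hN0 x
    linarith
  · rw [weakDeriv_congr hΩ hf]
    filter_upwards [(hW.isWeakDeriv hΩ j).weakDeriv_ae_eq hΩ, hmem] with x hx hxΩ
    refine sq_le_of_abs_le ?_
    rw [hx]
    have := abs_sum_le_of_le fun k => (abs_add_le _ _).trans
      (add_le_add (hmul (hV1 x hxΩ k j) (b0 x k)) (hmul (hV0 x hxΩ k) (b1 x j k)))
    have := hN0 x
    linarith
  · rw [weakDeriv_congr hΩ hf]
    filter_upwards [(hW.isWeakDeriv_two hΩ (hW2 j) l).weakDeriv_ae_eq hΩ, hmem] with x hx hxΩ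
    refine sq_le_of_abs_le ?_
    rw [hx]
    have := abs_sum_le_of_le fun k => (abs_add_le _ _).trans (add_le_add
      ((abs_add_le _ _).trans (add_le_add (hmul (hV2 x hxΩ k l j) (b0 x k))
        (hmul (hV1 x hxΩ k j) (b1 x l k))))
      ((abs_add_le _ _).trans (add_le_add (hmul (hV1 x hxΩ k l) (b1 x j k))
        (hmul (hV0 x hxΩ k) (b2 x l j k)))))
    have := hN0 x
    linarith

/-- A vector orthogonal to `U` has its time component determined by the spatial ones. -/
theorem time_component_eq {U X : Fin 4 → ℝ} (hU : 0 < U 0) (h : minkProd U X = 0) :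
    X 0 = ∑ k : Fin 3, U k.succ * (U 0)⁻¹ * X k.succ := by
  simp [minkProd, mink, Fin.sum_univ_four] at h
  have h' : U 0 * X 0 = U 1 * X 1 + U 2 * X 2 + U 3 * X 3 := by linarith
  have e : ∑ k : Fin 3, U k.succ * (U 0)⁻¹ * X k.succ
      = (U 0)⁻¹ * (U 1 * X 1 + U 2 * X 2 + U 3 * X 3) := by
    simp [Fin.sum_univ_three]; ring
  rw [e, ← h']
  field_simp

/-- The estimate for `L̃₂ + L̃₃`: the system with `λ = 1 + 1 / (γ - 1)` and `θ = 1`, applied to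
the spatial components of `ut`. Orthogonality to `u` then recovers the time component. -/
theorem vector_estimate (hγ : 1 < γ) (hM : 0 ≤ M) : ∃ C : ℝ≥0, ∀ (Ω : Set Space)
    (s r : Space → ℝ) (u : Space → Fin 4 → ℝ), VacuumFrame M Ω r (bgFrame u) →
    (∀ x ∈ Ω, minkProd (u x) (u x) = -1) → (∀ x ∈ Ω, 0 < u x 0) →
    (∀ x ∈ Ω, (Gam γ (s x) + r x) / (γ - 1) ≤ M) →
    (∀ k : Fin 3, ContDiffOn ℝ ∞ (fun x => u x k.succ * (u x 0)⁻¹) Ω) →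
    (∀ x ∈ Ω, ∀ k : Fin 3, |u x k.succ * (u x 0)⁻¹| ≤ M ∧
        (∀ i, |pd i (fun x => u x k.succ * (u x 0)⁻¹) x| ≤ M) ∧
        ∀ i j, |pd i (pd j fun x => u x k.succ * (u x 0)⁻¹) x| ≤ M) →
    ∀ ut : Space → Fin 4 → ℝ, (∀ μ, MemH Ω r 2 (1 / (2 * (γ - 1)) + 1) (fun x => ut x μ)) →
    (∀ᵐ x ∂(volume.restrict Ω), minkProd (u x) (ut x) = 0) →
    vecHNorm Ω r 2 (1 / (2 * (γ - 1)) + 1) ut ≤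
      C * (vecHNorm Ω r 0 (1 / (2 * (γ - 1)))
            (fun x => L2 γ Ω s r u ut x + L3 γ Ω s r u ut x)
          + vecWeightedL2Norm Ω (fun x => r x ^ (1 / (γ - 1))) ut) := by
  have hγ0 : 0 < γ - 1 := by linarith
  have hκ : 0 < 1 / (γ - 1) := by positivity
  obtain ⟨C, H⟩ := lintegral_estimate (lam := 1 + 1 / (γ - 1)) (θ := 1) (by positivity)
    zero_le_one le_rfl (by linarith) hM
  refine ⟨NNReal.sqrt (108 * ((11664 * M ^ 2).toNNReal * (C * ((M ^ 2).toNNReal + 1)))),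
    fun Ω s r u F hu hu0 hΓ hV hVb ut hf horth => ?_⟩
  set v : Fin 3 → Space → ℝ := fun k x => ut x k.succ with hvdef
  set X : Space → Fin 4 → ℝ := fun x => L2 γ Ω s r u ut x + L3 γ Ω s r u ut x with hX
  have hv : ∀ k, MemH Ω r 2 (1 / (2 * (γ - 1)) + 1) (v k) := fun k => hf k.succ
  let L : Fin 3 → Space → ℝ := fun i x => ∑ j, ∑ k, Hmat (u x) j k *
        (r x * weakDeriv Ω (e j + e k) (v i) x
          + (1 + 1 / (γ - 1)) * pd k r x * weakDeriv Ω (e j) (v i) x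
          + 1 * (pd i r x * weakDeriv Ω (e j) (v k) x
            - pd j r x * weakDeriv Ω (e i) (v k) x))
  have hσ : 2 * (1 / (2 * (γ - 1)) + 1) = 1 + 1 / (γ - 1) + 1 := by field_simp; ring
  have hσ' : 2 * (1 / (2 * (γ - 1))) = 1 + 1 / (γ - 1) - 1 := by field_simp; ring
  have hσ'' : 1 / (γ - 1) = 1 + 1 / (γ - 1) - 1 := by ring
  have hfac : ∀ x ∈ Ω, 0 < (Gam γ (s x) + r x) / (γ - 1) := fun x hx =>
    div_pos (add_pos (Gam_pos hγ) (F.pos x hx)) hγ0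
  have w0 := fun k => (hv k).wl F
  have w1 := fun i k => ((hv k).wl_weakDeriv F (mem_multiIndices_two.2.1 i)).2
  have w2 := fun i j k => ((hv k).wl_weakDeriv F (mem_multiIndices_two.2.2 i j)).2
  simp only [hσ] at w0 w1 w2
  have hE := H Ω r (bgFrame u) v L (fun i k => weakDeriv Ω (e i) (v k))
    (fun l i k => weakDeriv Ω (e l + e i) (v k)) F (fun k => (hv k).hasWD F)
    (fun i k => (hv k).hasWD_two F i) (fun l i k => by rw [add_comm])
    (fun x hx i => by simp only [sum_bgFrame_mul (hu x hx) (hu0 x hx), L]) w0 w1 w2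
  change ∫⁻ x in Ω, ENNReal.ofReal (r x ^ (1 + 1 / (γ - 1) + 1) * jetDensity Ω v x) ≤ _ at hE
  set E := ∫⁻ x in Ω, ENNReal.ofReal (r x ^ (1 + 1 / (γ - 1) + 1) * jetDensity Ω v x) with hEdef
  set K : ℝ := 11664 * M ^ 2 with hK
  have hK0 : 0 ≤ K := by positivity
  have hle : ∀ {g : Space → ℝ},
      (∀ᵐ x ∂(volume.restrict Ω), g x ^ 2 ≤ K * jetDensity Ω v x) →
      wInt Ω r (2 * (1 / (2 * (γ - 1)) + 1)) g ≤ ENNReal.ofReal K * E := fun h => by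
    rw [hσ]
    exact wInt_le_of_sq_le F hK0 h
  -- every component is a combination of the spatial ones, with smooth coefficients
  have hN : ∀ μ, hNorm Ω r 2 (1 / (2 * (γ - 1)) + 1) (fun x => ut x μ) ^ 2
      ≤ 27 * (ENNReal.ofReal K * E) := by
    intro μ
    refine Fin.cases ?_ (fun k => ?_) μ
    · obtain ⟨h0, h1, h2⟩ := combination_jet_le F (f := fun x => ut x 0) hv hV
        (fun x hx k => (hVb x hx k).1) (fun x hx k => (hVb x hx k).2.1)
        (fun x hx k => (hVb x hx k).2.2) (by
          filter_upwards [horth, ae_restrict_mem F.isOpen.measurableSet] with x hx hxΩ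
          exact time_component_eq (hu0 x hxΩ) hx)
      exact (hf 0).hNorm_sq_le F (hle h0) (fun i => hle (h1 i)) fun i j => hle (h2 i j)
    · have hone : ∀ j, ContDiffOn ℝ ∞ (fun _ : Space => if j = k then (1 : ℝ) else 0) Ω :=
        fun j => contDiffOn_const
      have hpd : ∀ (c : ℝ) (i : Fin 3), pd i (fun _ : Space => c) = fun _ => 0 := fun c i => by
        funext x; simp [pd]
      obtain ⟨h0, h1, h2⟩ := combination_jet_le F (f := v k) hv hone
        (fun x hx j => (by split_ifs <;> simp : |if j = k then (1 : ℝ) else 0| ≤ 1).trans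
          F.one_le)
        (fun x hx j i => by rw [hpd]; simpa using hM)
        (fun x hx j i l => by rw [hpd, hpd]; simpa using hM)
        (Eventually.of_forall fun x => by simp)
      exact (hv k).hNorm_sq_le F (hle h0) (fun i => hle (h1 i)) fun i j => hle (h2 i j)
  have hXL : ∀ i, wInt Ω r (1 + 1 / (γ - 1) - 1) (L i)
      ≤ ENNReal.ofReal (M ^ 2) * hNorm Ω r 0 (1 / (2 * (γ - 1))) (fun x => X x i.succ) ^ 2 := by
    intro i
    refine (wInt_le_of_eq_mul F hfac hΓ (Y := fun x => X x i.succ) ?_).trans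
      (mul_le_mul_right ?_ _)
    · filter_upwards [divCurl_eq (s := s) (u := u) F hf i] with x hx
      rw [inv_div]
      exact hx
    · have := wInt_le_hNorm_zero_sq F (1 / (2 * (γ - 1))) (fun x => X x i.succ)
      rwa [hσ'] at this
  have hXs : ∑ i, wInt Ω r (1 + 1 / (γ - 1) - 1) (L i)
      ≤ ENNReal.ofReal (M ^ 2) * vecHNorm Ω r 0 (1 / (2 * (γ - 1))) X ^ 2 := by
    refine (Finset.sum_le_sum fun i _ => hXL i).trans ?_
    rw [← Finset.mul_sum, vecHNorm, rpow_half_sq, Fin.sum_univ_succ (n := 3)]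
    exact mul_le_mul_right le_add_self _
  have hvs : ∑ i, wInt Ω r (1 + 1 / (γ - 1) - 1) (v i)
      ≤ vecWeightedL2Norm Ω (fun x => r x ^ (1 / (γ - 1))) ut ^ 2 := by
    rw [vecWeightedL2Norm, rpow_half_sq, Fin.sum_univ_succ (n := 3)]
    refine le_trans (Finset.sum_le_sum fun i _ => ?_) le_add_self
    rw [weightedL2Norm_sq, ← hσ'']
  set A := vecHNorm Ω r 0 (1 / (2 * (γ - 1))) X
  set B := vecWeightedL2Norm Ω (fun x => r x ^ (1 / (γ - 1))) ut
  refine rpow_half_le ?_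
  refine (Finset.sum_le_sum fun μ _ => hN μ).trans ?_
  simp only [Finset.sum_const, Finset.card_univ, Fintype.card_fin, nsmul_eq_mul]
  have h1 : ENNReal.ofReal (M ^ 2) * A ^ 2 + B ^ 2
      ≤ ((M ^ 2).toNNReal + 1) * (A ^ 2 + B ^ 2) := by
    rw [mul_add]
    exact add_le_add (mul_le_mul_left le_self_add _)
      (le_mul_of_one_le_left zero_le le_add_self)
  have h2 := hE.trans (mul_le_mul_right ((add_le_add hXs hvs).trans h1) _)
  push_cast
  calc 4 * (27 * (ENNReal.ofReal K * E))
      = 108 * (K.toNNReal * E) := by rw [ENNReal.ofReal]; ring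
    _ ≤ 108 * (K.toNNReal * (C * (((M ^ 2).toNNReal + 1) * (A ^ 2 + B ^ 2)))) :=
        mul_le_mul_right (mul_le_mul_right h2 _) _
    _ = 108 * (K.toNNReal * (C * ((M ^ 2).toNNReal + 1))) * (A ^ 2 + B ^ 2) := by ring

end DivCurl

end VacuumEuler

end

theorem lemmaL (γ T : ℝ) (hγ : 1 < γ) (hT : 0 < T) (Ω : ℝ → Set Space)
    (s r : ℝ → Space → ℝ) (u : ℝ → Space → Fin 4 → ℝ) (hB : VacuumBackground T Ω s r u) :
    (∃ C : ℝ≥0, ∀ t ∈ Icc 0 T, ∀ rt : Space → ℝ,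
      MemH (Ω t) (r t) 2 (1 / (2 * (γ - 1)) + 1 / 2) rt →
      hNorm (Ω t) (r t) 2 (1 / (2 * (γ - 1)) + 1 / 2) rt ≤
        C * (hNorm (Ω t) (r t) 0 (1 / (2 * (γ - 1)) - 1 / 2)
              (L1 γ (Ω t) (s t) (r t) (u t) rt)
            + weightedL2Norm (Ω t) (fun x => r t x ^ ((2 - γ) / (γ - 1))) rt)) ∧
    (∃ C : ℝ≥0, ∀ t ∈ Icc 0 T, ∀ ut : Space → Fin 4 → ℝ,
      (∀ μ, MemH (Ω t) (r t) 2 (1 / (2 * (γ - 1)) + 1) (fun x => ut x μ)) →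
      (∀ᵐ x ∂(volume.restrict (Ω t)), minkProd (u t x) (ut x) = 0) →
      vecHNorm (Ω t) (r t) 2 (1 / (2 * (γ - 1)) + 1) ut ≤
        C * (vecHNorm (Ω t) (r t) 0 (1 / (2 * (γ - 1)))
              (fun x => L2 γ (Ω t) (s t) (r t) (u t) ut x + L3 γ (Ω t) (s t) (r t) (u t) ut x)
            + vecWeightedL2Norm (Ω t) (fun x => r t x ^ (1 / (γ - 1))) ut)) := by
  obtain ⟨M, hM⟩ := hB.exists_vacuumFrame hγ
  have hM0 : 0 ≤ M := (hM 0 (left_mem_Icc.2 hT.le)).1.M_nonneg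
  obtain ⟨C₁, H₁⟩ := scalar_estimate hγ hM0
  obtain ⟨C₂, H₂⟩ := vector_estimate hγ hM0
  refine ⟨⟨C₁, fun t ht rt hrt => ?_⟩, ⟨C₂, fun t ht ut hut horth => ?_⟩⟩
  · obtain ⟨F, hΓ, -⟩ := hM t ht
    exact H₁ (Ω t) (s t) (r t) (u t) F (hB.unit_u t ht) (hB.future_u t ht) hΓ rt hrt
  · obtain ⟨F, hΓ, hV⟩ := hM t ht
    exact H₂ (Ω t) (s t) (r t) (u t) F (hB.unit_u t ht) (hB.future_u t ht) hΓ
      (fun k => (hB.unifC2_velocity k).1 t ht) hV ut hut horth
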